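/- Let $D\equiv 1 \pmod 4$ be a prime, $F=\mathbb Q(\sqrt D)$, and $\omega=\frac{D+\sqrt D}{2}$, so that $\mathcal O_F=\mathbb Z+\mathbb Z\omega$. Let $K=F(\sqrt\Delta)$ be a non-biquadratic quartic CM field with real quadratic subfield $F$ such that $$\mathcal O_K=\mathcal O_F+\mathcal O_F\,\frac{w+\sqrt\Delta}{2},\qquad w=w_0+w_1\omega\in\mathcal O_F\quad (w_0,w_1\in\mathbb Z),$$ and such that $\tilde D=\Delta\Delta'$ is square free and $\equiv 1\pmod 4$, where $\Delta'$ is the Galois conjugate of $\Delta\in\mathcal O_F$. Let $p$ be a prime, $E$ a supersingular elliptic curve over $\overline{\mathbb F}_p$, and $\mathcal O_E=\operatorname{End}(E)$, an order in a division quaternion algebra over $\mathbb Q$ with main involution $x\mapsto\bar x$, reduced trace $\operatorname{tr}$ and reduced norm $\operatorname{Nrd}(x)=x\bar x$. Let $$L_E=\{x\in\mathbb Z+2\mathcal O_E : \operatorname{tr}x=0\}$$ be the Gross lattice, let $(x,y)=\operatorname{Nrd}(x+y)-\operatorname{Nrd}(x)-\operatorname{Nrd}(y)$, and $T(x_1,\dots,x_r)=\frac12\big((x_i,x_j)\big)_{i,j}$.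 Call an integer $n$ admissible if $0<n<\sqrt{\tilde D}$ and $\frac{\tilde D-n^2}{4D}\in p\mathbb Z_{>0}$. For such $n$ and a sign $\mu=\pm1$, a positive definite symmetric integral matrix $T=\begin{pmatrix}a&b\\b&c\end{pmatrix}$ is said to be $T(\mu n)$ if $$\det T=\frac{\tilde D-n^2}{D},\qquad \Delta=\frac{2\mu n-Dc-(2b+Dc)\sqrt D}{2}$$ (there is at most one such matrix), and then $$\tilde T(\mu n)=\begin{pmatrix}1&\frac{w_0}2&\frac{w_1}2\\ \frac{w_0}2&\frac{a+w_0^2}4&\frac{b+w_0w_1}4\\ \frac{w_1}2&\frac{b+w_0w_1}4&\frac{c+w_1^2}4\end{pmatrix}.$$ Consider the following three sets. 1. $I(E)$: the ring embeddings $\iota:\mathcal O_K\hookrightarrow\mathcal O_E\otimes_{\mathbb Z}\mathcal O_F$ such that $\iota(a)=1\otimes a$ for $a\in\mathcal O_F$ and the main involution of $\mathcal O_E$ (acting on the first factor) induces complex conjugation on $\mathcal O_K$ via $\iota$. 2. $\mathbb T(E)$: the pairs $(\delta,\beta)\in L_E^2$ such that $T(\delta,\beta)=T(\mu n)$ for some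 admissible integer $n$ and a unique $\mu=\pm1$. 3. $\tilde{\mathbb T}(E)$: the pairs $(\alpha_0,\beta_0)\in\mathcal O_E^2$ such that $T(1,\alpha_0,\beta_0)=\tilde T(\mu n)$ for some admissible integer $n$ and a unique $\mu=\pm1$. Then there is a one-to-one correspondence among the three sets $I(E)$, $\mathbb T(E)$, $\tilde{\mathbb T}(E)$: there are unique bijections $I(E)\to\mathbb T(E)$, $\iota\mapsto(\delta,\beta)$, and $I(E)\to\tilde{\mathbb T}(E)$, $\iota\mapsto(\alpha_0,\beta_0)$, satisfying for all $\iota\in I(E)$ $$\iota\Big(\frac{w+\sqrt\Delta}2\Big)=\alpha_0+\beta_0\,\frac{D+\sqrt D}2,\qquad \iota(\sqrt\Delta)=\delta+\beta\,\frac{D+\sqrt D}2,\qquad \delta=2\alpha_0-w_0,\quad \beta=2\beta_0-w_1 .$$ -/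

import Mathlib

open Polynomial Filter
open scoped Polynomial.Bivariate TensorProduct NumberField

namespace GrossLattice

/-! ### The endomorphism ring of an elliptic curve over an algebraically closed field -/

section EndomorphismRing

variable {k : Type*} [Field k] (W : WeierstrassCurve k)

/-- The value of a polynomial `A(x, y)` at a point of the curve (with the convention `0` at the
point at infinity, which never matters below). -/
noncomputable def evalAt (A : k[X][Y]) : W.toAffine.Point → k
  | .zero => 0
  | .some x y _ => A.evalEval x y

/-- `f : E(k) → k` is a rational function on `E`: outside finitely many points it is the quotient
of two polynomials in the affine coordinates, the denominator having no zero there. -/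
def IsRational (f : W.toAffine.Point → k) : Prop :=
  ∃ A C : k[X][Y], ∀ᶠ P in cofinite, evalAt W C P ≠ 0 ∧ f P = evalAt W A P / evalAt W C P

variable {W} in
/-- The `x`-coordinate of an affine point (`0` at infinity). -/
def xCoord : W.toAffine.Point → k
  | .zero => 0
  | .some x _ _ => x

variable {W} in
/-- The `y`-coordinate of an affine point (`0` at infinity). -/
def yCoord : W.toAffine.Point → k
  | .zero => 0
  | .some _ y _ => y

/-- A homomorphism of groups `φ : E(k) → E(k)` is algebraic if it is zero, or if for all but
finitely many points `P` the point `φ P` is affine with coordinates rational functions of `P`.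
Since a rational map from a smooth curve to a projective curve is a morphism, over an
algebraically closed field these are exactly the endomorphisms of the elliptic curve `E`. -/
def IsAlgebraicHom [DecidableEq k] (φ : AddMonoid.End W.toAffine.Point) : Prop :=
  φ = 0 ∨ ((∀ᶠ P in cofinite, φ P ≠ 0) ∧ IsRational W (fun P => xCoord (φ P)) ∧
    IsRational W (fun P => yCoord (φ P)))

variable {W}

lemma some_coord {P : W.toAffine.Point} (hP : P ≠ 0) :
    ∃ h : W.toAffine.Nonsingular (xCoord P) (yCoord P), P = .some _ _ h := by
  cases P with
  | zero => exact absurd rfl hP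
  | some x y h => exact ⟨h, rfl⟩

lemma evalAt_of_ne {P : W.toAffine.Point} (hP : P ≠ 0) (A : k[X][Y]) :
    evalAt W A P = A.evalEval (xCoord P) (yCoord P) := by
  cases P with
  | zero => exact absurd rfl hP
  | some x y h => rfl

lemma eventually_ne (Q : W.toAffine.Point) : ∀ᶠ P in cofinite, P ≠ Q :=
  (Set.finite_singleton Q).compl_mem_cofinite

lemma finite_x [DecidableEq k] {s : Set k} (hs : s.Finite) :
    {P : W.toAffine.Point | P ≠ 0 ∧ xCoord P ∈ s}.Finite := by
  have : {P : W.toAffine.Point | P ≠ 0 ∧ xCoord P ∈ s} =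
      ⋃ a ∈ s, {P : W.toAffine.Point | P ≠ 0 ∧ xCoord P = a} := by
    ext P; simp
  rw [this]
  refine hs.biUnion fun a _ => ?_
  by_cases hne : ∃ Q : W.toAffine.Point, Q ≠ 0 ∧ xCoord Q = a
  · obtain ⟨Q, hQ, hQa⟩ := hne
    refine (Set.toFinite {Q, -Q}).subset ?_
    rintro P ⟨hP, hPa⟩
    obtain ⟨h1, e1⟩ := some_coord hP
    obtain ⟨h2, e2⟩ := some_coord hQ
    have hx : xCoord P = xCoord Q := hPa.trans hQa.symm
    have := (WeierstrassCurve.Affine.Point.X_eq_iff (h₁ := h1) (h₂ := h2)).mp hx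
    rwa [← e1, ← e2] at this
  · convert Set.finite_empty
    ext P
    simp only [Set.mem_ofPred_eq, Set.mem_empty_iff_false, iff_false]
    exact fun h => hne ⟨P, h⟩

/-- A polynomial function on the curve vanishes identically or has finitely many zeros. -/
lemma evalAt_dichotomy [DecidableEq k] (A : k[X][Y]) :
    (∀ᶠ P in cofinite, evalAt W A P = 0) ∨ (∀ᶠ P in cofinite, evalAt W A P ≠ 0) := by
  obtain ⟨p, q, hpq⟩ := WeierstrassCurve.Affine.CoordinateRing.exists_smul_basis_eq
    (WeierstrassCurve.Affine.CoordinateRing.mk W.toAffine A)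
  have hval : ∀ x y, W.toAffine.Nonsingular x y →
      A.evalEval x y = p.eval x + q.eval x * y := by
    intro x y h
    have h1 : WeierstrassCurve.Affine.CoordinateRing.mk W.toAffine (C p + C q * Y) =
        WeierstrassCurve.Affine.CoordinateRing.mk W.toAffine A := by
      rw [← hpq, map_add, map_mul, WeierstrassCurve.Affine.CoordinateRing.smul,
        WeierstrassCurve.Affine.CoordinateRing.smul, mul_one]
    obtain ⟨r, hr⟩ := (AdjoinRoot.mk_eq_mk).mp h1
    have h2 := congrArg (fun B => evalEval x y B) hr
    have h3 : W.toAffine.polynomial.evalEval x y = 0 := h.1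
    simp only [evalEval_sub, evalEval_add, evalEval_mul, evalEval_C, h3, zero_mul,
      evalEval_X] at h2
    linear_combination -h2
  by_cases h0 : WeierstrassCurve.Affine.CoordinateRing.mk W.toAffine A = 0
  · left
    filter_upwards [eventually_ne 0] with P hP
    obtain ⟨h, e⟩ := some_coord hP
    rw [evalAt_of_ne hP]
    obtain ⟨r, hr⟩ := (AdjoinRoot.mk_eq_zero).mp h0
    have h3 : W.toAffine.polynomial.evalEval (xCoord P) (yCoord P) = 0 := h.1
    rw [hr, evalEval_mul, h3, zero_mul]
  · right
    have : Module.Finite k[X] W.toAffine.CoordinateRing :=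
      .of_basis (WeierstrassCurve.Affine.CoordinateRing.basis W.toAffine)
    have hN : Algebra.norm k[X] (WeierstrassCurve.Affine.CoordinateRing.mk W.toAffine A) ≠ 0 :=
      Algebra.norm_ne_zero_iff.mpr h0
    have hfin := finite_x (W := W) (Polynomial.finite_setOfPred_isRoot hN)
    filter_upwards [eventually_ne 0, hfin.compl_mem_cofinite] with P hP hP' hA
    apply hP'
    refine ⟨hP, ?_⟩
    obtain ⟨h, e⟩ := some_coord hP
    rw [evalAt_of_ne hP, hval _ _ h] at hA
    have heq := (WeierstrassCurve.Affine.equation_iff' _ _).mp h.1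
    rw [← hpq, WeierstrassCurve.Affine.CoordinateRing.norm_smul_basis, IsRoot]
    simp only [eval_sub, eval_add, eval_mul, eval_pow, eval_C, eval_X]
    linear_combination (p.eval (xCoord P) + q.eval (xCoord P) *
      (-yCoord P - W.a₁ * xCoord P - W.a₃)) * hA + (q.eval (xCoord P)) ^ 2 * heq

lemma IsRational.congr {f g : W.toAffine.Point → k} (hf : IsRational W f)
    (h : ∀ᶠ P in cofinite, g P = f P) : IsRational W g := by
  obtain ⟨A, C, hAC⟩ := hf
  refine ⟨A, C, ?_⟩
  filter_upwards [hAC, h] with P h1 h2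
  exact ⟨h1.1, h2.trans h1.2⟩

lemma isRational_evalAt (A : k[X][Y]) : IsRational W (evalAt W A) := by
  refine ⟨A, 1, ?_⟩
  filter_upwards [eventually_ne 0] with P hP
  simp [evalAt_of_ne hP]

lemma isRational_const (c : k) : IsRational W (fun _ => c) := by
  refine (isRational_evalAt (C (C c))).congr ?_
  filter_upwards [eventually_ne 0] with P hP
  simp [evalAt_of_ne hP]

lemma isRational_xCoord : IsRational W xCoord := by
  refine (isRational_evalAt (C X)).congr ?_
  filter_upwards [eventually_ne 0] with P hP
  rw [evalAt_of_ne hP, evalEval_C, eval_X]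

lemma isRational_yCoord : IsRational W yCoord := by
  refine (isRational_evalAt Y).congr ?_
  filter_upwards [eventually_ne 0] with P hP
  simp [evalAt_of_ne hP]

lemma IsRational.add {f g : W.toAffine.Point → k} (hf : IsRational W f) (hg : IsRational W g) :
    IsRational W (fun P => f P + g P) := by
  obtain ⟨A, C, h1⟩ := hf
  obtain ⟨B, D, h2⟩ := hg
  refine ⟨A * D + C * B, C * D, ?_⟩
  filter_upwards [h1, h2, eventually_ne 0] with P h1 h2 hP
  simp only [evalAt_of_ne hP, evalEval_mul, evalEval_add] at *
  exact ⟨mul_ne_zero h1.1 h2.1, by rw [h1.2, h2.2, div_add_div _ _ h1.1 h2.1]⟩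

lemma IsRational.mul {f g : W.toAffine.Point → k} (hf : IsRational W f) (hg : IsRational W g) :
    IsRational W (fun P => f P * g P) := by
  obtain ⟨A, C, h1⟩ := hf
  obtain ⟨B, D, h2⟩ := hg
  refine ⟨A * B, C * D, ?_⟩
  filter_upwards [h1, h2, eventually_ne 0] with P h1 h2 hP
  simp only [evalAt_of_ne hP, evalEval_mul] at *
  exact ⟨mul_ne_zero h1.1 h2.1, by rw [h1.2, h2.2, div_mul_div_comm]⟩

lemma IsRational.sub {f g : W.toAffine.Point → k} (hf : IsRational W f) (hg : IsRational W g) :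
    IsRational W (fun P => f P - g P) :=
  (hf.add ((isRational_const (-1)).mul hg)).congr (.of_forall fun P => by ring)

lemma IsRational.dichotomy [DecidableEq k] {f : W.toAffine.Point → k} (hf : IsRational W f) :
    (∀ᶠ P in cofinite, f P = 0) ∨ (∀ᶠ P in cofinite, f P ≠ 0) := by
  obtain ⟨A, C, h⟩ := hf
  refine (evalAt_dichotomy (W := W) A).imp (fun hA => ?_) (fun hA => ?_)
  · filter_upwards [h, hA] with P h1 h2
    rw [h1.2, h2, zero_div]
  · filter_upwards [h, hA] with P h1 h2
    rw [h1.2]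
    exact div_ne_zero h2 h1.1

lemma IsRational.inv [DecidableEq k] {f : W.toAffine.Point → k} (hf : IsRational W f) :
    IsRational W (fun P => (f P)⁻¹) := by
  rcases hf.dichotomy with h0 | h0
  · refine (isRational_const 0).congr ?_
    filter_upwards [h0] with P h
    rw [h, inv_zero]
  · obtain ⟨A, C, h⟩ := hf
    refine ⟨C, A, ?_⟩
    filter_upwards [h, h0] with P h1 h2
    refine ⟨fun hA => h2 (by rw [h1.2, hA, zero_div]), by rw [h1.2, inv_div]⟩

lemma IsRational.div [DecidableEq k] {f g : W.toAffine.Point → k} (hf : IsRational W f)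
    (hg : IsRational W g) : IsRational W (fun P => f P / g P) :=
  (hf.mul hg.inv).congr (.of_forall fun P => div_eq_mul_inv _ _)

lemma IsRational.evalEval {f g : W.toAffine.Point → k} (hf : IsRational W f)
    (hg : IsRational W g) (A : k[X][Y]) : IsRational W (fun P => A.evalEval (f P) (g P)) := by
  induction A using Polynomial.induction_on' with
  | add p q hp hq => exact (hp.add hq).congr (.of_forall fun P => by simp)
  | monomial n a =>
    have hpow : ∀ (u : W.toAffine.Point → k), IsRational W u → ∀ m : ℕ,
        IsRational W (fun P => u P ^ m) := by
      intro u hu m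
      induction m with
      | zero => exact (isRational_const 1).congr (.of_forall fun P => pow_zero _)
      | succ m ih => exact (ih.mul hu).congr (.of_forall fun P => pow_succ _ _)
    have ha : IsRational W (fun P => a.eval (f P)) := by
      induction a using Polynomial.induction_on' with
      | add p q hp hq => exact (hp.add hq).congr (.of_forall fun P => by simp)
      | monomial m c =>
        exact ((isRational_const c).mul (hpow f hf m)).congr (.of_forall fun P => by simp)
    refine (ha.mul (hpow g hg n)).congr (.of_forall fun P => ?_)
    simp [Polynomial.evalEval, ← C_mul_X_pow_eq_monomial]

lemma isRational_negY {f g : W.toAffine.Point → k} (hf : IsRational W f) (hg : IsRational W g) :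
    IsRational W (fun P => W.toAffine.negY (f P) (g P)) :=
  ((((isRational_const 0).sub hg).sub ((isRational_const W.a₁).mul hf)).sub
    (isRational_const W.a₃)).congr (.of_forall fun P => by
      simp only [WeierstrassCurve.Affine.negY]; ring)

/-- Over an algebraically closed field an elliptic curve has infinitely many points. -/
lemma infinite_point [IsAlgClosed k] [W.IsElliptic] : Infinite W.toAffine.Point := by
  have : Infinite k := IsAlgClosed.instInfinite
  have hex : ∀ x : k, ∃ P : W.toAffine.Point, xCoord P = x := by
    intro x
    have hd : (X ^ 2 + C (W.a₁ * x + W.a₃) * X -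
        C (x ^ 3 + W.a₂ * x ^ 2 + W.a₄ * x + W.a₆) : k[X]).degree ≠ 0 := by
      have : (X ^ 2 + C (W.a₁ * x + W.a₃) * X -
        C (x ^ 3 + W.a₂ * x ^ 2 + W.a₄ * x + W.a₆) : k[X]).degree = 2 := by
        compute_degree!
      rw [this]
      decide
    obtain ⟨y, hy⟩ := IsAlgClosed.exists_root _ hd
    have heq : W.toAffine.Equation x y := by
      rw [WeierstrassCurve.Affine.equation_iff']
      simp only [IsRoot, eval_sub, eval_add, eval_mul, eval_pow, eval_X, eval_C] at hy
      linear_combination hy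
    exact ⟨.some x y (WeierstrassCurve.Affine.equation_iff_nonsingular.mp heq), rfl⟩
  exact Infinite.of_surjective xCoord hex

section

variable [DecidableEq k]

lemma eq_zero_of_eventually [IsAlgClosed k] [W.IsElliptic] {φ : AddMonoid.End W.toAffine.Point}
    (h : ∀ᶠ P in cofinite, φ P = 0) : φ = 0 := by
  have := infinite_point (W := W)
  refine AddMonoidHom.ext fun Q => ?_
  have hinj : Function.Injective (fun P : W.toAffine.Point => P + Q) := add_left_injective Q
  have h2 := hinj.tendsto_cofinite.eventually h
  obtain ⟨P, h3, h4⟩ := (h.and h2).exists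
  have h5 : φ (P + Q) = 0 := h4
  rw [map_add, h3, zero_add] at h5
  exact h5

/-- A pair of rational functions which eventually gives the coordinates of `φ`. -/
lemma isAlgebraicHom_of {φ : AddMonoid.End W.toAffine.Point} {f g : W.toAffine.Point → k}
    (hf : IsRational W f) (hg : IsRational W g)
    (h : ∀ᶠ P in cofinite, ∃ hP, φ P = .some (f P) (g P) hP) : IsAlgebraicHom W φ := by
  refine Or.inr ⟨?_, hf.congr ?_, hg.congr ?_⟩ <;> filter_upwards [h] with P hP
  · obtain ⟨h1, h2⟩ := hP
    rw [h2]
    exact WeierstrassCurve.Affine.Point.some_ne_zero _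
  · obtain ⟨h1, h2⟩ := hP
    rw [h2]; rfl
  · obtain ⟨h1, h2⟩ := hP
    rw [h2]; rfl

lemma isAlgebraicHom_one : IsAlgebraicHom W (1 : AddMonoid.End W.toAffine.Point) := by
  refine isAlgebraicHom_of isRational_xCoord isRational_yCoord ?_
  filter_upwards [eventually_ne 0] with P hP
  exact some_coord hP

lemma IsAlgebraicHom.neg {φ : AddMonoid.End W.toAffine.Point} (hφ : IsAlgebraicHom W φ) :
    IsAlgebraicHom W (-φ) := by
  rcases hφ with rfl | ⟨h0, hx, hy⟩
  · left; exact neg_zero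
  · refine isAlgebraicHom_of hx (isRational_negY hx hy) ?_
    filter_upwards [h0] with P hP
    obtain ⟨h1, h2⟩ := some_coord hP
    refine ⟨(WeierstrassCurve.Affine.nonsingular_neg _ _).mpr h1, ?_⟩
    change -(φ P) = _
    conv_lhs => rw [h2]
    rfl

lemma IsAlgebraicHom.add [IsAlgClosed k] [W.IsElliptic] {φ ψ : AddMonoid.End W.toAffine.Point}
    (hφ : IsAlgebraicHom W φ) (hψ : IsAlgebraicHom W ψ) : IsAlgebraicHom W (φ + ψ) := by
  rcases hφ with rfl | ⟨h0, hx, hy⟩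
  · rwa [zero_add]
  rcases hψ with rfl | ⟨h0', hx', hy'⟩
  · rw [add_zero]; exact Or.inr ⟨h0, hx, hy⟩
  have key : ∀ s : W.toAffine.Point → k, IsRational W s →
      (∀ᶠ P in cofinite, ¬ (xCoord (φ P) = xCoord (ψ P) ∧
        yCoord (φ P) = W.toAffine.negY (xCoord (ψ P)) (yCoord (ψ P)))) →
      (∀ᶠ P in cofinite, W.toAffine.slope (xCoord (φ P)) (xCoord (ψ P)) (yCoord (φ P))
        (yCoord (ψ P)) = s P) → IsAlgebraicHom W (φ + ψ) := by
    intro s hs hne hslope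
    have hX : IsRational W (fun P => W.toAffine.addX (xCoord (φ P)) (xCoord (ψ P)) (s P)) :=
      (((((hs.mul hs).add ((isRational_const W.a₁).mul hs)).sub (isRational_const W.a₂)).sub
        hx).sub hx').congr (.of_forall fun P => by
          simp only [WeierstrassCurve.Affine.addX]; ring)
    have hNY : IsRational W (fun P => W.toAffine.negAddY (xCoord (φ P)) (xCoord (ψ P))
        (yCoord (φ P)) (s P)) :=
      ((hs.mul (hX.sub hx)).add hy).congr (.of_forall fun P => by
          simp only [WeierstrassCurve.Affine.negAddY])
    refine isAlgebraicHom_of hX (isRational_negY hX hNY) ?_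
    filter_upwards [hne, hslope, h0, h0'] with P h1 h2 h3 h4
    obtain ⟨h5, h6⟩ := some_coord h3
    obtain ⟨h7, h8⟩ := some_coord h4
    have h9 := WeierstrassCurve.Affine.Point.add_some h1 (h₁ := h5) (h₂ := h7)
    rw [← h6, ← h8] at h9
    have h10 := WeierstrassCurve.Affine.nonsingular_add h5 h7 h1
    simp only [h2] at h9 h10
    exact ⟨h10, h9⟩
  rcases (hx.sub hx').dichotomy with hd | hd
  · rcases (hy.sub (isRational_negY hx' hy')).dichotomy with he | he
    · left
      apply eq_zero_of_eventually
      filter_upwards [hd, he, h0, h0'] with P h1 h2 h3 h4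
      obtain ⟨h5, h6⟩ := some_coord h3
      obtain ⟨h7, h8⟩ := some_coord h4
      change φ P + ψ P = 0
      rw [h6, h8]
      exact WeierstrassCurve.Affine.Point.add_of_Y_eq (sub_eq_zero.mp h1) (sub_eq_zero.mp h2)
    · refine key (fun P => (3 * (xCoord (φ P) * xCoord (φ P)) + 2 * W.a₂ * xCoord (φ P) + W.a₄ -
        W.a₁ * yCoord (φ P)) /
          (yCoord (φ P) - W.toAffine.negY (xCoord (φ P)) (yCoord (φ P)))) ?_ ?_ ?_
      · exact (((((isRational_const 3).mul (hx.mul hx)).add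
          ((isRational_const (2 * W.a₂)).mul hx)).add (isRational_const W.a₄)).sub
          ((isRational_const W.a₁).mul hy)).div (hy.sub (isRational_negY hx hy))
      · filter_upwards [he] with P h1 h2
        exact h1 (sub_eq_zero.mpr h2.2)
      · filter_upwards [hd, he] with P h1 h2
        rw [WeierstrassCurve.Affine.slope_of_Y_ne (sub_eq_zero.mp h1) (sub_ne_zero.mp h2), pow_two]
  · refine key (fun P => (yCoord (φ P) - yCoord (ψ P)) / (xCoord (φ P) - xCoord (ψ P)))
      ((hy.sub hy').div (hx.sub hx')) ?_ ?_
    · filter_upwards [hd] with P h1 h2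
      exact h1 (sub_eq_zero.mpr h2.1)
    · filter_upwards [hd] with P h1
      rw [WeierstrassCurve.Affine.slope_of_X_ne (sub_ne_zero.mp h1)]

lemma IsAlgebraicHom.mul {φ ψ : AddMonoid.End W.toAffine.Point}
    (hφ : IsAlgebraicHom W φ) (hψ : IsAlgebraicHom W ψ) : IsAlgebraicHom W (φ * ψ) := by
  rcases hφ with rfl | ⟨h0, hx, hy⟩
  · left; exact zero_mul _
  rcases hψ with rfl | ⟨h0', hx', hy'⟩
  · left; exact mul_zero _
  have hker : {P | ψ P = 0}.Finite := by
    have := h0'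
    rw [eventually_cofinite] at this
    simpa using this
  have htend : Tendsto (fun P => ψ P) cofinite cofinite := by
    refine Tendsto.cofinite_of_finite_preimage_singleton fun Q => ?_
    by_cases hQ : ∃ R, ψ R = Q
    · obtain ⟨R, hR⟩ := hQ
      refine (hker.image (fun P => P + R)).subset ?_
      intro P hP
      have hP' : ψ P = Q := hP
      refine ⟨P - R, ?_, sub_add_cancel P R⟩
      change ψ (P - R) = 0
      rw [map_sub, hP', hR, sub_self]
    · exact Set.finite_empty.subset fun P hP => hQ ⟨P, hP⟩
  have hcomp : ∀ f : W.toAffine.Point → k, IsRational W f → IsRational W (fun P => f (ψ P)) := by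
    rintro f ⟨A, C, h⟩
    by_cases hC : ∀ᶠ P in cofinite, C.evalEval (xCoord (ψ P)) (yCoord (ψ P)) ≠ 0 ∧
        f (ψ P) = A.evalEval (xCoord (ψ P)) (yCoord (ψ P)) /
          C.evalEval (xCoord (ψ P)) (yCoord (ψ P))
    · refine ((hx'.evalEval hy' A).div (hx'.evalEval hy' C)).congr ?_
      filter_upwards [hC] with P h1
      exact h1.2
    · exfalso
      apply hC
      filter_upwards [htend.eventually h, h0'] with P h1 h2
      rwa [evalAt_of_ne h2, evalAt_of_ne h2] at h1
  exact Or.inr ⟨htend.eventually h0, hcomp _ hx, hcomp _ hy⟩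

end

variable (W) in
/-- The ring `O_E = End(E)` of endomorphisms of the elliptic curve `E` over an algebraically
closed field, as a subring of the ring of endomorphisms of the abelian group `E(k)`. -/
def EndRing [DecidableEq k] [IsAlgClosed k] [W.IsElliptic] :
    Subring (AddMonoid.End W.toAffine.Point) where
  carrier := {φ | IsAlgebraicHom W φ}
  zero_mem' := Or.inl rfl
  one_mem' := isAlgebraicHom_one
  add_mem' := fun h1 h2 => h1.add h2
  mul_mem' := fun h1 h2 => h1.mul h2
  neg_mem' := fun h => h.neg

variable (W) in
/-- An elliptic curve over an algebraically closed field of characteristic `p` is supersingular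
if it has no point of order `p`. -/
def IsSupersingular [DecidableEq k] (p : ℕ) : Prop :=
  ∀ P : W.toAffine.Point, p • P = 0 → P = 0

end EndomorphismRing

/-! ### Reduced trace, reduced norm, main involution -/

section Quaternion

variable {R : Type*} [Ring R]

/-- The reduced characteristic polynomial `X ^ 2 - tr(x) X + Nrd(x)` of an element of an order in a
division quaternion algebra over `ℚ`: it is the minimal polynomial of `x` if `x ∉ ℤ`, and
`(X - m) ^ 2` if `x = m ∈ ℤ`. -/
noncomputable def reducedCharpoly (x : R) : ℤ[X] :=
  minpoly ℤ x ^ (2 / (minpoly ℤ x).natDegree)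

/-- The reduced trace. -/
noncomputable def reducedTrace (x : R) : ℤ := -(reducedCharpoly x).coeff 1

/-- The reduced norm. -/
noncomputable def reducedNorm (x : R) : ℤ := (reducedCharpoly x).coeff 0

/-- The main involution `x ↦ tr(x) - x`. -/
noncomputable def mainInvolution (x : R) : R := (reducedTrace x : R) - x

/-- The symmetric bilinear form `(x, y) = Nrd(x + y) - Nrd(x) - Nrd(y)`, for which
`(x, x) = 2 Nrd(x)`. -/
noncomputable def normPairing (x y : R) : ℤ :=
  reducedNorm (x + y) - reducedNorm x - reducedNorm y

/-- The matrix `T(x₁, …, xₙ) = ½ ((xᵢ, xⱼ))`. -/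
noncomputable def gramMatrix {n : ℕ} (x : Fin n → R) : Matrix (Fin n) (Fin n) ℚ :=
  Matrix.of fun i j => (normPairing (x i) (x j) : ℚ) / 2

variable (R) in
/-- The Gross lattice `{x ∈ ℤ + 2 R | tr(x) = 0}`. -/
def grossLattice : Set R :=
  {x | (∃ (m : ℤ) (y : R), x = (m : R) + 2 * y) ∧ reducedTrace x = 0}

end Quaternion

/-! ### The matrices `T(μn)` and `T̃(μn)` -/

section Matrices

variable {F : Type*} [Field F] [NumberField F]

/-- For `F = ℚ(√D)`, `Δ ∈ O_F` and `m = μn`, the conditions which characterize the matrix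
`T(μn) = (a b; b c)`: it is a positive definite symmetric integral matrix with
`det T(μn) = (ΔΔ' - n²) / D` and `Δ = (2μn - Dc - (2b + Dc)√D) / 2`. -/
structure IsTMatrix (D : ℕ) (sqrtD Δ : 𝓞 F) (m : ℤ) (T : Matrix (Fin 2) (Fin 2) ℤ) : Prop where
  isSymm : T.IsSymm
  posDef : (T.map (Int.cast : ℤ → ℝ)).PosDef
  det_eq : (D : ℤ) * T.det = Algebra.norm ℤ Δ - m ^ 2
  delta_eq : 2 * Δ = ((2 * m - D * T 1 1 : ℤ) : 𝓞 F) - ((2 * T 0 1 + D * T 1 1 : ℤ) : 𝓞 F) * sqrtD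

/-- The matrix `T̃ = P diag(1, T) Pᵀ` with `P = (1 0 0; w₀/2 1/2 0; w₁/2 0 1/2)`, written out. -/
def tildeMatrix (w₀ w₁ : ℤ) (T : Matrix (Fin 2) (Fin 2) ℤ) : Matrix (Fin 3) (Fin 3) ℚ :=
  !![1, w₀ / 2, w₁ / 2;
     w₀ / 2, (T 0 0 + w₀ ^ 2) / 4, (T 0 1 + w₀ * w₁) / 4;
     w₁ / 2, (T 0 1 + w₀ * w₁) / 4, (T 1 1 + w₁ ^ 2) / 4]

/-- The integers `n` with `0 < n < √D̃` and `(D̃ - n²) / 4D ∈ p ℤ_{>0}`, where `D̃ = ΔΔ'`. -/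
def IsAdmissible (p D : ℕ) (Δ : 𝓞 F) (n : ℤ) : Prop :=
  0 < n ∧ n ^ 2 < Algebra.norm ℤ Δ ∧
    ∃ j : ℤ, 0 < j ∧ Algebra.norm ℤ Δ - n ^ 2 = 4 * D * (p * j)

/-- The set `𝕋(E)` of pairs `(δ, β)` in the Gross lattice of `R` with `T(δ, β) = T(μn)`
for some admissible `n` and a unique sign `μ`. -/
def latticePairs (R : Type*) [Ring R] (p D : ℕ) (sqrtD Δ : 𝓞 F) : Set (R × R) :=
  {x | x.1 ∈ grossLattice R ∧ x.2 ∈ grossLattice R ∧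
    ∃ n : ℤ, IsAdmissible p D Δ n ∧ ∃! μ : ℤˣ, ∃ T : Matrix (Fin 2) (Fin 2) ℤ,
      IsTMatrix D sqrtD Δ (μ * n) T ∧ gramMatrix ![x.1, x.2] = T.map (Int.cast : ℤ → ℚ)}

/-- The set `𝕋̃(E)` of pairs `(α₀, β₀)` in `R` with `T(1, α₀, β₀) = T̃(μn)`
for some admissible `n` and a unique sign `μ`. -/
def orderPairs (R : Type*) [Ring R] (p D : ℕ) (sqrtD Δ : 𝓞 F) (w₀ w₁ : ℤ) : Set (R × R) :=
  {x | ∃ n : ℤ, IsAdmissible p D Δ n ∧ ∃! μ : ℤˣ, ∃ T : Matrix (Fin 2) (Fin 2) ℤ,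
      IsTMatrix D sqrtD Δ (μ * n) T ∧ gramMatrix ![1, x.1, x.2] = tildeMatrix w₀ w₁ T}

end Matrices

/-- The set `I(E)` of ring embeddings `ι : O_K → R ⊗ O_F` with `ι(a) = 1 ⊗ a` for `a ∈ O_F`, such
that the main involution of `R` (extended to `R ⊗ O_F` as the additive map `J` with
`J(x ⊗ a) = x̄ ⊗ a`) induces complex conjugation on `O_K` via `ι`. -/
def conjEmbeddings (R : Type*) [Ring R] (F K : Type*) [Field F] [NumberField F] [Field K]
    [NumberField K] [Algebra F K] [NumberField.IsCMField K] : Set (𝓞 K →+* R ⊗[ℤ] 𝓞 F) :=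
  {ι | Function.Injective ι ∧ (∀ a : 𝓞 F, ι (algebraMap (𝓞 F) (𝓞 K) a) = 1 ⊗ₜ[ℤ] a) ∧
    ∃ J : (R ⊗[ℤ] 𝓞 F) →+ (R ⊗[ℤ] 𝓞 F),
      (∀ (x : R) (a : 𝓞 F), J (x ⊗ₜ[ℤ] a) = mainInvolution x ⊗ₜ[ℤ] a) ∧
      ∀ z : 𝓞 K, J (ι z) = ι (NumberField.IsCMField.ringOfIntegersComplexConj K z)}

end GrossLattice

/-! The proof splits into an algebraic correspondence and one geometric fact supplied by
supersingularity.

Algebra (`existsUnique_equiv`). Let R carry a positive definite multiplicative quadratic form N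
(`IsNormForm`). Then x² - tr(x) x + N(x) = 0 for every x, so the reduced trace and norm are read off
from N. Since R ⊗ O_F = R ⊕ Rω, an embedding ι amounts to the coordinates α₀, β₀ of ι(θ). Put z =
ι(√Δ) = δ + βω. Compatibility with conjugation says that δ and β have trace zero, and z² = Δ becomes
two integral equations (`IsRootPair`). Let T = (a b; b c) be the Gram matrix of δ, β, let z' = δ +
βω', and m = -½(z, z') = -(a + bD + cD(D - 1)/4). As N(z) = -Δ and N(z') = -Δ', the Gram determinant
of z, z' gives ΔΔ' - m² = (ω - ω')² det T = D det T, so T is T(m). Conversely the two conditions on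
T(m) force this value of m and then the equations for Δ (`IsTMatrix.isRootPair`).

Admissibility: det T = ¼ N([δ, β]) = 4 N([α₀, β₀]), hence (D̃ - m²)/4D = N([α₀, β₀]). It is nonzero
because K would be biquadratic if D̃ were a square (`IsCMData.isKleinFour`); m ≠ 0 because D̃ ≡ 1
mod 4; divisibility by p is the geometric input. A pair in the Gross lattice has the form (2α₀ - w₀,
2β₀ - w₁) because Δ ≡ w² mod 4 and squaring is injective on O_F/2.

Geometry (`exists_isNormForm_endRing`). The form N is the degree, defined as the degree of the
rational function by which an endomorphism acts on x-coordinates. Composition gives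
multiplicativity; the quadratic forms expressing {x(P+Q), x(P-Q)} through {x(P), x(Q)} give the
parallelogram law. On a supersingular curve, a degree divisible by p means vanishing derivative,
since a separable endomorphism has a kernel of order equal to its degree and there is no p-torsion.
Endomorphisms with vanishing derivative are closed under addition, so those of degree divisible by p
form a two-sided ideal. By Chevalley–Warning some nontrivial combination of 1, α, β lies in it, and
commutators with this element show that [α, β] lies in it too. -/

namespace GrossLattice

/-! ### Degrees of morphisms from the projective line to projective spaces -/

section PrimitiveVectors

variable {k : Type*} [Field k] {ι κ : Type*}

/-- A vector of polynomials which defines a morphism of degree `d` from the projective line to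
a projective space: the entries have degree at most `d` and no common zero, not even at infinity. -/
structure IsPrimitiveOfDegree (v : ι → k[X]) (d : ℕ) : Prop where
  natDegree_le : ∀ i, (v i).natDegree ≤ d
  coeff_ne_zero : (fun i => (v i).coeff d) ≠ 0
  eval_ne_zero : ∀ x, (fun i => (v i).eval x) ≠ 0

/-- The ideal of the entries is principal; a generator that is not a unit has a root, which would be
a common zero. -/
lemma IsPrimitiveOfDegree.exists_sum_eq_one [IsAlgClosed k] [Fintype ι] {v : ι → k[X]} {d : ℕ}
    (hv : IsPrimitiveOfDegree v d) : ∃ c : ι → k[X], ∑ i, c i * v i = 1 := by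
  have htop : Ideal.span (Set.range v) = ⊤ := by
    by_contra hne
    obtain ⟨g, hg⟩ := (IsPrincipalIdealRing.principal (Ideal.span (Set.range v))).principal
    have hg' : Ideal.span (Set.range v) = Ideal.span {g} := hg
    have hdeg : g.degree ≠ 0 := by
      intro h0
      apply hne
      rw [hg', Ideal.span_singleton_eq_top]
      exact isUnit_iff_degree_eq_zero.mpr h0
    obtain ⟨x, hx⟩ := IsAlgClosed.exists_root g hdeg
    apply hv.eval_ne_zero x
    funext i
    have : v i ∈ Ideal.span {g} := hg' ▸ Ideal.subset_span ⟨i, rfl⟩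
    obtain ⟨r, hr⟩ := Ideal.mem_span_singleton.mp this
    simp [hr, hx.eq_zero]
  have h1 : (1 : k[X]) ∈ Ideal.span (Set.range v) := htop ▸ Submodule.mem_top
  obtain ⟨c, hc⟩ := (Ideal.mem_span_range_iff_exists_fun).mp h1
  exact ⟨c, hc⟩

/-- Two primitive vectors which define the same morphism are proportional by a constant. -/
lemma IsPrimitiveOfDegree.exists_eq_C_mul [IsAlgClosed k] [Fintype ι] {v w : ι → k[X]} {d e : ℕ}
    (hv : IsPrimitiveOfDegree v d) (hw : IsPrimitiveOfDegree w e)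
    (h : ∀ i j, v i * w j = v j * w i) : ∃ c : k, c ≠ 0 ∧ ∀ i, w i = C c * v i := by
  obtain ⟨c, hc⟩ := hv.exists_sum_eq_one
  set g := ∑ i, c i * w i with hg
  -- Proportionality turns the Bézout relation for v into w = g v; a root of g would be a common
  -- zero of w, so g is constant.
  have hw' : ∀ j, w j = g * v j := by
    intro j
    rw [hg, Finset.sum_mul, ← one_mul (w j), ← hc, Finset.sum_mul]
    refine Finset.sum_congr rfl fun i _ => ?_
    rw [mul_assoc, h i j]
    ring
  have hdeg : g.degree = 0 := by
    by_contra h0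
    obtain ⟨x, hx⟩ := IsAlgClosed.exists_root g h0
    apply hw.eval_ne_zero x
    funext i
    simp [hw' i, hx.eq_zero]
  rw [eq_C_of_degree_eq_zero hdeg] at hw'
  refine ⟨g.coeff 0, fun h0 => ?_, hw'⟩
  apply hw.eval_ne_zero 0
  funext i
  simp [hw' i, h0]

lemma IsPrimitiveOfDegree.le_of_eq_C_mul {v w : ι → k[X]} {d e : ℕ}
    (hv : IsPrimitiveOfDegree v d) (hw : IsPrimitiveOfDegree w e) {c : k}
    (h : ∀ i, w i = C c * v i) : e ≤ d := by
  by_contra! hlt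
  apply hw.coeff_ne_zero
  funext i
  rw [h i]
  simp [coeff_eq_zero_of_natDegree_lt ((hv.natDegree_le i).trans_lt hlt)]

/-- This makes the degree of an endomorphism well defined. After scaling by a constant, the
condition at infinity forbids either bound from exceeding the other. -/
lemma IsPrimitiveOfDegree.unique [IsAlgClosed k] [Fintype ι] {v w : ι → k[X]} {d e : ℕ}
    (hv : IsPrimitiveOfDegree v d) (hw : IsPrimitiveOfDegree w e)
    (h : ∀ i j, v i * w j = v j * w i) : d = e := by
  obtain ⟨c, _, hc⟩ := hv.exists_eq_C_mul hw h
  obtain ⟨c', _, hc'⟩ := hw.exists_eq_C_mul hv fun i j => by rw [mul_comm, ← h i j, mul_comm]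
  exact le_antisymm (hw.le_of_eq_C_mul hv hc') (hv.le_of_eq_C_mul hw hc)

lemma eval_aeval_mvPolynomial (G : MvPolynomial ι k) (v : ι → k[X]) (x : k) :
    (MvPolynomial.aeval v G).eval x = MvPolynomial.eval (fun i => (v i).eval x) G := by
  induction G using MvPolynomial.induction_on with
  | C a => simp
  | add p q hp hq => simp [hp, hq]
  | mul_X p i hp => simp [hp]

lemma natDegree_coeff_prod_pow {v : ι → k[X]} {d : ℕ} (hv : ∀ i, (v i).natDegree ≤ d)
    (s : Finset ι) (m : ι → ℕ) :
    (∏ i ∈ s, v i ^ m i).natDegree ≤ (∑ i ∈ s, m i) * d ∧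
    (∏ i ∈ s, v i ^ m i).coeff ((∑ i ∈ s, m i) * d) = ∏ i ∈ s, (v i).coeff d ^ m i := by
  classical
  induction s using Finset.induction_on with
  | empty => simp
  | insert a s ha ih =>
    rw [Finset.prod_insert ha, Finset.sum_insert ha, Finset.prod_insert ha, add_mul]
    have h1 : (v a ^ m a).natDegree ≤ m a * d := natDegree_pow_le_of_le _ (hv a)
    refine ⟨natDegree_mul_le_of_le h1 ih.1, ?_⟩
    rw [coeff_mul_add_eq_of_natDegree_le h1 ih.1, ih.2, coeff_pow_of_natDegree_le (hv a)]

/-- The coefficient in degree e d is the value of G at the point at infinity of v, so infinity can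
be treated like any other point. -/
lemma natDegree_coeff_aeval_of_isHomogeneous {G : MvPolynomial ι k} {e : ℕ}
    (hG : G.IsHomogeneous e) {v : ι → k[X]} {d : ℕ} (hv : ∀ i, (v i).natDegree ≤ d) :
    (MvPolynomial.aeval v G).natDegree ≤ e * d ∧
    (MvPolynomial.aeval v G).coeff (e * d) =
      MvPolynomial.eval (fun i => (v i).coeff d) G := by
  have hterm : ∀ m ∈ G.support, m.support.sum m = e := by
    intro m hm
    have := hG (MvPolynomial.mem_support_iff.mp hm)
    rwa [Pi.one_def, ← Finsupp.degree_eq_weight_one, Finsupp.degree_apply] at this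
  rw [MvPolynomial.aeval_def, MvPolynomial.eval₂_eq, MvPolynomial.eval_eq]
  constructor
  · refine natDegree_sum_le_of_forall_le _ _ fun m hm => ?_
    have := (natDegree_coeff_prod_pow hv m.support m).1
    rw [hterm m hm] at this
    exact (natDegree_C_mul_le _ _).trans this
  · rw [finsetSum_coeff]
    refine Finset.sum_congr rfl fun m hm => ?_
    have := (natDegree_coeff_prod_pow hv m.support m).2
    rw [hterm m hm] at this
    rw [← this]
    exact coeff_C_mul _

/-- A morphism of projective spaces, given by forms of degree `e`, multiplies degrees by `e`. -/
lemma IsPrimitiveOfDegree.aeval {v : ι → k[X]} {d e : ℕ} (hv : IsPrimitiveOfDegree v d)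
    {G : κ → MvPolynomial ι k} (hG : ∀ j, (G j).IsHomogeneous e)
    (hG0 : ∀ x : ι → k, x ≠ 0 → (fun j => MvPolynomial.eval x (G j)) ≠ 0) :
    IsPrimitiveOfDegree (fun j => MvPolynomial.aeval v (G j)) (e * d) where
  natDegree_le j := (natDegree_coeff_aeval_of_isHomogeneous (hG j) hv.natDegree_le).1
  coeff_ne_zero := by
    simp only [(natDegree_coeff_aeval_of_isHomogeneous (hG _) hv.natDegree_le).2]
    exact hG0 _ hv.coeff_ne_zero
  eval_ne_zero x := by
    simp only [eval_aeval_mvPolynomial]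
    exact hG0 _ (hv.eval_ne_zero x)

/-- The homogenization in degree `d` of a polynomial. -/
noncomputable def homogenization (d : ℕ) (a : k[X]) : MvPolynomial (Fin 2) k :=
  ∑ j ∈ Finset.range (d + 1),
    MvPolynomial.C (a.coeff j) * (MvPolynomial.X 0 ^ j * MvPolynomial.X 1 ^ (d - j))

lemma isHomogeneous_homogenization (d : ℕ) (a : k[X]) : (homogenization d a).IsHomogeneous d := by
  refine MvPolynomial.IsHomogeneous.sum _ _ _ fun j hj => ?_
  have h1 := ((MvPolynomial.isHomogeneous_X_pow (R := k) (0 : Fin 2) j).mul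
    (MvPolynomial.isHomogeneous_X_pow (1 : Fin 2) (d - j))).C_mul (a.coeff j)
  rwa [Nat.add_sub_cancel' (Finset.mem_range_succ_iff.mp hj)] at h1

lemma eval_homogenization (d : ℕ) (a : k[X]) (x : Fin 2 → k) :
    MvPolynomial.eval x (homogenization d a) =
      ∑ j ∈ Finset.range (d + 1), a.coeff j * (x 0 ^ j * x 1 ^ (d - j)) := by
  simp [homogenization]

lemma eval_homogenization_of_ne {d : ℕ} {a : k[X]} (ha : a.natDegree ≤ d) {x : Fin 2 → k}
    (hx : x 1 ≠ 0) :
    MvPolynomial.eval x (homogenization d a) = x 1 ^ d * a.eval (x 0 / x 1) := by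
  rw [eval_homogenization, eval_eq_sum_range' (Nat.lt_succ_of_le ha), Finset.mul_sum]
  refine Finset.sum_congr rfl fun j hj => ?_
  obtain ⟨i, rfl⟩ := Nat.exists_eq_add_of_le (Finset.mem_range_succ_iff.mp hj)
  rw [Nat.add_sub_cancel_left, pow_add, div_pow]
  field_simp

lemma eval_homogenization_of_eq {d : ℕ} {a : k[X]} {x : Fin 2 → k} (hx : x 1 = 0) :
    MvPolynomial.eval x (homogenization d a) = x 0 ^ d * a.coeff d := by
  rw [eval_homogenization, Finset.sum_range_succ, Finset.sum_eq_zero, hx]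
  · simp [mul_comm]
  · intro j hj
    have := Finset.mem_range.mp hj
    simp [hx, zero_pow (show d - j ≠ 0 by omega)]

lemma IsPrimitiveOfDegree.homogenization_ne_zero {v : ι → k[X]} {d : ℕ}
    (hv : IsPrimitiveOfDegree v d) {x : Fin 2 → k} (hx : x ≠ 0) :
    (fun i => MvPolynomial.eval x (homogenization d (v i))) ≠ 0 := by
  intro h
  by_cases h1 : x 1 = 0
  · have h0 : x 0 ≠ 0 := fun h0 => hx (by ext i; fin_cases i <;> simp [h0, h1])
    apply hv.coeff_ne_zero
    funext i
    have := congrFun h i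
    simp only [eval_homogenization_of_eq h1] at this
    exact (mul_eq_zero.mp this).resolve_left (pow_ne_zero _ h0)
  · apply hv.eval_ne_zero (x 0 / x 1)
    funext i
    have := congrFun h i
    simp only [eval_homogenization_of_ne (hv.natDegree_le i) h1] at this
    exact (mul_eq_zero.mp this).resolve_left (pow_ne_zero _ h1)

/-- Composition multiplies the degrees of rational functions. -/
lemma IsPrimitiveOfDegree.comp {v w : Fin 2 → k[X]} {d e : ℕ} (hv : IsPrimitiveOfDegree v d)
    (hw : IsPrimitiveOfDegree w e) :
    IsPrimitiveOfDegree (fun i => MvPolynomial.aeval w (homogenization d (v i))) (d * e) :=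
  hw.aeval (fun _ => isHomogeneous_homogenization _ _) fun _ hx => hv.homogenization_ne_zero hx

/-- The coefficients of the product of two binary linear forms. -/
def symProd {R : Type*} [CommRing R] (v w : Fin 2 → R) : Fin 3 → R :=
  ![v 0 * w 0, v 0 * w 1 + v 1 * w 0, v 1 * w 1]

/-- A product of two nonzero linear forms over a domain is nonzero; hence the symmetric product is a
morphism from ℙ¹ × ℙ¹ to ℙ². -/
lemma symProd_ne_zero {R : Type*} [CommRing R] [IsDomain R] {v w : Fin 2 → R} (hv : v ≠ 0)
    (hw : w ≠ 0) : symProd v w ≠ 0 := by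
  intro h
  have h0 : v 0 * w 0 = 0 := congrFun h 0
  have h1 : v 0 * w 1 + v 1 * w 0 = 0 := congrFun h 1
  have h2 : v 1 * w 1 = 0 := congrFun h 2
  rcases mul_eq_zero.mp h0 with h3 | h3
  · have h4 : v 1 ≠ 0 := fun h4 => hv (by ext i; fin_cases i <;> simp [h3, h4])
    apply hw
    have h5 := (mul_eq_zero.mp h2).resolve_left h4
    rw [h3, zero_mul, zero_add] at h1
    have h6 := (mul_eq_zero.mp h1).resolve_left h4
    ext i; fin_cases i <;> simp [h5, h6]
  · have h4 : w 1 ≠ 0 := fun h4 => hw (by ext i; fin_cases i <;> simp [h3, h4])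
    apply hv
    have h5 := (mul_eq_zero.mp h2).resolve_right h4
    rw [h3, mul_zero, add_zero] at h1
    have h6 := (mul_eq_zero.mp h1).resolve_right h4
    ext i; fin_cases i <;> simp [h5, h6]

lemma IsPrimitiveOfDegree.symProd {v w : Fin 2 → k[X]} {d e : ℕ} (hv : IsPrimitiveOfDegree v d)
    (hw : IsPrimitiveOfDegree w e) : IsPrimitiveOfDegree (symProd v w) (d + e) where
  natDegree_le i := by
    have h := fun i j => natDegree_mul_le_of_le (hv.natDegree_le i) (hw.natDegree_le j)
    have h' := fun i j => natDegree_mul_le_of_le (hv.natDegree_le i) (hw.natDegree_le j)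
    fin_cases i
    · exact h 0 0
    · exact (natDegree_add_le_of_degree_le (h 0 1) (h 1 0))
    · exact h 1 1
  coeff_ne_zero := by
    have h := fun i j => coeff_mul_add_eq_of_natDegree_le (hv.natDegree_le i) (hw.natDegree_le j)
    have : (fun i => (GrossLattice.symProd v w i).coeff (d + e)) =
        GrossLattice.symProd (fun i => (v i).coeff d) (fun i => (w i).coeff e) := by
      ext i
      fin_cases i <;> simp [GrossLattice.symProd, h]
    rw [this]
    exact symProd_ne_zero hv.coeff_ne_zero hw.coeff_ne_zero
  eval_ne_zero x := by
    have : (fun i => (GrossLattice.symProd v w i).eval x) =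
        GrossLattice.symProd (fun i => (v i).eval x) (fun i => (w i).eval x) := by
      ext i
      fin_cases i <;> simp [GrossLattice.symProd]
    rw [this]
    exact symProd_ne_zero (hv.eval_ne_zero x) (hw.eval_ne_zero x)

/-- A coprime pair with vanishing Wronskian has vanishing derivatives. -/
lemma IsPrimitiveOfDegree.derivative_eq_zero [IsAlgClosed k] {v : Fin 2 → k[X]} {d : ℕ}
    (hv : IsPrimitiveOfDegree v d)
    (h : derivative (v 0) * v 1 = v 0 * derivative (v 1)) (i : Fin 2) :
    derivative (v i) = 0 := by
  obtain ⟨c, hc⟩ := hv.exists_sum_eq_one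
  rw [Fin.sum_univ_two] at hc
  have hcop : IsCoprime (v 0) (v 1) := ⟨c 0, c 1, hc⟩
  -- By coprimality each entry divides its own derivative, which has smaller degree unless it is
  -- zero.
  have aux : ∀ a : k[X], a ∣ derivative a → derivative a = 0 := by
    intro a ha
    by_cases hd : a.degree = 0 ∨ a = 0
    · rcases hd with hd | hd
      · rw [eq_C_of_degree_eq_zero hd, derivative_C]
      · rw [hd, derivative_zero]
    · push Not at hd
      by_contra h0
      exact (degree_le_of_dvd ha h0).not_gt (degree_derivative_lt hd.2)
  fin_cases i
  · exact aux _ (hcop.dvd_of_dvd_mul_right (h ▸ dvd_mul_right _ _))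
  · exact aux _ (hcop.symm.dvd_of_dvd_mul_left (h ▸ dvd_mul_left _ _))

/-- The coefficient of degree d - 1 in the derivative is d times the coefficient of degree d, and
the latter is nonzero for some entry. -/
lemma dvd_of_derivative_eq_zero {p : ℕ} [CharP k p] {v : ι → k[X]} {d : ℕ}
    (hv : IsPrimitiveOfDegree v d) (h : ∀ i, derivative (v i) = 0) : p ∣ d := by
  obtain ⟨i, hi⟩ := Function.ne_iff.mp hv.coeff_ne_zero
  rcases Nat.eq_zero_or_pos d with rfl | hd
  · exact dvd_zero _
  have h1 := congrArg (fun q => q.coeff (d - 1)) (h i)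
  simp only [coeff_derivative, coeff_zero] at h1
  rw [Nat.sub_add_cancel hd, ← Nat.cast_add_one, Nat.sub_add_cancel hd] at h1
  exact (CharP.cast_eq_zero_iff k p d).mp ((mul_eq_zero.mp h1).resolve_left hi)

end PrimitiveVectors

/-! ### The x-coordinates of P + Q and P - Q in terms of those of P and Q -/

section AddSub

open WeierstrassCurve

variable {k : Type*} [Field k] {W : WeierstrassCurve k}

lemma eval_addSubMap (W : WeierstrassCurve k) (x : Fin 3 → k) :
    (fun i => MvPolynomial.eval x (W.addSubMap i)) =
      ![x 0 ^ 2 - W.b₄ * x 0 * x 2 - W.b₆ * x 1 * x 2 - W.b₈ * x 2 ^ 2,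
        2 * x 1 * x 0 + W.b₂ * x 0 * x 2 + W.b₄ * x 1 * x 2 + W.b₆ * x 2 ^ 2,
        x 1 ^ 2 - 4 * x 0 * x 2] := by
  ext i
  fin_cases i <;> simp [addSubMap]

variable [DecidableEq k]

/-- The duplication formula. For 2P = 0 the target is (1, 0, 0) and the scalar is the quartic
numerator of that formula; otherwise it is the squared denominator (2y + a₁x + a₃)². -/
lemma exists_addSubMap_self_eq (P : W.toAffine.Point) :
    ∃ c : k, (fun i => MvPolynomial.eval (P.sym2x P) (W.addSubMap i)) =
      c • (P + P).sym2x (P - P) := by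
  rw [eval_addSubMap, sub_self]
  cases P with
  | zero => exact ⟨1, by ext i; fin_cases i <;> simp [← Affine.Point.zero_def]⟩
  | some x y h =>
    have heq := (Affine.equation_iff _ _).mp h.1
    by_cases hy : y = W.toAffine.negY x y
    · rw [Affine.Point.add_self_of_Y_eq hy]
      refine ⟨x ^ 4 - W.b₄ * x ^ 2 - 2 * W.b₆ * x - W.b₈, ?_⟩
      have h0 : 2 * y + W.a₁ * x + W.a₃ = 0 := by
        rw [Affine.negY] at hy; linear_combination hy
      ext i
      fin_cases i
      · simp; ring
      · simp [b₂, b₄, b₆]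
        linear_combination (2 * y + W.a₁ * x + W.a₃) * h0 - 4 * heq
      · simp; ring
    · rw [Affine.Point.add_self_of_Y_ne hy]
      have h0 : 2 * y + W.a₁ * x + W.a₃ ≠ 0 := by
        intro h0; apply hy; rw [Affine.negY]; linear_combination h0
      refine ⟨(2 * y + W.a₁ * x + W.a₃) ^ 2, ?_⟩
      have hs : W.toAffine.slope x x y y * (2 * y + W.a₁ * x + W.a₃) =
          3 * x ^ 2 + 2 * W.a₂ * x + W.a₄ - W.a₁ * y := by
        rw [Affine.slope_of_Y_ne rfl hy, Affine.negY, div_mul_eq_mul_div, div_eq_iff]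
        · ring
        · intro h; apply h0; linear_combination h
      ext i
      fin_cases i
      · simp [Affine.addX, b₄, b₆, b₈]
        generalize W.toAffine.slope x x y y = l at hs ⊢
        grind
      · simp [b₂, b₄, b₆]
        linear_combination - 4 * heq
      · simp; ring

/-- The source of the parallelogram law: the unordered pair {x(P + Q), x(P - Q)} is a function of
{x(P), x(Q)}, given by quadratic forms. -/
lemma exists_addSubMap_eq (P Q : W.toAffine.Point) :
    ∃ c : k, (fun i => MvPolynomial.eval (P.sym2x Q) (W.addSubMap i)) =
      c • (P + Q).sym2x (P - Q) := by
  by_cases hPQ : P = Q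
  · subst hPQ; exact exists_addSubMap_self_eq P
  by_cases hPQ' : P = -Q
  · obtain ⟨c, hc⟩ := exists_addSubMap_self_eq P
    refine ⟨c, ?_⟩
    have : Q = -P := by rw [hPQ', neg_neg]
    rw [this, Affine.Point.sym2x_neg_right, hc, Affine.Point.sym2x_comm, sub_neg_eq_add, 
      sub_eq_add_neg]
  rw [eval_addSubMap]
  cases P with
  | zero =>
    refine ⟨1, ?_⟩
    rw [← Affine.Point.zero_def, zero_add, zero_sub, Affine.Point.sym2x_neg_right]
    cases Q with
    | zero => exact absurd rfl hPQ
    | some x y h => ext i; fin_cases i <;> simp <;> ring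
  | some x₁ y₁ h₁ =>
    cases Q with
    | zero =>
      refine ⟨1, ?_⟩
      rw [← Affine.Point.zero_def, add_zero, sub_zero]
      ext i; fin_cases i <;> simp <;> ring
    | some x₂ y₂ h₂ =>
      have hx : x₁ ≠ x₂ := fun hx => by
        rcases Affine.Point.X_eq_iff.mp hx with h | h
        · exact hPQ h
        · exact hPQ' h
      have e₁ := (Affine.equation_iff _ _).mp h₁.1
      have e₂ := (Affine.equation_iff _ _).mp h₂.1
      rw [sub_eq_add_neg (Affine.Point.some _ _ _), Affine.Point.neg_some, Affine.Point.add_of_X_ne hx,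
        Affine.Point.add_of_X_ne hx, Affine.Point.sym2x_some_some, Affine.Point.sym2x_some_some,
        Affine.slope_of_X_ne hx, Affine.slope_of_X_ne hx]
      have hx' := sub_ne_zero.mpr hx
      -- Forced by the last coordinate: the form gives (x₁ + x₂)² - 4x₁x₂, while the target has
      -- entry 1.
      refine ⟨(x₁ - x₂) ^ 2, ?_⟩
      ext i
      fin_cases i
      · simp [Affine.addX, b₄, b₆, b₈, Affine.negY]
        field_simp
        grind
      · simp [Affine.addX, b₂, b₄, b₆, Affine.negY]
        field_simp
        grind
      · simp; ring

end AddSub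

/-! ### The action of endomorphisms on x-coordinates, and the degree -/

section XMap

open WeierstrassCurve

variable {k : Type*} [Field k] {W : WeierstrassCurve k}

lemma isPrimitiveOfDegree_of_isCoprime {a b : k[X]} (h : IsCoprime a b) :
    IsPrimitiveOfDegree ![a, b] (max a.natDegree b.natDegree) where
  natDegree_le i := by fin_cases i <;> simp
  coeff_ne_zero h0 := by
    have h1 : a.coeff (max a.natDegree b.natDegree) = 0 := congrFun h0 0
    have h2 : b.coeff (max a.natDegree b.natDegree) = 0 := congrFun h0 1
    obtain ⟨u, v, huv⟩ := h
    rcases le_total a.natDegree b.natDegree with hle | hle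
    · rw [max_eq_right hle] at h1 h2
      have hb : b = 0 := leadingCoeff_eq_zero.mp h2
      rw [hb, natDegree_zero] at hle h1
      have ha : a = 0 := by rw [eq_C_of_natDegree_le_zero hle, h1, C_0]
      simp [ha, hb] at huv
    · rw [max_eq_left hle] at h1 h2
      have ha : a = 0 := leadingCoeff_eq_zero.mp h1
      rw [ha, natDegree_zero] at hle h2
      have hb : b = 0 := by rw [eq_C_of_natDegree_le_zero hle, h2, C_0]
      simp [ha, hb] at huv
  eval_ne_zero x h0 := by
    have h1 : a.eval x = 0 := congrFun h0 0
    have h2 : b.eval x = 0 := congrFun h0 1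
    obtain ⟨u, v, huv⟩ := h
    simpa [h1, h2] using congrArg (eval x) huv

/-- The coordinate ring is free over k[x] on 1, y. -/
lemma exists_evalAt_eq (A : k[X][Y]) : ∃ p q : k[X], ∀ P : W.toAffine.Point, P ≠ 0 →
    evalAt W A P = p.eval (xCoord P) + q.eval (xCoord P) * yCoord P := by
  obtain ⟨p, q, hpq⟩ := Affine.CoordinateRing.exists_smul_basis_eq
    (Affine.CoordinateRing.mk W.toAffine A)
  refine ⟨p, q, fun P hP => ?_⟩
  obtain ⟨h, -⟩ := some_coord hP
  rw [evalAt_of_ne hP]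
  have h1 : Affine.CoordinateRing.mk W.toAffine (C p + C q * Y) =
      Affine.CoordinateRing.mk W.toAffine A := by
    rw [← hpq, map_add, map_mul, Affine.CoordinateRing.smul, Affine.CoordinateRing.smul, mul_one]
  obtain ⟨r, hr⟩ := (AdjoinRoot.mk_eq_mk).mp h1
  have h2 := congrArg (fun B => evalEval (xCoord P) (yCoord P) B) hr
  have h3 : W.toAffine.polynomial.evalEval (xCoord P) (yCoord P) = 0 := h.1
  simp only [evalEval_sub, evalEval_add, evalEval_mul, evalEval_C, h3, zero_mul, evalEval_X] at h2
  linear_combination -h2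

lemma xCoord_neg (P : W.toAffine.Point) : xCoord (-P) = xCoord P := by
  cases P <;> rfl

lemma yCoord_neg {P : W.toAffine.Point} (hP : P ≠ 0) :
    yCoord (-P) = W.toAffine.negY (xCoord P) (yCoord P) := by
  cases P with
  | zero => exact absurd rfl hP
  | some x y h => rfl

lemma eq_of_coord_eq {P Q : W.toAffine.Point} (hP : P ≠ 0) (hQ : Q ≠ 0)
    (hx : xCoord P = xCoord Q) (hy : yCoord P = yCoord Q) : P = Q := by
  cases P with
  | zero => exact absurd rfl hP
  | some x y h =>
    cases Q with
    | zero => exact absurd rfl hQ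
    | some x' y' h' => rw [Affine.Point.some.injEq]; exact ⟨hx, hy⟩

lemma xRep_of_ne {P : W.toAffine.Point} (hP : P ≠ 0) : P.xRep = ![xCoord P, 1] := by
  cases P with
  | zero => exact absurd rfl hP
  | some x y h => rfl

lemma sym2x_eq_symProd (P Q : W.toAffine.Point) : P.sym2x Q = symProd P.xRep Q.xRep := rfl

lemma mul_eq_mul_of_proportional {ι : Type*} {v w r : ι → k} (hr : r ≠ 0)
    (hv : ∀ i j, v i * r j = v j * r i) (hw : ∀ i j, w i * r j = w j * r i) (i j : ι) :
    v i * w j = v j * w i := by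
  obtain ⟨l, hl⟩ := Function.ne_iff.mp hr
  apply mul_right_cancel₀ (mul_ne_zero hl hl)
  linear_combination w j * r l * hv i l + v l * r i * hw j l - w i * r l * hv j l -
    v l * r j * hw i l

lemma addSubMap_isPrimitive [W.IsElliptic] {v w : Fin 2 → k[X]} {d e : ℕ}
    (hv : IsPrimitiveOfDegree v d) (hw : IsPrimitiveOfDegree w e) :
    IsPrimitiveOfDegree (fun i => MvPolynomial.aeval (symProd v w) (W.addSubMap i))
      (2 * (d + e)) :=
  (hv.symProd hw).aeval W.isHomogeneous_addSubMap fun _ hx => W.addSubMap_ne_zero hx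

lemma exists_eq_smul_of_proportional {ι : Type*} {v r : ι → k} (hr : r ≠ 0)
    (hv : ∀ i j, v i * r j = v j * r i) : ∃ c : k, v = c • r := by
  obtain ⟨l, hl⟩ := Function.ne_iff.mp hr
  replace hl : r l ≠ 0 := hl
  refine ⟨v l / r l, funext fun i => ?_⟩
  rw [Pi.smul_apply, smul_eq_mul, div_mul_eq_mul_div, eq_div_iff hl, hv i l]

lemma symProd_smul_smul (c d : k) (v w : Fin 2 → k) :
    symProd (c • v) (d • w) = (c * d) • symProd v w := by
  ext i
  fin_cases i <;> simp [symProd] <;> ring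

lemma eval_smul_addSubMap (c : k) (x : Fin 3 → k) :
    (fun i => MvPolynomial.eval (c • x) (W.addSubMap i)) =
      c ^ 2 • fun i => MvPolynomial.eval x (W.addSubMap i) := by
  rw [eval_addSubMap, eval_addSubMap]
  ext i
  fin_cases i <;> simp <;> ring

lemma eval_symProd (v w : Fin 2 → k[X]) (x : k) :
    (fun i => (symProd v w i).eval x) =
      symProd (fun i => (v i).eval x) (fun i => (w i).eval x) := by
  ext i
  fin_cases i <;> simp [symProd]

variable [DecidableEq k]

lemma eventually_eval_ne_zero {q : k[X]} (hq : q ≠ 0) :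
    ∀ᶠ P : W.toAffine.Point in cofinite, q.eval (xCoord P) ≠ 0 := by
  have hfin := finite_x (W := W) (Polynomial.finite_setOfPred_isRoot hq)
  filter_upwards [eventually_ne 0, hfin.compl_mem_cofinite] with P hP hP' h0
  exact hP' ⟨hP, h0⟩

/-- Points with P = -P are cut out by 4x³ + b₂x² + 2b₄x + b₆. This is a nonzero polynomial even in
characteristic 2, since its vanishing would make the discriminant zero. -/
lemma eventually_ne_neg [W.IsElliptic] : ∀ᶠ P : W.toAffine.Point in cofinite, P ≠ -P := by
  have hq : (C 4 * X ^ 3 + C W.b₂ * X ^ 2 + C (2 * W.b₄) * X + C W.b₆ : k[X]) ≠ 0 := by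
    intro h0
    have h (n : ℕ) := congrArg (fun q => q.coeff n) h0
    have h3 := h 3
    have h2 := h 2
    have h1 := h 1
    have h0 := h 0
    simp [coeff_X, coeff_C] at h0 h1 h2 h3
    have hΔ : W.Δ = 0 := by
      rw [Δ, h2, h0]
      linear_combination (-2 * W.b₄ ^ 3) * h3
    exact W.isUnit_Δ.ne_zero hΔ
  filter_upwards [eventually_ne 0, eventually_eval_ne_zero hq] with P hP hq hneg
  have hy := congrArg yCoord hneg
  rw [yCoord_neg hP, Affine.negY] at hy
  obtain ⟨h, -⟩ := some_coord hP
  have heq := (Affine.equation_iff _ _).mp h.1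
  apply hq
  simp [b₂, b₄, b₆]
  linear_combination (2 * yCoord P + W.a₁ * xCoord P + W.a₃) * hy - 4 * heq

lemma eq_zero_of_eventually_eval [IsAlgClosed k] [W.IsElliptic] {q : k[X]}
    (h : ∃ᶠ P : W.toAffine.Point in cofinite, q.eval (xCoord P) = 0) : q = 0 := by
  by_contra hq
  exact h (eventually_eval_ne_zero hq)

/-- An even rational function is a rational function of `x`. -/
lemma IsRational.exists_eq_of_even [W.IsElliptic] [IsAlgClosed k] {f : W.toAffine.Point → k}
    (hf : IsRational W f) (heven : ∀ P, f (-P) = f P) :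
    ∃ U V : k[X], V ≠ 0 ∧ ∀ᶠ P in cofinite, V.eval (xCoord P) * f P = U.eval (xCoord P) := by
  obtain ⟨A, B, hAB⟩ := hf
  obtain ⟨a, a', hA⟩ := exists_evalAt_eq (W := W) A
  obtain ⟨b, b', hB⟩ := exists_evalAt_eq (W := W) B
  have := infinite_point (W := W)
  have htend : Tendsto (fun P : W.toAffine.Point => -P) cofinite cofinite :=
    neg_injective.tendsto_cofinite
  -- Write f = (a + a'y)/(b + b'y). Subtracting the equations at P and -P, where f and x agree but y
  -- differs, gives b'f = a' and bf = a; one of b, b' is nonzero.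
  have key : ∀ᶠ P in cofinite, b'.eval (xCoord P) * f P = a'.eval (xCoord P) ∧
      b.eval (xCoord P) * f P = a.eval (xCoord P) := by
    filter_upwards [hAB, htend.eventually hAB, eventually_ne 0, eventually_ne_neg] with
      P h1 h2 hP hP'
    have hneg : -P ≠ 0 := neg_ne_zero.mpr hP
    have hy : yCoord P ≠ yCoord (-P) :=
      fun hy => hP' (eq_of_coord_eq hP hneg (xCoord_neg P).symm hy)
    obtain ⟨h1, h3⟩ := h1
    obtain ⟨h2, h4⟩ := h2
    rw [heven] at h4
    rw [eq_div_iff h1] at h3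
    rw [eq_div_iff h2] at h4
    rw [hA _ hP, hB _ hP] at h3
    rw [hA _ hneg, hB _ hneg, xCoord_neg] at h4
    have h5 : b'.eval (xCoord P) * f P = a'.eval (xCoord P) := by
      apply mul_right_cancel₀ (sub_ne_zero.mpr hy)
      linear_combination h3 - h4
    exact ⟨h5, by linear_combination h3 - yCoord P * h5⟩
  by_cases hb : b = 0
  · refine ⟨a', b', ?_, key.mono fun P h => h.1⟩
    rintro rfl
    obtain ⟨P, h1, h2⟩ := (hAB.and (eventually_ne 0)).exists
    apply h1.1
    simp [hB _ h2, hb]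
  · exact ⟨a, b, hb, key.mono fun P h => h.2⟩

/-- The endomorphism `φ` acts on `x`-coordinates through the rational function `v 0 / v 1` of
degree `d`. -/
structure IsXMap (φ : AddMonoid.End W.toAffine.Point) (v : Fin 2 → k[X]) (d : ℕ) : Prop where
  isPrimitive : IsPrimitiveOfDegree v d
  eventually_eq : ∀ᶠ P in cofinite,
    (v 0).eval (xCoord P) * (φ P).xRep 1 = (v 1).eval (xCoord P) * (φ P).xRep 0

lemma isXMap_zero : IsXMap (0 : AddMonoid.End W.toAffine.Point) ![1, 0] 0 where
  isPrimitive := by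
    have := isPrimitiveOfDegree_of_isCoprime (isCoprime_one_left (x := (0 : k[X])))
    simpa using this
  eventually_eq := .of_forall fun P => by simp

lemma isXMap_one : IsXMap (1 : AddMonoid.End W.toAffine.Point) ![X, 1] 1 where
  isPrimitive := by
    have := isPrimitiveOfDegree_of_isCoprime (isCoprime_one_right (x := (X : k[X])))
    simpa using this
  eventually_eq := by
    filter_upwards [eventually_ne 0] with P hP
    simp [xRep_of_ne hP]

lemma IsAlgebraicHom.exists_isXMap [W.IsElliptic] [IsAlgClosed k]
    {φ : AddMonoid.End W.toAffine.Point} (hφ : IsAlgebraicHom W φ) : ∃ v d, IsXMap φ v d := by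
  rcases hφ with rfl | ⟨h0, hx, -⟩
  · exact ⟨_, _, isXMap_zero⟩
  obtain ⟨U, V, hV, hUV⟩ := hx.exists_eq_of_even fun P => by rw [map_neg, xCoord_neg]
  obtain ⟨u, hu⟩ := EuclideanDomain.gcd_dvd_left U V
  obtain ⟨v, hv⟩ := EuclideanDomain.gcd_dvd_right U V
  have hgcd := EuclideanDomain.gcd_eq_gcd_ab U V
  set g := EuclideanDomain.gcd U V
  have hg : g ≠ 0 := by
    rintro hg
    rw [hg, zero_mul] at hv
    exact hV hv
  have hcop : IsCoprime u v := by
    refine ⟨EuclideanDomain.gcdA U V, EuclideanDomain.gcdB U V, mul_left_cancel₀ hg ?_⟩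
    linear_combination -hgcd - EuclideanDomain.gcdA U V * hu - EuclideanDomain.gcdB U V * hv
  refine ⟨_, _, isPrimitiveOfDegree_of_isCoprime hcop, ?_⟩
  filter_upwards [h0, hUV, eventually_eval_ne_zero hg] with P h1 h2 h3
  rw [hu, hv, eval_mul, eval_mul] at h2
  have h4 : v.eval (xCoord P) * xCoord (φ P) = u.eval (xCoord P) :=
    mul_left_cancel₀ h3 (by linear_combination h2)
  simp [xRep_of_ne h1, h4]

/-- Two polynomial vectors in x that are proportional to the same nonzero vector at almost every
point of the curve are proportional as polynomials, because the curve has infinitely many points. -/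
lemma IsPrimitiveOfDegree.mul_eq_mul_of_eventually [W.IsElliptic] [IsAlgClosed k] {ι : Type*}
    {v w : ι → k[X]} {r : W.toAffine.Point → ι → k} (hr : ∀ P, r P ≠ 0)
    (hv : ∀ᶠ P in cofinite, ∀ i j, (v i).eval (xCoord P) * r P j = (v j).eval (xCoord P) * r P i)
    (hw : ∀ᶠ P in cofinite, ∀ i j, (w i).eval (xCoord P) * r P j = (w j).eval (xCoord P) * r P i)
    (i j : ι) : v i * w j = v j * w i := by
  have := infinite_point (W := W)
  rw [← sub_eq_zero]
  apply eq_zero_of_eventually_eval (W := W)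
  refine Eventually.frequently ?_
  filter_upwards [hv, hw] with P h1 h2
  rw [eval_sub, eval_mul, eval_mul, sub_eq_zero]
  exact mul_eq_mul_of_proportional (v := fun i => (v i).eval (xCoord P))
    (w := fun i => (w i).eval (xCoord P)) (hr P) h1 h2 i j

lemma IsXMap.proportional {φ : AddMonoid.End W.toAffine.Point} {v : Fin 2 → k[X]} {d : ℕ}
    (h : IsXMap φ v d) : ∀ᶠ P in cofinite, ∀ i j,
      (v i).eval (xCoord P) * (φ P).xRep j = (v j).eval (xCoord P) * (φ P).xRep i := by
  filter_upwards [h.eventually_eq] with P hP i j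
  fin_cases i <;> fin_cases j <;> simp only [Fin.zero_eta, Fin.mk_one, Fin.isValue, hP]

lemma IsXMap.unique [W.IsElliptic] [IsAlgClosed k] {φ : AddMonoid.End W.toAffine.Point}
    {v w : Fin 2 → k[X]} {d e : ℕ} (hv : IsXMap φ v d) (hw : IsXMap φ w e) : d = e :=
  hv.isPrimitive.unique hw.isPrimitive fun i j =>
    IsPrimitiveOfDegree.mul_eq_mul_of_eventually (fun P => (φ P).xRep_ne_zero)
      hv.proportional hw.proportional i j

lemma IsAlgebraicHom.finite_ker {φ : AddMonoid.End W.toAffine.Point} (hφ : IsAlgebraicHom W φ)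
    (h0 : φ ≠ 0) : {P | φ P = 0}.Finite := by
  have := (hφ.resolve_left h0).1
  rw [eventually_cofinite] at this
  simpa using this

lemma IsAlgebraicHom.tendsto_cofinite {φ : AddMonoid.End W.toAffine.Point}
    (hφ : IsAlgebraicHom W φ) (h0 : φ ≠ 0) : Tendsto φ cofinite cofinite := by
  refine Tendsto.cofinite_of_finite_preimage_singleton fun Q => ?_
  by_cases hQ : ∃ R, φ R = Q
  · obtain ⟨R, hR⟩ := hQ
    refine ((hφ.finite_ker h0).image (fun P => P + R)).subset fun P hP => ?_
    have hP' : φ P = Q := hP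
    refine ⟨P - R, ?_, sub_add_cancel P R⟩
    change φ (P - R) = 0
    rw [map_sub, hP', hR, sub_self]
  · exact Set.finite_empty.subset fun P hP => hQ ⟨P, hP⟩

/-- In degree 0 the x-coordinate of φ P would be the same for almost all P, leaving at most two
values ± φ P; but a nonzero φ has finite fibres. -/
lemma IsXMap.ne_zero [W.IsElliptic] [IsAlgClosed k] {φ : AddMonoid.End W.toAffine.Point}
    {v : Fin 2 → k[X]} {d : ℕ} (hv : IsXMap φ v d) (hφ : IsAlgebraicHom W φ) (h0 : φ ≠ 0) :
    d ≠ 0 := by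
  rintro rfl
  have := infinite_point (W := W)
  have hv' : ∀ i, v i = C ((v i).coeff 0) := fun i =>
    eq_C_of_natDegree_le_zero (hv.isPrimitive.natDegree_le i)
  have htend := hφ.tendsto_cofinite h0
  obtain ⟨P, hP, hP0⟩ := (hv.proportional.and (htend.eventually (eventually_ne 0))).exists
  obtain ⟨Q, hQ, hQ0, hQ1, hQ2⟩ := (hv.proportional.and
    ((htend.eventually (eventually_ne 0)).and ((htend.eventually (eventually_ne (φ P))).and
    (htend.eventually (eventually_ne (-φ P)))))).exists
  have hPQ := mul_eq_mul_of_proportional (v := (φ P).xRep) (w := (φ Q).xRep)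
    (hv.isPrimitive.eval_ne_zero 0) (fun i j => ?_) (fun i j => ?_) 0 1
  · rw [xRep_of_ne hP0, xRep_of_ne hQ0] at hPQ
    have h : (φ Q).xRep = (φ P).xRep := by
      rw [xRep_of_ne hP0, xRep_of_ne hQ0]
      simpa using hPQ.symm
    exact (Affine.Point.eq_or_eq_neg_of_xRep_eq_xRep h).elim hQ1 hQ2
  · have := hP j i
    rw [hv' i, hv' j] at this ⊢
    simp only [eval_C] at this ⊢
    linear_combination this
  · have := hQ j i
    rw [hv' i, hv' j] at this ⊢
    simp only [eval_C] at this ⊢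
    linear_combination this

/-- Composition of endomorphisms. -/
lemma IsXMap.mul [W.IsElliptic] [IsAlgClosed k] {φ ψ : AddMonoid.End W.toAffine.Point}
    {v w : Fin 2 → k[X]} {d e : ℕ} (hv : IsXMap φ v d) (hw : IsXMap ψ w e)
    (hψ : IsAlgebraicHom W ψ) (h0 : ψ ≠ 0) :
    IsXMap (φ * ψ) (fun i => MvPolynomial.aeval w (homogenization d (v i))) (d * e) where
  isPrimitive := hv.isPrimitive.comp hw.isPrimitive
  eventually_eq := by
    -- Finite fibres of ψ let an identity valid at almost all points for φ be pulled back along ψ.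
    have htend := hψ.tendsto_cofinite h0
    filter_upwards [htend.eventually hv.eventually_eq, htend.eventually (eventually_ne 0),
      hw.eventually_eq] with P h1 h2 h3
    rw [xRep_of_ne h2] at h3
    simp only [Matrix.cons_val_one, Matrix.cons_val_zero, mul_one] at h3
    have h4 : (w 1).eval (xCoord P) ≠ 0 := by
      intro h4
      apply hw.isPrimitive.eval_ne_zero (xCoord P)
      rw [h4, zero_mul] at h3
      ext i; fin_cases i <;> simp [h3, h4]
    simp only [eval_aeval_mvPolynomial]
    rw [eval_homogenization_of_ne (hv.isPrimitive.natDegree_le _) h4,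
      eval_homogenization_of_ne (hv.isPrimitive.natDegree_le _) h4, h3,
      mul_div_cancel_left₀ _ h4]
    change _ * (φ (ψ P)).xRep 1 = _ * (φ (ψ P)).xRep 0
    linear_combination (eval (xCoord P) (w 1)) ^ d * h1

/-- At almost every P both vectors represent the unordered pair of x-coordinates of φ P + ψ P and φ
P - ψ P. -/
lemma IsXMap.exists_addSubMap_eq [W.IsElliptic] [IsAlgClosed k]
    {φ ψ : AddMonoid.End W.toAffine.Point} {v w s t : Fin 2 → k[X]} {d₁ d₂ e₁ e₂ : ℕ}
    (hv : IsXMap φ v d₁) (hw : IsXMap ψ w d₂) (hs : IsXMap (φ + ψ) s e₁)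
    (ht : IsXMap (φ - ψ) t e₂) :
    (∀ i j, MvPolynomial.aeval (symProd v w) (W.addSubMap i) * symProd s t j =
      MvPolynomial.aeval (symProd v w) (W.addSubMap j) * symProd s t i) := by
  refine IsPrimitiveOfDegree.mul_eq_mul_of_eventually
    (fun P => (φ P + ψ P).sym2x_ne_zero (φ P - ψ P)) ?_ ?_
  · filter_upwards [hv.proportional, hw.proportional] with P h1 h2
    obtain ⟨c, hc⟩ := exists_eq_smul_of_proportional
      (v := fun i => (v i).eval (xCoord P)) (φ P).xRep_ne_zero h1
    obtain ⟨d, hd⟩ := exists_eq_smul_of_proportional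
      (v := fun i => (w i).eval (xCoord P)) (ψ P).xRep_ne_zero h2
    obtain ⟨e, he⟩ := GrossLattice.exists_addSubMap_eq (φ P) (ψ P)
    have key : (fun i => (MvPolynomial.aeval (symProd v w) (W.addSubMap i)).eval (xCoord P)) =
        ((c * d) ^ 2 * e) • (φ P + ψ P).sym2x (φ P - ψ P) := by
      simp only [eval_aeval_mvPolynomial]
      rw [eval_symProd, hc, hd, symProd_smul_smul, eval_smul_addSubMap, ← sym2x_eq_symProd, he,
        smul_smul]
    intro i j
    have h3 := congrFun key i
    have h4 := congrFun key j
    simp only [Pi.smul_apply, smul_eq_mul] at h3 h4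
    rw [h3, h4]
    ring
  · filter_upwards [hs.proportional, ht.proportional] with P h1 h2
    obtain ⟨c, hc⟩ := exists_eq_smul_of_proportional
      (v := fun i => (s i).eval (xCoord P)) (φ P + ψ P).xRep_ne_zero h1
    obtain ⟨d, hd⟩ := exists_eq_smul_of_proportional
      (v := fun i => (t i).eval (xCoord P)) (φ P - ψ P).xRep_ne_zero h2
    have key := eval_symProd s t (xCoord P)
    rw [hc, hd, symProd_smul_smul, ← sym2x_eq_symProd] at key
    intro i j
    have h3 := congrFun key i
    have h4 := congrFun key j
    simp only [Pi.smul_apply, smul_eq_mul] at h3 h4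
    rw [h3, h4]
    ring

/-- The parallelogram law for the degree. -/
lemma IsXMap.parallelogram [W.IsElliptic] [IsAlgClosed k]
    {φ ψ : AddMonoid.End W.toAffine.Point} {v w s t : Fin 2 → k[X]} {d₁ d₂ e₁ e₂ : ℕ}
    (hv : IsXMap φ v d₁) (hw : IsXMap ψ w d₂) (hs : IsXMap (φ + ψ) s e₁)
    (ht : IsXMap (φ - ψ) t e₂) : e₁ + e₂ = 2 * (d₁ + d₂) :=
  -- One side has degree 2(d₁ + d₂), as the forms are quadratic and have no common zero on an
  -- elliptic curve; the other has degree e₁ + e₂.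
  ((addSubMap_isPrimitive (W := W) hv.isPrimitive hw.isPrimitive).unique
    (hs.isPrimitive.symProd ht.isPrimitive) (hv.exists_addSubMap_eq hw hs ht)).symm

end XMap

/-! ### Inseparable endomorphisms of a supersingular curve -/

section Inseparable

open WeierstrassCurve

variable {k : Type*} [Field k] {W : WeierstrassCurve k}

lemma derivative_aeval_mvPolynomial {ι : Type*} (G : MvPolynomial ι k) {v : ι → k[X]}
    (hv : ∀ i, derivative (v i) = 0) : derivative (MvPolynomial.aeval v G) = 0 := by
  induction G using MvPolynomial.induction_on with
  | C a => simp
  | add p q hp hq => simp [hp, hq]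
  | mul_X p i hp => simp [hp, hv]

lemma xRep_eq_of_proportional {P Q : W.toAffine.Point}
    (h : P.xRep 0 * Q.xRep 1 = P.xRep 1 * Q.xRep 0) : P.xRep = Q.xRep := by
  cases P <;> cases Q <;> simp_all [← Affine.Point.zero_def]

/-- A simple root of a binary quadratic form with coefficients of derivative zero has itself
derivative zero: differentiate the relation saying that s is a root. The first factor measures
whether the two roots coincide, the second is the Wronskian of s. -/
lemma derivative_symProd_eq_zero {s t : Fin 2 → k[X]}
    (h : ∀ i, derivative (symProd s t i) = 0) :
    (s 0 * t 1 - s 1 * t 0) * (derivative (s 0) * s 1 - s 0 * derivative (s 1)) = 0 := by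
  have hA := h 2
  have hB := h 1
  have hC := h 0
  simp [symProd, derivative_mul] at hA hB hC
  linear_combination -s 0 ^ 2 * hA + s 0 * s 1 * hB - s 1 ^ 2 * hC

variable [DecidableEq k] [IsAlgClosed k] [W.IsElliptic]

/-- If 2φ = 0, the parallelogram law for φ, φ would read 0 + 0 = 4d. -/
lemma IsXMap.add_self_ne_zero {φ : AddMonoid.End W.toAffine.Point} {v : Fin 2 → k[X]} {d : ℕ}
    (hv : IsXMap φ v d) (hφ : IsAlgebraicHom W φ) (h0 : φ ≠ 0) : φ + φ ≠ 0 := by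
  intro h
  have h1 : IsXMap (φ + φ) ![1, 0] 0 := h ▸ isXMap_zero
  have h2 : IsXMap (φ - φ) ![1, 0] 0 := (sub_self φ).symm ▸ isXMap_zero
  have := hv.parallelogram hv h1 h2
  have := hv.ne_zero hφ h0
  omega

/-- A sum of endomorphisms with vanishing derivative has vanishing derivative. -/
lemma IsXMap.derivative_add {φ ψ : AddMonoid.End W.toAffine.Point}
    {v w s t : Fin 2 → k[X]} {d₁ d₂ e₁ e₂ : ℕ}
    (hv : IsXMap φ v d₁) (hw : IsXMap ψ w d₂) (hs : IsXMap (φ + ψ) s e₁)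
    (ht : IsXMap (φ - ψ) t e₂) (hφ : IsAlgebraicHom W φ) (hψ : IsAlgebraicHom W ψ)
    (hφ0 : φ ≠ 0) (hψ0 : ψ ≠ 0) (hv' : ∀ i, derivative (v i) = 0)
    (hw' : ∀ i, derivative (w i) = 0) (i : Fin 2) : derivative (s i) = 0 := by
  have := infinite_point (W := W)
  obtain ⟨c, -, hc⟩ := (addSubMap_isPrimitive (W := W) hv.isPrimitive hw.isPrimitive).exists_eq_C_mul
    (hs.isPrimitive.symProd ht.isPrimitive) (hv.exists_addSubMap_eq hw hs ht)
  have hvw : ∀ i, derivative (symProd v w i) = 0 := by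
    intro i
    fin_cases i <;> simp [symProd, derivative_mul, hv', hw']
  have hst : ∀ i, derivative (symProd s t i) = 0 := by
    intro i
    rw [hc i, derivative_C_mul, derivative_aeval_mvPolynomial _ hvw, mul_zero]
  -- If the first factor vanishes, φ + ψ and φ - ψ have the same x-coordinates, so 2φ or 2ψ vanishes
  -- at P. The point P is chosen so that neither does.
  rcases mul_eq_zero.mp (derivative_symProd_eq_zero hst) with h | h
  · exfalso
    have h1 := (hφ.add hφ).resolve_left (hv.add_self_ne_zero hφ hφ0)
    have h2 := (hψ.add hψ).resolve_left (hw.add_self_ne_zero hψ hψ0)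
    obtain ⟨P, hP1, hP2, hP3, hP4⟩ := (h1.1.and (h2.1.and
      (hs.proportional.and ht.proportional))).exists
    have h3 : (φ P + ψ P).xRep = (φ P - ψ P).xRep := by
      apply xRep_eq_of_proportional
      have h4 := mul_eq_mul_of_proportional (v := ((φ + ψ) P).xRep)
        (w := fun i => (t i).eval (xCoord P)) (r := fun i => (s i).eval (xCoord P))
        (hs.isPrimitive.eval_ne_zero _) (fun i j => by linear_combination hP3 j i) (fun i j => ?_)
      · exact mul_eq_mul_of_proportional (v := ((φ + ψ) P).xRep) (w := ((φ - ψ) P).xRep)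
          (r := fun i => (t i).eval (xCoord P)) (ht.isPrimitive.eval_ne_zero _) h4
          (fun i j => by linear_combination hP4 j i) 0 1
      · have h5 := congrArg (eval (xCoord P)) h
        simp only [eval_sub, eval_mul, eval_zero] at h5
        fin_cases i <;> fin_cases j <;> simp <;>
          first | linear_combination h5 | linear_combination -h5
    rcases Affine.Point.eq_or_eq_neg_of_xRep_eq_xRep h3 with h4 | h4
    · apply hP2
      change ψ P + ψ P = 0
      rw [sub_eq_add_neg, add_right_inj] at h4
      rw [← sub_neg_eq_add, ← h4, sub_self]
    · apply hP1
      change φ P + φ P = 0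
      rw [neg_sub, sub_eq_add_neg, add_comm, add_right_inj] at h4
      rw [← sub_neg_eq_add, ← h4, sub_self]
  · exact hs.isPrimitive.derivative_eq_zero (sub_eq_zero.mp h) i

omit [DecidableEq k] in
lemma exists_xCoord_eq (x : k) : ∃ P : W.toAffine.Point, P ≠ 0 ∧ xCoord P = x := by
  have hd : (X ^ 2 + C (W.a₁ * x + W.a₃) * X -
      C (x ^ 3 + W.a₂ * x ^ 2 + W.a₄ * x + W.a₆) : k[X]).degree ≠ 0 := by
    have : (X ^ 2 + C (W.a₁ * x + W.a₃) * X -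
      C (x ^ 3 + W.a₂ * x ^ 2 + W.a₄ * x + W.a₆) : k[X]).degree = 2 := by
      compute_degree!
    rw [this]
    decide
  obtain ⟨y, hy⟩ := IsAlgClosed.exists_root _ hd
  have heq : W.toAffine.Equation x y := by
    rw [Affine.equation_iff']
    simp only [IsRoot, eval_sub, eval_add, eval_mul, eval_pow, eval_X, eval_C] at hy
    linear_combination hy
  exact ⟨.some x y (Affine.equation_iff_nonsingular.mp heq), Affine.Point.some_ne_zero _, rfl⟩

/-- A value of a rational function which avoids finitely many values is taken the expected number
of times if the derivative does not vanish. -/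
lemma card_roots_eq {v : Fin 2 → k[X]} {d : ℕ} (hv : IsPrimitiveOfDegree v d) {c : k}
    (hc : (v 0).coeff d - c * (v 1).coeff d ≠ 0)
    (h : ∀ x, (derivative (v 0) * v 1 - v 0 * derivative (v 1)).eval x = 0 →
      (v 0).eval x ≠ c * (v 1).eval x) :
    {x | (v 0).eval x = c * (v 1).eval x}.ncard = d := by
  set f : k[X] := v 0 - C c * v 1 with hf
  have hdeg : f.natDegree = d := by
    refine natDegree_eq_of_le_of_coeff_ne_zero ?_ (by simpa [hf] using hc)
    simpa using natDegree_sub_le_of_le (hv.natDegree_le 0)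
      ((natDegree_C_mul_le c _).trans (hv.natDegree_le 1))
  have hf0 : f ≠ 0 := by
    intro h0
    apply hc
    simpa [hf] using congrArg (fun q => q.coeff d) h0
  have hroots : ∀ x, x ∈ f.roots ↔ (v 0).eval x = c * (v 1).eval x := by
    intro x
    rw [mem_roots hf0, IsRoot, hf, eval_sub, eval_mul, eval_C, sub_eq_zero]
  have hnodup : f.roots.Nodup := by
    rw [Multiset.nodup_iff_count_le_one]
    intro x
    rw [count_roots]
    by_contra! hlt
    obtain ⟨h1, h2⟩ := (one_lt_rootMultiplicity_iff_isRoot hf0).mp hlt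
    have h3 := (hroots x).mp ((mem_roots hf0).mpr h1)
    refine h x ?_ h3
    simp [hf, IsRoot] at h2
    simp only [eval_sub, eval_mul]
    linear_combination (eval x (v 1)) * h2 - (eval x (derivative (v 1))) * h3
  have hset : {x | (v 0).eval x = c * (v 1).eval x} = (f.roots.toFinset : Set k) := by
    ext x
    simp [← hroots]
  rw [hset, Set.ncard_coe_finset, Multiset.toFinset_card_of_nodup hnodup,
    ← (IsAlgClosed.splits f).natDegree_eq_card_roots, hdeg]

/-- The degree of a separable endomorphism is the order of its kernel. -/
lemma IsXMap.card_ker {φ : AddMonoid.End W.toAffine.Point} {v : Fin 2 → k[X]} {d : ℕ}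
    (hv : IsXMap φ v d) (hφ : IsAlgebraicHom W φ) (h0 : φ ≠ 0)
    (hsep : derivative (v 0) * v 1 - v 0 * derivative (v 1) ≠ 0) :
    Nat.card (AddMonoidHom.ker φ) = d := by
  have hk : Infinite k := IsAlgClosed.instInfinite
  have hS := eventually_cofinite.mp hv.eventually_eq
  set S := {P | ¬(v 0).eval (xCoord P) * (φ P).xRep 1 = (v 1).eval (xCoord P) * (φ P).xRep 0}
  have hN := eventually_cofinite.mp (eventually_ne_neg (W := W))
  set B : Set k := (xCoord '' S) ∪
    {x | IsRoot (derivative (v 0) * v 1 - v 0 * derivative (v 1)) x}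
  have hB : B.Finite := (hS.image _).union (Polynomial.finite_setOfPred_isRoot hsep)
  -- A generic value c: it avoids the branch values, the value at infinity, the images of the
  -- exceptional points in S, and the x-coordinates of points with Q = -Q.
  obtain ⟨c, hc⟩ := (((hB.image (fun x => (v 0).eval x / (v 1).eval x)).union
    ((hS.image (fun P => xCoord (φ P))).union (hN.image xCoord))).union
      (Set.finite_singleton ((v 0).coeff d / (v 1).coeff d))).infinite_compl.nonempty
  simp only [Set.mem_compl_iff, Set.mem_union, not_or, Set.mem_singleton_iff] at hc
  obtain ⟨⟨hc1, hc2, hc3⟩, hc4⟩ := hc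
  have hBc : ∀ x ∈ B, (v 0).eval x ≠ c * (v 1).eval x := by
    intro x hx h
    by_cases h1 : (v 1).eval x = 0
    · apply hv.isPrimitive.eval_ne_zero x
      rw [h1, mul_zero] at h
      ext i; fin_cases i <;> simp [h, h1]
    · exact hc1 ⟨x, hx, by rw [div_eq_iff h1, h]⟩
  have hcoeff : (v 0).coeff d - c * (v 1).coeff d ≠ 0 := by
    intro h
    by_cases h1 : (v 1).coeff d = 0
    · apply hv.isPrimitive.coeff_ne_zero
      rw [h1, mul_zero, sub_zero] at h
      ext i; fin_cases i <;> simp [h, h1]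
    · exact hc4 (by rw [eq_div_iff h1]; linear_combination -h)
  have hcard := card_roots_eq hv.isPrimitive hcoeff fun x hx => hBc x (Or.inr hx)
  obtain ⟨Q, hQ0, hQc⟩ := exists_xCoord_eq (W := W) c
  have hQ : Q ≠ -Q := by
    by_contra h
    exact hc3 ⟨Q, by simpa using h, hQc⟩
  -- The fibre of φ over Q has the same x-coordinates as the fibre of v 0 / v 1 over c: if φ P = -Q,
  -- replace P by -P. Below, Q ≠ -Q makes x injective on the fibre over Q, which is a coset of the
  -- kernel.
  have himage : xCoord '' {P | φ P = Q} = {x | (v 0).eval x = c * (v 1).eval x} := by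
    ext x
    constructor
    · rintro ⟨P, hP, rfl⟩
      replace hP : φ P = Q := hP
      have hPS : P ∉ S := fun h => hc2 ⟨P, h, by simp only [hP, hQc]⟩
      simp only [S, Set.mem_ofPred_eq, not_not, hP, xRep_of_ne hQ0, hQc] at hPS
      simp at hPS
      simp [hPS, mul_comm]
    · intro hx
      obtain ⟨P, hP0, rfl⟩ := exists_xCoord_eq (W := W) x
      have hPS : P ∉ S := fun h => hBc _ (Or.inl ⟨P, h, rfl⟩) hx
      simp only [S, Set.mem_ofPred_eq, not_not] at hPS
      replace hx : (v 0).eval (xCoord P) = c * (v 1).eval (xCoord P) := hx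
      have h1 : (v 1).eval (xCoord P) ≠ 0 := by
        intro h1
        apply hv.isPrimitive.eval_ne_zero (xCoord P)
        rw [h1, mul_zero] at hx
        ext i; fin_cases i <;> simp [hx, h1]
      have h2 : (φ P).xRep = Q.xRep := by
        apply xRep_eq_of_proportional
        rw [xRep_of_ne hQ0, hQc]
        apply mul_left_cancel₀ h1
        simp only [Matrix.cons_val_one, Matrix.cons_val_zero, mul_one]
        linear_combination (φ P).xRep 1 * hx - hPS
      rcases Affine.Point.eq_or_eq_neg_of_xRep_eq_xRep h2 with h3 | h3
      · exact ⟨P, h3, rfl⟩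
      · exact ⟨-P, by simp [h3], xCoord_neg P⟩
  have hinj : Set.InjOn xCoord {P | φ P = Q} := by
    intro P hP P' hP' h
    have hne : ∀ R, φ R = Q → R ≠ 0 := by rintro R hR rfl; exact hQ0 (by rw [← hR, map_zero])
    have h1 : P.xRep = P'.xRep := by rw [xRep_of_ne (hne _ hP), xRep_of_ne (hne _ hP'), h]
    refine (Affine.Point.eq_or_eq_neg_of_xRep_eq_xRep h1).resolve_right fun h2 => hQ ?_
    replace hP : φ P = Q := hP
    rw [h2, map_neg] at hP
    rw [show φ P' = Q from hP'] at hP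
    exact hP.symm
  rw [← himage, hinj.ncard_image] at hcard
  have hd := hv.ne_zero hφ h0
  obtain ⟨P₀, hP₀⟩ : {P | φ P = Q}.Nonempty := by
    rw [← hcard] at hd
    exact Set.nonempty_of_ncard_ne_zero hd
  rw [← hcard, ← Nat.card_coe_set_eq]
  refine Nat.card_congr
    { toFun := fun P => ⟨P.1 + P₀, ?_⟩
      invFun := fun P => ⟨P.1 - P₀, ?_⟩
      left_inv := fun P => by simp
      right_inv := fun P => by simp }
  · change φ _ = Q
    rw [map_add, show φ P.1 = 0 from P.2, zero_add]
    exact hP₀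
  · change φ _ = 0
    rw [map_sub, show φ P.1 = Q from P.2, show φ P₀ = Q from hP₀, sub_self]

/-- On a supersingular curve, endomorphisms of degree divisible by `p` have vanishing
derivative. -/
lemma IsXMap.derivative_eq_zero {p : ℕ} [Fact p.Prime] (hW : IsSupersingular W p)
    {φ : AddMonoid.End W.toAffine.Point} {v : Fin 2 → k[X]} {d : ℕ}
    (hv : IsXMap φ v d) (hφ : IsAlgebraicHom W φ) (h0 : φ ≠ 0) (hp : p ∣ d) (i : Fin 2) :
    derivative (v i) = 0 := by
  refine hv.isPrimitive.derivative_eq_zero ?_ i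
  by_contra hsep
  have hcard := hv.card_ker hφ h0 (sub_ne_zero.mpr hsep)
  have : Finite (AddMonoidHom.ker φ) := (hφ.finite_ker h0).to_subtype
  -- Cauchy's theorem: a separable φ would have kernel of order d divisible by p, hence a point of
  -- order p.
  obtain ⟨P, hP⟩ := exists_prime_addOrderOf_dvd_card' p (hcard ▸ hp)
  have h1 : p • (P : W.toAffine.Point) = 0 := by
    have := addOrderOf_nsmul_eq_zero P
    rw [hP] at this
    exact_mod_cast congrArg Subtype.val this
  have h2 : P = 0 := Subtype.ext (hW _ h1)
  rw [h2, addOrderOf_zero] at hP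
  exact (Fact.out : p.Prime).one_lt.ne hP

/-- The endomorphisms of degree divisible by `p` of a supersingular curve form a group. -/
lemma IsXMap.dvd_add {p : ℕ} [Fact p.Prime] [CharP k p] (hW : IsSupersingular W p)
    {φ ψ : AddMonoid.End W.toAffine.Point}
    {v w s t : Fin 2 → k[X]} {d₁ d₂ e₁ e₂ : ℕ}
    (hv : IsXMap φ v d₁) (hw : IsXMap ψ w d₂) (hs : IsXMap (φ + ψ) s e₁)
    (ht : IsXMap (φ - ψ) t e₂) (hφ : IsAlgebraicHom W φ) (hψ : IsAlgebraicHom W ψ)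
    (h₁ : p ∣ d₁) (h₂ : p ∣ d₂) : p ∣ e₁ := by
  by_cases hφ0 : φ = 0
  · rw [hφ0, zero_add] at hs
    rwa [hs.unique hw]
  by_cases hψ0 : ψ = 0
  · rw [hψ0, add_zero] at hs
    rwa [hs.unique hv]
  exact dvd_of_derivative_eq_zero hs.isPrimitive (hv.derivative_add hw hs ht hφ hψ hφ0 hψ0
    (hv.derivative_eq_zero hW hφ hφ0 h₁) (hw.derivative_eq_zero hW hψ hψ0 h₂))

end Inseparable

/-! ### Composition algebra: rings with a positive definite multiplicative quadratic form -/

section NormForm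

variable {R : Type*} [Ring R]

/-- A positive definite multiplicative quadratic form on a ring. -/
structure IsNormForm (N : R → ℤ) : Prop where
  nonneg : ∀ x, 0 ≤ N x
  eq_zero : ∀ x, N x = 0 → x = 0
  apply_one : N 1 = 1
  apply_mul : ∀ x y, N (x * y) = N x * N y
  parallelogram : ∀ x y, N (x + y) + N (x - y) = 2 * (N x + N y)

/-- The symmetric bilinear form attached to a quadratic form. -/
def polarForm (N : R → ℤ) (x y : R) : ℤ := N (x + y) - N x - N y

lemma polarForm_comm (N : R → ℤ) (x y : R) : polarForm N x y = polarForm N y x := by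
  rw [polarForm, polarForm, add_comm x y]; ring

namespace IsNormForm

variable {N : R → ℤ} (h : IsNormForm N)

include h

lemma apply_zero : N 0 = 0 := by
  have := h.parallelogram 0 0
  rw [add_zero, sub_zero] at this
  linarith

lemma apply_neg (x : R) : N (-x) = N x := by
  have := h.parallelogram 0 x
  rw [zero_add, zero_sub, h.apply_zero] at this
  linarith

/-- The Jordan–von Neumann argument: a combination of four instances of the parallelogram law. -/
lemma polarForm_add_left (x y z : R) :
    polarForm N (x + y) z = polarForm N x z + polarForm N y z := by
  have h1 := h.parallelogram (x + z) y
  have h2 := h.parallelogram (x - y) z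
  have h3 := h.parallelogram x (y + z)
  have h4 := h.parallelogram x y
  rw [show x + z + y = x + y + z by abel] at h1
  rw [show x - y + z = x + z - y by abel] at h2
  rw [show x - (y + z) = x - y - z by abel, show x + (y + z) = x + y + z by abel] at h3
  unfold polarForm
  linarith

/-- The polar form as a homomorphism in the first argument. -/
def polarHom (z : R) : R →+ ℤ where
  toFun x := polarForm N x z
  map_zero' := by have := h.apply_zero; simp [polarForm, this]
  map_add' x y := h.polarForm_add_left x y z

lemma polarForm_add_right (x y z : R) :
    polarForm N z (x + y) = polarForm N z x + polarForm N z y := by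
  simp only [polarForm_comm N z, h.polarForm_add_left]

lemma polarForm_sub_left (x y z : R) :
    polarForm N (x - y) z = polarForm N x z - polarForm N y z := map_sub (h.polarHom z) x y

lemma polarForm_sub_right (x y z : R) :
    polarForm N z (x - y) = polarForm N z x - polarForm N z y := by
  simp only [polarForm_comm N z, h.polarForm_sub_left]

lemma polarForm_intCast_mul_left (n : ℤ) (x z : R) :
    polarForm N (n * x) z = n * polarForm N x z := by
  have := map_zsmul (h.polarHom z) n x
  rwa [zsmul_eq_mul, smul_eq_mul] at this

lemma polarForm_intCast_mul_right (n : ℤ) (x z : R) :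
    polarForm N z (n * x) = n * polarForm N z x := by
  simp only [polarForm_comm N z, h.polarForm_intCast_mul_left]

lemma polarForm_self (x : R) : polarForm N x x = 2 * N x := by
  have := h.parallelogram x x
  rw [sub_self, h.apply_zero] at this
  rw [polarForm]
  linarith

omit h in
variable (N) in
lemma apply_add (x y : R) : N (x + y) = N x + N y + polarForm N x y := by
  rw [polarForm]; ring

lemma polarForm_one_one : polarForm N 1 1 = 2 := by
  rw [h.polarForm_self, h.apply_one, mul_one]

lemma apply_intCast_mul (n : ℤ) (x : R) : N (n * x) = n ^ 2 * N x := by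
  have := h.polarForm_self (n * x)
  rw [h.polarForm_intCast_mul_left, h.polarForm_intCast_mul_right, h.polarForm_self] at this
  linarith

lemma apply_intCast (n : ℤ) : N (n : R) = n ^ 2 := by
  rw [← mul_one (n : R), h.apply_intCast_mul, h.apply_one, mul_one]

lemma polarForm_intCast_left (n : ℤ) (x : R) : polarForm N (n : R) x = n * polarForm N 1 x := by
  rw [← mul_one (n : R), h.polarForm_intCast_mul_left]

lemma polarForm_intCast_right (n : ℤ) (x : R) : polarForm N x (n : R) = n * polarForm N x 1 := by
  rw [← mul_one (n : R), h.polarForm_intCast_mul_right]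

lemma polarForm_mul_right (x y z : R) :
    polarForm N (x * z) (y * z) = polarForm N x y * N z := by
  simp only [polarForm, ← add_mul, h.apply_mul]; ring

lemma polarForm_mul_left (x y z : R) :
    polarForm N (z * x) (z * y) = N z * polarForm N x y := by
  simp only [polarForm, ← mul_add, h.apply_mul]; ring

lemma polarForm_mul_mul (x y z w : R) :
    polarForm N (x * z) (y * w) + polarForm N (x * w) (y * z) =
      polarForm N x y * polarForm N z w := by
  have h1 := h.polarForm_mul_right x y (z + w)
  rw [mul_add, mul_add, h.polarForm_add_left, h.polarForm_add_right, h.polarForm_add_right,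
    h.polarForm_mul_right, h.polarForm_mul_right, apply_add N z w] at h1
  linarith

/-- By the polarized composition law the left side is orthogonal to every y, in particular to
itself, so positive definiteness makes it zero. -/
lemma sq_sub_mul_add (x : R) :
    x * x - (polarForm N x 1 : ℤ) * x + (N x : ℤ) = 0 := by
  have key : ∀ y, polarForm N (x * x - (polarForm N x 1 : ℤ) * x + (N x : ℤ)) y = 0 := by
    intro y
    rw [h.polarForm_add_left, h.polarForm_sub_left, h.polarForm_intCast_mul_left,
      h.polarForm_intCast_left]
    have h1 := h.polarForm_mul_mul x 1 x y
    have h2 := h.polarForm_mul_left y 1 x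
    rw [one_mul, one_mul] at h1
    rw [mul_one] at h2
    rw [h2] at h1
    rw [polarForm_comm N 1 y]
    linarith
  apply h.eq_zero
  have := key (x * x - (polarForm N x 1 : ℤ) * x + (N x : ℤ))
  rw [h.polarForm_self] at this
  linarith

lemma intCast_injective : Function.Injective (Int.cast : ℤ → R) := by
  intro m n hmn
  have h1 := h.apply_intCast (m - n)
  rw [Int.cast_sub, sub_eq_zero.mpr hmn, h.apply_zero] at h1
  have := pow_eq_zero_iff (two_ne_zero) |>.mp h1.symm
  linarith

lemma eq_zero_of_intCast_mul {n : ℤ} (hn : n ≠ 0) {x : R} (hx : (n : R) * x = 0) : x = 0 := by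
  have h1 := h.apply_intCast_mul n x
  rw [hx, h.apply_zero] at h1
  exact h.eq_zero _ ((mul_eq_zero.mp h1.symm).resolve_left (pow_ne_zero _ hn))

/-- An element with a rational multiple in `ℤ` is in `ℤ`. -/
lemma exists_eq_intCast {n c : ℤ} (hn : n ≠ 0) {x : R} (hx : (n : R) * x = c) :
    ∃ m : ℤ, x = m := by
  have h1 := h.apply_intCast_mul n x
  rw [hx, h.apply_intCast] at h1
  -- Taking norms gives n² N(x) = c², so n divides c, and R has no torsion.
  obtain ⟨m, rfl⟩ := (Int.pow_dvd_pow_iff two_ne_zero).mp (Dvd.intro _ h1.symm)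
  refine ⟨m, sub_eq_zero.mp (h.eq_zero_of_intCast_mul hn ?_)⟩
  rw [mul_sub, hx, Int.cast_mul, sub_self]

/-- This identifies the abstract form N with the reduced norm, which is defined through minimal
polynomials. -/
lemma reducedCharpoly_eq (x : R) :
    reducedCharpoly x = X ^ 2 - C (polarForm N x 1) * X + C (N x) := by
  have := h.intCast_injective
  set f : ℤ[X] := X ^ 2 - C (polarForm N x 1) * X + C (N x) with hf
  have hfdeg : f.natDegree = 2 := by rw [hf]; compute_degree!
  have hfmonic : f.Monic := by rw [hf]; monicity!
  have hfx : aeval x f = 0 := by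
    have := h.sq_sub_mul_add x
    rw [hf]
    simpa [sq] using this
  have hint : IsIntegral ℤ x := ⟨f, hfmonic, by rwa [← aeval_def]⟩
  have hmonic := minpoly.monic hint
  have hnt : Nontrivial R := ⟨1, 0, fun h0 => by
    have := h.apply_one
    rw [h0, h.apply_zero] at this
    exact zero_ne_one this⟩
  have hle : (minpoly ℤ x).natDegree ≤ 2 := by
    rw [← hfdeg]
    exact natDegree_le_natDegree (minpoly.min ℤ x hfmonic hfx)
  have hpos : 0 < (minpoly ℤ x).natDegree := by
    by_contra! h0
    have h1 := eq_one_of_monic_natDegree_zero hmonic (by omega)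
    have h2 := minpoly.aeval ℤ x
    rw [h1] at h2
    simp at h2
  by_cases hx : ∃ m : ℤ, x = m
  · obtain ⟨m, rfl⟩ := hx
    have h1 : (minpoly ℤ (m : R)).natDegree ≤ 1 := by
      rw [← natDegree_X_sub_C m]
      refine natDegree_le_natDegree (minpoly.min ℤ _ (monic_X_sub_C m) ?_)
      simp
    have h2 : (minpoly ℤ (m : R)).natDegree = 1 := by omega
    have h3 : minpoly ℤ (m : R) = X + C ((minpoly ℤ (m : R)).coeff 0) := by
      conv_lhs => rw [hmonic.as_sum, h2]
      simp
    have h4 := minpoly.aeval ℤ (m : R)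
    rw [h3] at h4
    rw [map_add, aeval_X, aeval_C, algebraMap_int_eq, eq_intCast, ← Int.cast_add] at h4
    have h5 : m + (minpoly ℤ (m : R)).coeff 0 = 0 := h.intCast_injective (by rw [h4, Int.cast_zero])
    have h6 : (minpoly ℤ (m : R)).coeff 0 = -m := by linarith
    rw [reducedCharpoly, h2, h3, h6, hf, h.apply_intCast, h.polarForm_intCast_left,
      h.polarForm_one_one]
    simp only [map_neg, map_mul, map_pow, C_ofNat]
    ring
  · have h2 : (minpoly ℤ x).natDegree = 2 := by
      by_contra hne
      have h2 : (minpoly ℤ x).natDegree = 1 := by omega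
      have h3 : minpoly ℤ x = X + C ((minpoly ℤ x).coeff 0) := by
        conv_lhs => rw [hmonic.as_sum, h2]
        simp
      have h4 := minpoly.aeval ℤ x
      rw [h3] at h4
      simp at h4
      exact hx ⟨-(minpoly ℤ x).coeff 0, by push_cast; exact eq_neg_of_add_eq_zero_left h4⟩
    have h3 : minpoly ℤ x = X ^ 2 + (C ((minpoly ℤ x).coeff 0) + C ((minpoly ℤ x).coeff 1) * X) := by
      conv_lhs => rw [hmonic.as_sum, h2]
      simp [Finset.sum_range_succ]
    rw [reducedCharpoly, h2, Nat.div_self two_pos, pow_one]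
    set a := (minpoly ℤ x).coeff 0
    set b := (minpoly ℤ x).coeff 1
    have h4 := minpoly.aeval ℤ x
    rw [h3] at h4
    simp only [map_add, map_mul, map_pow, aeval_X, aeval_C, algebraMap_int_eq, Int.coe_castRingHom] at h4
    have h5 := h.sq_sub_mul_add x
    -- The difference of two monic quadratic equations for x is linear; a nonzero leading
    -- coefficient would put x in ℤ.
    have h6 : ((b + polarForm N x 1 : ℤ) : R) * x = ((N x - a : ℤ) : R) := by
      push_cast
      rw [← sub_eq_zero]
      have h7 := congrArg₂ (· - ·) h4 h5
      simp only [sq, sub_zero] at h7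
      rw [← h7]
      noncomm_ring
    have h7 : b + polarForm N x 1 = 0 := by
      by_contra h7
      exact hx (h.exists_eq_intCast h7 h6)
    rw [h7, Int.cast_zero, zero_mul] at h6
    have h8 : N x - a = 0 := h.intCast_injective (by rw [← h6, Int.cast_zero])
    rw [h3, hf, show b = -polarForm N x 1 by linarith, show a = N x by linarith]
    simp only [map_neg]
    ring

lemma reducedTrace_eq (x : R) : reducedTrace x = polarForm N x 1 := by
  rw [reducedTrace, h.reducedCharpoly_eq]
  simp [-eq_intCast, coeff_C]

lemma reducedNorm_eq (x : R) : reducedNorm x = N x := by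
  rw [reducedNorm, h.reducedCharpoly_eq]
  simp [-eq_intCast]

lemma normPairing_eq (x y : R) : normPairing x y = polarForm N x y := by
  rw [normPairing, h.reducedNorm_eq, h.reducedNorm_eq, h.reducedNorm_eq, polarForm]

/-- Polarization of the quadratic equation of an element. -/
lemma mul_add_mul (x y : R) : x * y + y * x =
    (polarForm N x 1 : ℤ) * y + (polarForm N y 1 : ℤ) * x - (polarForm N x y : ℤ) := by
  have h1 := h.sq_sub_mul_add (x + y)
  have h2 := h.sq_sub_mul_add x
  have h3 := h.sq_sub_mul_add y
  rw [h.polarForm_add_left, apply_add N] at h1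
  rw [← sub_eq_zero]
  have h4 : ((x + y) * (x + y) - ((polarForm N x 1 + polarForm N y 1 : ℤ) : R) * (x + y) +
    ((N x + N y + polarForm N x y : ℤ) : R)) - (x * x - (polarForm N x 1 : ℤ) * x + (N x : ℤ)) -
    (y * y - (polarForm N y 1 : ℤ) * y + (N y : ℤ)) = 0 := by rw [h1, h2, h3]; simp
  rw [← h4]
  push_cast
  noncomm_ring

lemma polarForm_mul_one {x y : R} (hx : polarForm N x 1 = 0) :
    polarForm N (x * y) 1 = -polarForm N x y := by
  have h1 := h.polarForm_mul_mul x 1 y 1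
  rw [mul_one, mul_one, one_mul, hx] at h1
  linarith

/-- The norm of the commutator of two elements of trace zero. -/
lemma apply_commutator {x y : R} (hx : polarForm N x 1 = 0) (hy : polarForm N y 1 = 0) :
    N (x * y - y * x) = 4 * (N x * N y) - polarForm N x y ^ 2 := by
  have h1 := h.mul_add_mul x y
  rw [hx, hy, Int.cast_zero, zero_mul, zero_mul, add_zero, zero_sub] at h1
  -- For trace zero, xy + yx = -(x, y), so the commutator is 2xy + (x, y), and tr(xy) = -(x, y).
  have h2 : x * y - y * x = ((2 : ℤ) : R) * (x * y) + (polarForm N x y : ℤ) := by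
    rw [eq_sub_of_add_eq' h1]
    push_cast
    noncomm_ring
  rw [h2, apply_add N, h.apply_intCast_mul, h.apply_mul, h.apply_intCast, h.polarForm_intCast_mul_left,
    h.polarForm_intCast_right, h.polarForm_mul_one hx]
  ring

end IsNormForm

end NormForm

/-! ### Commutators and norms divisible by p -/

section Commutator

/-- A ternary quadratic form over `𝔽_p` has a nontrivial zero. -/
lemma exists_ternary_zero (p : ℕ) [Fact p.Prime] (a b c d e f : ℤ) :
    ∃ x y z : ℤ, ¬((p : ℤ) ∣ x ∧ (p : ℤ) ∣ y ∧ (p : ℤ) ∣ z) ∧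
      (p : ℤ) ∣ a * x ^ 2 + b * y ^ 2 + c * z ^ 2 + d * (x * y) + e * (x * z) + f * (y * z) := by
  classical
  let q : MvPolynomial (Fin 3) (ZMod p) :=
    .C (a : ZMod p) * (.X 0 * .X 0) + .C (b : ZMod p) * (.X 1 * .X 1) +
    .C (c : ZMod p) * (.X 2 * .X 2) + .C (d : ZMod p) * (.X 0 * .X 1) +
    .C (e : ZMod p) * (.X 0 * .X 2) + .C (f : ZMod p) * (.X 1 * .X 2)
  have hX : ∀ (a : ZMod p) (i j : Fin 3),
      (MvPolynomial.C a * (MvPolynomial.X i * MvPolynomial.X j)).IsHomogeneous 2 := fun a i j =>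
    ((MvPolynomial.isHomogeneous_X (ZMod p) i).mul (MvPolynomial.isHomogeneous_X _ j)).C_mul a
  have hq : q.IsHomogeneous 2 :=
    (((((hX _ _ _).add (hX _ _ _)).add (hX _ _ _)).add (hX _ _ _)).add (hX _ _ _)).add (hX _ _ _)
  -- Chevalley–Warning: degree 2 < 3 variables, so the number of zeros is a multiple of p and
  -- exceeds 1.
  have hcard := char_dvd_card_solutions p (f := q)
    (hq.totalDegree_le.trans_lt (by simp))
  have h0 : MvPolynomial.eval (0 : Fin 3 → ZMod p) q = 0 := by simp [q]
  obtain ⟨⟨v, hv⟩, hv0⟩ : ∃ v : {x : Fin 3 → ZMod p // MvPolynomial.eval x q = 0},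
      v ≠ ⟨0, h0⟩ := by
    have : Nonempty {x : Fin 3 → ZMod p // MvPolynomial.eval x q = 0} := ⟨⟨0, h0⟩⟩
    have h1 : 1 < Fintype.card {x : Fin 3 → ZMod p // MvPolynomial.eval x q = 0} :=
      (Fact.out : p.Prime).one_lt.trans_le (Nat.le_of_dvd Fintype.card_pos hcard)
    have := Fintype.one_lt_card_iff_nontrivial.mp h1
    exact exists_ne _
  obtain ⟨x, hx⟩ := ZMod.intCast_surjective (v 0)
  obtain ⟨y, hy⟩ := ZMod.intCast_surjective (v 1)
  obtain ⟨z, hz⟩ := ZMod.intCast_surjective (v 2)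
  refine ⟨x, y, z, fun h => hv0 ?_, ?_⟩
  · simp only [← ZMod.intCast_zmod_eq_zero_iff_dvd, hx, hy, hz] at h
    refine Subtype.ext (funext fun i => ?_)
    fin_cases i
    exacts [h.1, h.2.1, h.2.2]
  · rw [← ZMod.intCast_zmod_eq_zero_iff_dvd]
    push_cast
    rw [hx, hy, hz]
    simp [q] at hv
    linear_combination hv

variable {R : Type*} [Ring R] {N : R → ℤ}

/-- If the elements of norm divisible by `p` form a group, they contain all commutators. -/
lemma IsNormForm.dvd_commutator (h : IsNormForm N) {p : ℕ} [Fact p.Prime]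
    (hp : ∀ x y, (p : ℤ) ∣ N x → (p : ℤ) ∣ N y → (p : ℤ) ∣ N (x + y)) (α β : R) :
    (p : ℤ) ∣ N (α * β - β * α) := by
  have hpp : Prime (p : ℤ) := Nat.prime_iff_prime_int.mp Fact.out
  have hsub : ∀ x y, (p : ℤ) ∣ N x → (p : ℤ) ∣ N y → (p : ℤ) ∣ N (x - y) := by
    intro x y hx hy
    rw [sub_eq_add_neg]
    exact hp _ _ hx (by rwa [h.apply_neg])
  -- The ternary form is N(x + yα + zβ).
  obtain ⟨x, y, z, hne, hxyz⟩ := exists_ternary_zero p 1 (N α) (N β) (polarForm N α 1)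
    (polarForm N β 1) (polarForm N α β)
  set u : R := x + y * α + z * β with hu
  have hNu : (p : ℤ) ∣ N u := by
    rw [hu, apply_add N, apply_add N, h.polarForm_add_left, h.apply_intCast, h.apply_intCast_mul,
      h.apply_intCast_mul, h.polarForm_intCast_left, h.polarForm_intCast_left,
      h.polarForm_intCast_mul_right, h.polarForm_intCast_mul_right, h.polarForm_intCast_mul_left,
      h.polarForm_intCast_mul_right, polarForm_comm N 1, polarForm_comm N 1]
    convert hxyz using 1
    ring
  -- The elements of norm divisible by p form a two-sided ideal. Commutators of u with α and β are
  -- z[α, β] and -y[α, β], so y or z prime to p suffices.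
  have hcomm : ∀ γ, (p : ℤ) ∣ N (γ * u - u * γ) := fun γ =>
    hsub _ _ (by rw [h.apply_mul]; exact hNu.mul_left _) (by rw [h.apply_mul]; exact hNu.mul_right _)
  by_cases hz : (p : ℤ) ∣ z
  · by_cases hy : (p : ℤ) ∣ y
    · exfalso
      refine hne ⟨?_, hy, hz⟩
      -- If p divides y and z, the integer x also lies in the ideal; its norm is x², so p divides x,
      -- against nontriviality.
      have h1 := hsub _ (z * β) (hsub _ (y * α) hNu ?_) ?_
      · rw [show u - y * α - z * β = x by rw [hu]; abel, h.apply_intCast] at h1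
        exact hpp.dvd_of_dvd_pow h1
      · rw [h.apply_intCast_mul]
        exact (hy.pow two_ne_zero).mul_right _
      · rw [h.apply_intCast_mul]
        exact (hz.pow two_ne_zero).mul_right _
    · have h1 := hcomm β
      rw [show β * u - u * β = ((-y : ℤ) : R) * (α * β - β * α) by
        rw [hu, ← sub_eq_zero]
        have h2 := (Int.cast_commute x β).eq
        have h3 := (Int.cast_commute y β).eq
        have h4 := (Int.cast_commute z β).eq
        simp only [mul_add, add_mul, ← mul_assoc, ← h2, ← h3, ← h4]
        push_cast
        noncomm_ring, h.apply_intCast_mul] at h1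
      refine (hpp.dvd_or_dvd h1).resolve_left fun h2 => hy ?_
      rw [neg_sq] at h2
      exact hpp.dvd_of_dvd_pow h2
  · have h1 := hcomm α
    rw [show α * u - u * α = (z : R) * (α * β - β * α) by
      rw [hu, ← sub_eq_zero]
      have h2 := (Int.cast_commute x α).eq
      have h3 := (Int.cast_commute y α).eq
      have h4 := (Int.cast_commute z α).eq
      simp only [mul_add, add_mul, ← mul_assoc, ← h2, ← h3, ← h4]
      noncomm_ring, h.apply_intCast_mul] at h1
    exact (hpp.dvd_or_dvd h1).resolve_left fun h2 => hz (hpp.dvd_of_dvd_pow h2)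

end Commutator

/-! ### The degree as a norm form on the endomorphism ring -/

section EndDegree

variable {k : Type*} [Field k] {W : WeierstrassCurve k} [DecidableEq k] [IsAlgClosed k]
  [W.IsElliptic]

/-- The degree of an endomorphism of an elliptic curve. -/
noncomputable def endDegree (φ : EndRing W) : ℕ := φ.2.exists_isXMap.choose_spec.choose

lemma exists_isXMap_endDegree (φ : EndRing W) : ∃ v, IsXMap φ.1 v (endDegree φ) :=
  ⟨_, φ.2.exists_isXMap.choose_spec.choose_spec⟩

lemma IsXMap.endDegree_eq {φ : EndRing W} {v : Fin 2 → k[X]} {d : ℕ} (h : IsXMap φ.1 v d) :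
    endDegree φ = d :=
  (exists_isXMap_endDegree φ).choose_spec.unique h

lemma isNormForm_endDegree : IsNormForm (fun φ : EndRing W => (endDegree φ : ℤ)) where
  nonneg φ := Int.natCast_nonneg _
  eq_zero φ hφ := by
    by_contra h0
    obtain ⟨v, hv⟩ := exists_isXMap_endDegree φ
    exact hv.ne_zero φ.2 (fun h => h0 (Subtype.ext h)) (by exact_mod_cast hφ)
  apply_one := by
    have : endDegree (1 : EndRing W) = 1 := IsXMap.endDegree_eq (φ := 1) isXMap_one
    rw [this, Nat.cast_one]
  apply_mul φ ψ := by
    have h0 : endDegree (0 : EndRing W) = 0 := IsXMap.endDegree_eq (φ := 0) isXMap_zero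
    by_cases hψ : ψ = 0
    · rw [hψ, mul_zero, h0, Nat.cast_zero, mul_zero]
    · obtain ⟨v, hv⟩ := exists_isXMap_endDegree φ
      obtain ⟨w, hw⟩ := exists_isXMap_endDegree ψ
      have := IsXMap.endDegree_eq (φ := φ * ψ) (hv.mul hw ψ.2 fun h => hψ (Subtype.ext h))
      rw [this, Nat.cast_mul]
  parallelogram φ ψ := by
    obtain ⟨v, hv⟩ := exists_isXMap_endDegree φ
    obtain ⟨w, hw⟩ := exists_isXMap_endDegree ψ
    obtain ⟨s, hs⟩ := exists_isXMap_endDegree (φ + ψ)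
    obtain ⟨t, ht⟩ := exists_isXMap_endDegree (φ - ψ)
    exact_mod_cast hv.parallelogram hw hs ht

lemma dvd_endDegree_add {p : ℕ} [Fact p.Prime] [CharP k p] (hW : IsSupersingular W p)
    (φ ψ : EndRing W) (hφ : (p : ℤ) ∣ endDegree φ) (hψ : (p : ℤ) ∣ endDegree ψ) :
    (p : ℤ) ∣ endDegree (φ + ψ) := by
  rw [Int.natCast_dvd_natCast] at *
  obtain ⟨v, hv⟩ := exists_isXMap_endDegree φ
  obtain ⟨w, hw⟩ := exists_isXMap_endDegree ψ
  obtain ⟨s, hs⟩ := exists_isXMap_endDegree (φ + ψ)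
  obtain ⟨t, ht⟩ := exists_isXMap_endDegree (φ - ψ)
  exact hv.dvd_add hW hw hs ht φ.2 ψ.2 hφ hψ

/-- The degree is a norm form on the endomorphism ring of a supersingular elliptic curve, and
it is divisible by `p` on commutators. -/
lemma exists_isNormForm_endRing {p : ℕ} [Fact p.Prime] [CharP k p] (hW : IsSupersingular W p) :
    ∃ N : EndRing W → ℤ, IsNormForm N ∧ ∀ α β, (p : ℤ) ∣ N (α * β - β * α) :=
  ⟨_, isNormForm_endDegree, isNormForm_endDegree.dvd_commutator (dvd_endDegree_add hW)⟩

end EndDegree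

/-! ### The ring of integers ℤ + ℤω of ℚ(√D) -/

section QuadraticField

variable {F : Type*} [Field F] [NumberField F]

lemma exists_int_of_sq_mul {D : ℕ} (hD : D.Prime) {u : ℚ} {n : ℤ} (h : (D : ℚ) * u ^ 2 = n) :
    ∃ m : ℤ, u = m := by
  have hD0 : (D : ℚ) ≠ 0 := by exact_mod_cast hD.ne_zero
  have hint : IsIntegral ℤ ((D : ℚ) * u) := by
    refine IsIntegral.of_pow two_pos ?_
    rw [show ((D : ℚ) * u) ^ 2 = ((D * n : ℤ) : ℚ) by push_cast; rw [← h]; ring]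
    exact isIntegral_algebraMap (R := ℤ) (A := ℚ)
  obtain ⟨m, hm⟩ := IsIntegrallyClosed.isIntegral_iff.mp hint
  replace hm : (m : ℚ) = D * u := hm
  have h1 : m ^ 2 = D * n := by
    have : ((m ^ 2 : ℤ) : ℚ) = ((D * n : ℤ) : ℚ) := by push_cast; rw [hm, ← h]; ring
    exact_mod_cast this
  obtain ⟨l, rfl⟩ := (Nat.prime_iff_prime_int.mp hD).dvd_of_dvd_pow (Dvd.intro _ h1.symm)
  refine ⟨l, mul_left_cancel₀ hD0 ?_⟩
  rw [← hm]
  push_cast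
  ring

/-- The trace and the norm of an integral element of a quadratic field are integers. -/
lemma exists_int_of_quadratic {z : F} (hz : IsIntegral ℤ z) (hz' : z ∉ (algebraMap ℚ F).range)
    {t n : ℚ} (h : z ^ 2 - algebraMap ℚ F t * z + algebraMap ℚ F n = 0) :
    (∃ t' : ℤ, t = t') ∧ ∃ n' : ℤ, n = n' := by
  set f : ℚ[X] := X ^ 2 - C t * X + C n with hf
  have hfdeg : f.natDegree = 2 := by rw [hf]; compute_degree!
  have hfmonic : f.Monic := by rw [hf]; monicity!
  have hfz : aeval z f = 0 := by simpa [hf] using h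
  have hzQ : IsIntegral ℚ z := hz.tower_top
  have hmin : minpoly ℚ z = f := by
    refine (eq_of_monic_of_dvd_of_natDegree_le (minpoly.monic hzQ) hfmonic
      (minpoly.dvd ℚ z hfz) ?_).symm
    rw [hfdeg]
    exact (minpoly.two_le_natDegree_iff hzQ).mpr hz'
  have hmin' := minpoly.isIntegrallyClosed_eq_field_fractions' ℚ hz
  rw [hmin] at hmin'
  constructor
  · refine ⟨-(minpoly ℤ z).coeff 1, ?_⟩
    have := congrArg (fun q => q.coeff 1) hmin'
    simp [hf, -eq_intCast, coeff_C] at this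
    push_cast
    linarith
  · refine ⟨(minpoly ℤ z).coeff 0, ?_⟩
    have := congrArg (fun q => q.coeff 0) hmin'
    simpa [hf, -eq_intCast] using this

lemma sqrt_notMem_range {D : ℕ} (hD : D.Prime) {s : F} (hs : s ^ 2 = D) :
    s ∉ (algebraMap ℚ F).range := by
  rintro ⟨q, rfl⟩
  have h1 : q ^ 2 = (D : ℚ) := by
    apply (algebraMap ℚ F).injective
    rw [map_pow, hs, map_natCast]
  have hint : IsIntegral ℤ q := by
    refine IsIntegral.of_pow two_pos ?_
    rw [h1]
    exact_mod_cast isIntegral_algebraMap (R := ℤ) (A := ℚ) (x := (D : ℤ))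
  obtain ⟨m, hm⟩ := IsIntegrallyClosed.isIntegral_iff.mp hint
  replace hm : (m : ℚ) = q := hm
  have h2 : m ^ 2 = (D : ℤ) := by
    rw [← hm] at h1
    exact_mod_cast h1
  have := (Nat.prime_iff_prime_int.mp hD).irreducible.not_isSquare
  exact this ⟨m, by rw [← h2, sq]⟩

lemma exists_rat_add_mul_sqrt (hF : Module.finrank ℚ F = 2) {D : ℕ} (hD : D.Prime) {s : F}
    (hs : s ^ 2 = D) (z : F) : ∃ r t : ℚ, z = algebraMap ℚ F r + algebraMap ℚ F t * s := by
  have hli : LinearIndependent ℚ ![(1 : F), s] := by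
    rw [LinearIndependent.pair_iff]
    intro a b hab
    rw [Algebra.smul_def, Algebra.smul_def, mul_one] at hab
    have hb : b = 0 := by
      by_contra hb
      apply sqrt_notMem_range hD hs
      refine ⟨-a / b, ?_⟩
      have hb' : algebraMap ℚ F b ≠ 0 := by simpa using hb
      rw [map_div₀, map_neg, div_eq_iff hb']
      linear_combination -hab
    refine ⟨?_, hb⟩
    rw [hb, map_zero, zero_mul, add_zero] at hab
    simpa using hab
  have hspan := hli.span_eq_top_of_card_eq_finrank' (by simp [hF])
  have hz : z ∈ Submodule.span ℚ (Set.range ![(1 : F), s]) := hspan ▸ Submodule.mem_top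
  rw [Matrix.range_cons, Matrix.range_cons, Matrix.range_empty, Set.union_empty] at hz
  obtain ⟨a, b, hab⟩ := Submodule.mem_span_pair.mp hz
  exact ⟨a, b, by rw [← hab, Algebra.smul_def, Algebra.smul_def, mul_one]⟩

/-- The data of a real quadratic field `ℚ(√D)` with `D = 4 e + 1` prime. -/
structure IsQuadraticData (D e : ℕ) (sqrtD ω : 𝓞 F) : Prop where
  prime : D.Prime
  eq_add : D = 4 * e + 1
  finrank : Module.finrank ℚ F = 2
  sq_sqrt : sqrtD ^ 2 = (D : 𝓞 F)
  two_mul : 2 * ω = (D : 𝓞 F) + sqrtD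

namespace IsQuadraticData

variable {D e : ℕ} {sqrtD ω : 𝓞 F} (h : IsQuadraticData D e sqrtD ω)

include h

lemma sq_coe : (sqrtD : F) ^ 2 = D := by exact_mod_cast congrArg (algebraMap (𝓞 F) F) h.sq_sqrt

lemma omega_sq : ω * ω = D * ω - (D * e : ℕ) := by
  have h2 : (D : 𝓞 F) = 4 * e + 1 := by exact_mod_cast congrArg (Nat.cast (R := 𝓞 F)) h.eq_add
  apply mul_left_cancel₀ (show (4 : 𝓞 F) ≠ 0 by norm_num)
  push_cast
  linear_combination (2 * ω - D + sqrtD) * h.two_mul + h.sq_sqrt - D * h2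

lemma eq_zero_of_add_mul_eq_zero {a b : ℤ} (hab : (a : 𝓞 F) + b * sqrtD = 0) : a = 0 ∧ b = 0 := by
  have h1 : (a : F) + b * sqrtD = 0 := by
    have := congrArg (algebraMap (𝓞 F) F) hab
    simpa using this
  have hb : b = 0 := by
    by_contra hb
    apply sqrt_notMem_range h.prime h.sq_coe
    refine ⟨-a / b, ?_⟩
    have hb' : (b : F) ≠ 0 := by exact_mod_cast hb
    rw [map_div₀, map_neg, map_intCast, map_intCast, div_eq_iff hb']
    linear_combination -h1
  refine ⟨?_, hb⟩
  rw [hb, Int.cast_zero, zero_mul, add_zero] at hab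
  exact_mod_cast hab

lemma eq_of_add_mul_sqrt_eq {a b a' b' : ℤ}
    (hab : (a : 𝓞 F) + b * sqrtD = a' + b' * sqrtD) : a = a' ∧ b = b' := by
  have := h.eq_zero_of_add_mul_eq_zero (a := a - a') (b := b - b')
    (by push_cast; linear_combination hab)
  omega

lemma eq_of_add_mul_eq {a b a' b' : ℤ} (hab : (a : 𝓞 F) + b * ω = a' + b' * ω) :
    a = a' ∧ b = b' := by
  have := h.eq_of_add_mul_sqrt_eq (a := 2 * a + D * b) (b := b) (a' := 2 * a' + D * b')
    (b' := b') (by push_cast; linear_combination 2 * hab - (b - b') * h.two_mul)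
  obtain ⟨h1, rfl⟩ := this
  exact ⟨by linarith, rfl⟩

lemma exists_eq_add_mul (z : 𝓞 F) : ∃ a b : ℤ, z = a + b * ω := by
  obtain ⟨r, s, hrs⟩ := exists_rat_add_mul_sqrt h.finrank h.prime h.sq_coe (z : F)
  have hz : IsIntegral ℤ (z : F) := z.isIntegral_coe
  have key : ∃ t u : ℤ, 2 * r = t ∧ 2 * s = u ∧ (2 : ℤ) ∣ t - u := by
    by_cases hs : s = 0
    · rw [hs, map_zero, zero_mul, add_zero] at hrs
      rw [hrs, isIntegral_algebraMap_iff (algebraMap ℚ F).injective] at hz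
      obtain ⟨m, hm⟩ := IsIntegrallyClosed.isIntegral_iff.mp hz
      replace hm : (m : ℚ) = r := hm
      exact ⟨2 * m, 0, by rw [← hm]; push_cast; ring, by simp [hs], by simp⟩
    · have hz' : (z : F) ∉ (algebraMap ℚ F).range := by
        rintro ⟨q, hq⟩
        apply sqrt_notMem_range h.prime h.sq_coe
        refine ⟨(q - r) / s, ?_⟩
        have hs' : algebraMap ℚ F s ≠ 0 := by simpa using hs
        rw [map_div₀, div_eq_iff hs', map_sub, hq, hrs]
        ring
      obtain ⟨⟨t, ht⟩, n, hn⟩ := exists_int_of_quadratic hz hz' (t := 2 * r)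
        (n := r ^ 2 - D * s ^ 2) (by
          rw [hrs]
          simp only [map_sub, map_mul, map_pow, map_natCast, map_ofNat]
          linear_combination (algebraMap ℚ F s) ^ 2 * h.sq_coe)
      obtain ⟨u, hu⟩ := exists_int_of_sq_mul h.prime (u := 2 * s) (n := t ^ 2 - 4 * n) (by
        push_cast
        rw [← ht, ← hn]
        ring)
      refine ⟨t, u, ht, hu, ?_⟩
      have h1 : t ^ 2 - D * u ^ 2 = 4 * n := by
        have : ((t ^ 2 - D * u ^ 2 : ℤ) : ℚ) = ((4 * n : ℤ) : ℚ) := by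
          push_cast
          rw [← ht, ← hn, ← hu]
          ring
        exact_mod_cast this
      have h2 : (D : ℤ) = 4 * e + 1 := by exact_mod_cast h.eq_add
      rw [h2] at h1
      have h3 : (2 : ℤ) ∣ (t - u) * (t + u) := ⟨2 * n + 2 * e * u ^ 2, by linarith⟩
      rcases Int.prime_two.dvd_or_dvd h3 with h4 | h4 <;> omega
  obtain ⟨t, u, ht, hu, m, hm⟩ := key
  -- z = (t + u√D)/2 = (t - Du)/2 + uω, with t - u = 2m and D = 4e + 1.
  refine ⟨m - 2 * e * u, u, ?_⟩
  apply mul_left_cancel₀ (two_ne_zero (α := 𝓞 F))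
  have h2 : (D : 𝓞 F) = 4 * e + 1 := by exact_mod_cast congrArg (Nat.cast (R := 𝓞 F)) h.eq_add
  have h3 : 2 * z = t + u * sqrtD := by
    apply FaithfulSMul.algebraMap_injective (𝓞 F) F
    have ht' := congrArg (algebraMap ℚ F) ht
    have hu' := congrArg (algebraMap ℚ F) hu
    simp only [map_mul, map_add, map_ofNat, map_intCast] at ht' hu' ⊢
    rw [← ht', ← hu', show algebraMap (𝓞 F) F z = z from rfl, hrs]
    ring
  have hm' : (t : 𝓞 F) - u = 2 * m := by exact_mod_cast congrArg (Int.cast (R := 𝓞 F)) hm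
  rw [h3]
  push_cast
  linear_combination hm' - u * h.two_mul - u * h2

/-- The basis `1, ω` of the ring of integers. -/
noncomputable def basis : Module.Basis (Fin 2) ℤ (𝓞 F) :=
  Module.Basis.mk (v := ![1, ω])
    (by
      rw [LinearIndependent.pair_iff]
      intro a b hab
      apply h.eq_of_add_mul_eq
      simpa using hab)
    (by
      intro z _
      obtain ⟨a, b, rfl⟩ := h.exists_eq_add_mul z
      rw [Matrix.range_cons, Matrix.range_cons, Matrix.range_empty, Set.union_empty,
        Set.singleton_union]
      exact Submodule.mem_span_pair.mpr ⟨a, b, by simp⟩)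

lemma basis_apply (i : Fin 2) : h.basis i = (![1, ω] : Fin 2 → 𝓞 F) i := by
  rw [basis, Module.Basis.mk_apply]

lemma basis_repr (a b : ℤ) : ⇑(h.basis.repr (a + b * ω)) = ![a, b] := by
  have h1 : (a : 𝓞 F) + b * ω = a • h.basis 0 + b • h.basis 1 := by
    simp [h.basis_apply]
  rw [h1, map_add, map_smul, map_smul, Module.Basis.repr_self, Module.Basis.repr_self]
  ext i
  fin_cases i <;> simp

lemma norm_eq (x y : ℤ) :
    Algebra.norm ℤ ((x : 𝓞 F) + y * ω) = x ^ 2 + D * x * y + D * e * y ^ 2 := by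
  rw [Algebra.norm_eq_matrix_det h.basis, Matrix.det_fin_two]
  simp only [Algebra.leftMulMatrix_eq_repr_mul, h.basis_apply]
  have h1 : ((x : 𝓞 F) + y * ω) * (![1, ω] : Fin 2 → 𝓞 F) 0 = x + y * ω := by simp
  have h2 : ((x : 𝓞 F) + y * ω) * (![1, ω] : Fin 2 → 𝓞 F) 1 =
      ((-(D * e * y) : ℤ) : 𝓞 F) + ((x + D * y : ℤ) : 𝓞 F) * ω := by
    have := h.omega_sq
    simp only [Matrix.cons_val_one, Matrix.cons_val_zero]
    push_cast at this ⊢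
    linear_combination y * this
  rw [h1, h2, h.basis_repr, h.basis_repr]
  simp
  ring

end IsQuadraticData

end QuadraticField

/-! ### Quartic fields in which ΔΔ' is a square -/

section Biquadratic

variable {K : Type*} [Field K] [CharZero K] {s u : K} {d r t m : ℚ}

lemma isSplittingField_biquadratic (hs : s ^ 2 = d) (hu : u ^ 2 = r + t * s) (hu0 : u ≠ 0)
    (hm : r ^ 2 - d * t ^ 2 = m ^ 2) (hadj : Algebra.adjoin ℚ {s, u} = ⊤) :
    IsSplittingField ℚ K ((X ^ 2 - C d) * (X ^ 4 - C (2 * r) * X ^ 2 + C (m ^ 2))) := by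
  set f : ℚ[X] := (X ^ 2 - C d) * (X ^ 4 - C (2 * r) * X ^ 2 + C (m ^ 2)) with hf
  have hm' : (r : K) ^ 2 - d * t ^ 2 = m ^ 2 := by exact_mod_cast congrArg (Rat.cast (K := K)) hm
  -- Since u² = r + ts has conjugate r - ts and their product is m², the conjugate square root is
  -- m/u, already in K.
  have hfac : f.map (algebraMap ℚ K) =
      (X - C s) * (X + C s) * ((X - C u) * (X + C u) * ((X - C (m / u)) * (X + C (m / u)))) := by
    have h1 : (m / u : K) * u = m := div_mul_cancel₀ _ hu0
    have h2 : (m / u : K) ^ 2 = r - t * s := by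
      rw [div_pow, div_eq_iff (pow_ne_zero 2 hu0), ← hm', hu]
      linear_combination (t : K) ^ 2 * hs
    have c1 : (C s : K[X]) ^ 2 = C (d : K) := by rw [← C_pow, hs]
    have c2 : (C u : K[X]) ^ 2 + C (m / u) ^ 2 = C (2 * r : K) := by
      rw [← C_pow, ← C_pow, ← C_add, hu, h2]; congr 1; ring
    have c3 : (C u : K[X]) ^ 2 * C (m / u) ^ 2 = C ((m : K) ^ 2) := by
      rw [← C_pow, ← C_pow, ← C_mul, ← mul_pow, mul_comm u, h1]
    have hL : f.map (algebraMap ℚ K) =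
        (X ^ 2 - C (d : K)) * (X ^ 4 - C (2 * r : K) * X ^ 2 + C ((m : K) ^ 2)) := by
      rw [hf]
      simp only [Polynomial.map_mul, Polynomial.map_sub, Polynomial.map_add, Polynomial.map_pow,
        map_X, Polynomial.map_C, map_mul, map_pow, map_ofNat, Polynomial.map_ofNat, eq_ratCast]
    rw [hL, ← c1, ← c2, ← c3]
    ring
  have hX : ∀ a : K, (X + C a : K[X]) = X - C (-a) := fun a => by rw [C_neg, sub_neg_eq_add]
  refine ⟨?_, ?_⟩
  · rw [hfac]
    simp only [hX]
    exact ((Splits.X_sub_C _).mul (Splits.X_sub_C _)).mul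
      (((Splits.X_sub_C _).mul (Splits.X_sub_C _)).mul
      ((Splits.X_sub_C _).mul (Splits.X_sub_C _)))
  · rw [eq_top_iff, ← hadj]
    apply Algebra.adjoin_mono
    have hf0 : f.map (algebraMap ℚ K) ≠ 0 := by
      rw [hfac]
      simp only [hX]
      have := fun a : K => X_sub_C_ne_zero a
      exact mul_ne_zero (mul_ne_zero (this _) (this _)) (mul_ne_zero (mul_ne_zero (this _) (this _))
        (mul_ne_zero (this _) (this _)))
    intro z hz
    rw [mem_rootSet', ← eval_map_algebraMap, hfac]
    refine ⟨hfac ▸ hf0, ?_⟩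
    rcases hz with rfl | hz
    · simp
    · rw [Set.mem_singleton_iff.mp hz]
      simp

lemma isKleinFour_of_biquadratic [FiniteDimensional ℚ K] (hrank : Module.finrank ℚ K = 4)
    (hs : s ^ 2 = d) (hu : u ^ 2 = r + t * s)
    (hu0 : u ≠ 0) (hm : r ^ 2 - d * t ^ 2 = m ^ 2) (hadj : Algebra.adjoin ℚ {s, u} = ⊤) :
    IsKleinFour (K ≃ₐ[ℚ] K) := by
  have hm' : (r : K) ^ 2 - d * t ^ 2 = m ^ 2 := by exact_mod_cast congrArg (Rat.cast (K := K)) hm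
  have hsplit := isSplittingField_biquadratic hs hu hu0 hm hadj
  have hnormal : Normal ℚ K := Normal.of_isSplittingField _ (hFEp := hsplit)
  have hgal : IsGalois ℚ K := {}
  have hcard : Nat.card (K ≃ₐ[ℚ] K) = 4 := by rw [IsGalois.card_aut_eq_finrank, hrank]
  refine ⟨hcard, ?_⟩
  -- If σ fixes s, then σu = ±u. Otherwise uσ(u) = ±m is rational; applying σ gives σ(u)σ²(u) =
  -- uσ(u), hence σ²u = u.
  have hsq : ∀ σ : K ≃ₐ[ℚ] K, σ ^ 2 = 1 := by
    intro σ
    have hσs : σ s = s ∨ σ s = -s := by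
      apply sq_eq_sq_iff_eq_or_eq_neg.mp
      rw [← map_pow, hs, map_ratCast]
    have hσs2 : σ (σ s) = s := by
      rcases hσs with h1 | h1
      · rw [h1, h1]
      · rw [h1, map_neg, h1, neg_neg]
    have hσu2 : σ (σ u) = u := by
      rcases hσs with h1 | h1
      · have h3 : σ u = u ∨ σ u = -u := by
          apply sq_eq_sq_iff_eq_or_eq_neg.mp
          rw [← map_pow, hu, map_add, map_mul, map_ratCast, map_ratCast, h1]
        rcases h3 with h3 | h3
        · rw [h3, h3]
        · rw [h3, map_neg, h3, neg_neg]
      · have h3 : u * σ u = m ∨ u * σ u = -m := by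
          apply sq_eq_sq_iff_eq_or_eq_neg.mp
          rw [mul_pow, ← map_pow, hu, map_add, map_mul, map_ratCast, map_ratCast, h1, ← hm']
          linear_combination -(t : K) ^ 2 * hs
        have hσu0 : σ u ≠ 0 := by simpa using hu0
        rcases h3 with h3 | h3
        · have h4 := congrArg σ h3
          rw [map_mul, map_ratCast, ← h3, mul_comm u] at h4
          exact mul_left_cancel₀ hσu0 h4
        · have h4 := congrArg σ h3
          rw [map_mul, map_neg, map_ratCast, ← h3, mul_comm u] at h4
          exact mul_left_cancel₀ hσu0 h4
    have h1 : ((σ ^ 2 : K ≃ₐ[ℚ] K) : K →ₐ[ℚ] K) = AlgHom.id ℚ K := by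
      apply AlgHom.ext_of_adjoin_eq_top hadj
      rintro z (rfl | hz)
      · exact hσs2
      · rw [Set.mem_singleton_iff.mp hz]
        exact hσu2
    ext z
    exact DFunLike.congr_fun h1 z
  have hdvd : Monoid.exponent (K ≃ₐ[ℚ] K) ∣ 2 := Monoid.exponent_dvd_of_forall_pow_eq_one hsq
  refine ((Nat.dvd_prime Nat.prime_two).mp hdvd).resolve_left fun h1 => ?_
  have := Monoid.exp_eq_one_iff.mp h1
  rw [Nat.card_unique] at hcard
  omega

end Biquadratic

/-! ### Complex conjugation and the O_F-basis 1, θ of O_K -/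

section CMField

open NumberField NumberField.IsCMField

variable {F K : Type*} [Field F] [NumberField F] [Field K] [NumberField K] [IsCMField K]
  [Algebra F K] {D e : ℕ} {sqrtD ω : 𝓞 F}

/-- Complex conjugation is trivial on a real quadratic subfield. -/
lemma IsQuadraticData.conj_algebraMap (h : IsQuadraticData D e sqrtD ω) (a : 𝓞 F) :
    ringOfIntegersComplexConj K (algebraMap (𝓞 F) (𝓞 K) a) = algebraMap (𝓞 F) (𝓞 K) a := by
  have hs : ringOfIntegersComplexConj K (algebraMap (𝓞 F) (𝓞 K) sqrtD) =
      algebraMap (𝓞 F) (𝓞 K) sqrtD := by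
    apply RingOfIntegers.ext
    rw [coe_ringOfIntegersComplexConj]
    let φ : K →+* ℂ := Classical.choice inferInstance
    apply φ.injective
    rw [complexEmbedding_complexConj]
    -- A square root of the positive number D has a real image ±√D in ℂ, so conjugation fixes it.
    have h1 : (φ (algebraMap (𝓞 F) (𝓞 K) sqrtD : 𝓞 K)) ^ 2 = ((Real.sqrt D : ℝ) : ℂ) ^ 2 := by
      rw [← map_pow, ← Complex.ofReal_pow, Real.sq_sqrt (Nat.cast_nonneg D)]
      have h2 : ((algebraMap (𝓞 F) (𝓞 K) sqrtD : 𝓞 K) : K) ^ 2 = (D : K) := by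
        have := congrArg (fun z => ((algebraMap (𝓞 F) (𝓞 K) z : 𝓞 K) : K)) h.sq_sqrt
        simpa using this
      rw [h2]
      simp
    rcases sq_eq_sq_iff_eq_or_eq_neg.mp h1 with h2 | h2
    · rw [h2, Complex.conj_ofReal]
    · rw [h2, map_neg, Complex.conj_ofReal]
  have hω : ringOfIntegersComplexConj K (algebraMap (𝓞 F) (𝓞 K) ω) =
      algebraMap (𝓞 F) (𝓞 K) ω := by
    apply mul_left_cancel₀ (two_ne_zero (α := 𝓞 K))
    have h1 := congrArg (algebraMap (𝓞 F) (𝓞 K)) h.two_mul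
    simp only [map_mul, map_add, map_ofNat, map_natCast] at h1
    have h2 := congrArg (ringOfIntegersComplexConj K) h1
    simp only [map_mul, map_add, map_ofNat, map_natCast, hs] at h2
    rw [h2, h1]
  obtain ⟨x, y, rfl⟩ := h.exists_eq_add_mul a
  simp only [map_mul, map_add, map_intCast, hω]

/-- The data of a quartic CM field `K = F(√Δ)` with `O_K = O_F + O_F θ`. -/
structure IsCMData (Δ : 𝓞 F) (sqrtΔ θ : 𝓞 K) (w : 𝓞 F) : Prop where
  sq_sqrt : sqrtΔ ^ 2 = algebraMap (𝓞 F) (𝓞 K) Δ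
  two_mul : 2 * θ = algebraMap (𝓞 F) (𝓞 K) w + sqrtΔ
  exists_eq : ∀ z : 𝓞 K, ∃ a b : 𝓞 F,
    z = algebraMap (𝓞 F) (𝓞 K) a + algebraMap (𝓞 F) (𝓞 K) b * θ

namespace IsCMData

variable {Δ w : 𝓞 F} {sqrtΔ θ : 𝓞 K}

/-- Otherwise conjugation would fix O_F and θ, hence O_K and its fraction field K, and be trivial.
-/
lemma conj_sqrt_ne (hK : IsCMData Δ sqrtΔ θ w) (h : IsQuadraticData D e sqrtD ω) :
    ringOfIntegersComplexConj K sqrtΔ ≠ sqrtΔ := by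
  intro h2
  have hθ : ringOfIntegersComplexConj K θ = θ := by
    apply mul_left_cancel₀ (two_ne_zero (α := 𝓞 K))
    have h3 := congrArg (ringOfIntegersComplexConj K) hK.two_mul
    simp only [map_mul, map_add, map_ofNat, h.conj_algebraMap, h2] at h3
    rw [h3, hK.two_mul]
  have hall : ∀ z : 𝓞 K, ringOfIntegersComplexConj K z = z := by
    intro z
    obtain ⟨a, b, rfl⟩ := hK.exists_eq z
    simp only [map_mul, map_add, h.conj_algebraMap, hθ]
  apply complexConj_ne_one K
  ext x
  obtain ⟨a, b, -, rfl⟩ := IsFractionRing.div_surjective (A := 𝓞 K) x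
  have ha : complexConj K (a : K) = a := congrArg (algebraMap (𝓞 K) K) (hall a)
  have hb : complexConj K (b : K) = b := congrArg (algebraMap (𝓞 K) K) (hall b)
  change complexConj K ((a : K) / b) = (a : K) / b
  rw [map_div₀, ha, hb]

lemma conj_sqrt (hK : IsCMData Δ sqrtΔ θ w) (h : IsQuadraticData D e sqrtD ω) :
    ringOfIntegersComplexConj K sqrtΔ = -sqrtΔ := by
  have h1 : (ringOfIntegersComplexConj K sqrtΔ) ^ 2 = sqrtΔ ^ 2 := by
    rw [← map_pow, hK.sq_sqrt, h.conj_algebraMap]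
  exact (sq_eq_sq_iff_eq_or_eq_neg.mp h1).resolve_left (hK.conj_sqrt_ne h)

lemma sqrt_ne_zero (hK : IsCMData Δ sqrtΔ θ w) (h : IsQuadraticData D e sqrtD ω) :
    sqrtΔ ≠ 0 := fun h0 => hK.conj_sqrt_ne h (by rw [h0, map_zero])

lemma conj_theta (hK : IsCMData Δ sqrtΔ θ w) (h : IsQuadraticData D e sqrtD ω) :
    ringOfIntegersComplexConj K θ = algebraMap (𝓞 F) (𝓞 K) w - θ := by
  apply mul_left_cancel₀ (two_ne_zero (α := 𝓞 K))
  have h3 := congrArg (ringOfIntegersComplexConj K) hK.two_mul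
  simp only [map_mul, map_add, map_ofNat, h.conj_algebraMap, hK.conj_sqrt h] at h3
  linear_combination h3 + hK.two_mul

omit [NumberField F] [NumberField K] [IsCMField K] in
lemma algebraMap_injective : Function.Injective (algebraMap (𝓞 F) (𝓞 K)) :=
  FaithfulSMul.algebraMap_injective (𝓞 F) (𝓞 K)

lemma eq_of_add_mul_eq (hK : IsCMData Δ sqrtΔ θ w) (h : IsQuadraticData D e sqrtD ω)
    {a b a' b' : 𝓞 F}
    (hab : algebraMap (𝓞 F) (𝓞 K) a + algebraMap (𝓞 F) (𝓞 K) b * θ =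
      algebraMap (𝓞 F) (𝓞 K) a' + algebraMap (𝓞 F) (𝓞 K) b' * θ) : a = a' ∧ b = b' := by
  have h1 := congrArg (ringOfIntegersComplexConj K) hab
  simp only [map_mul, map_add, h.conj_algebraMap, hK.conj_theta h] at h1
  have h2 : algebraMap (𝓞 F) (𝓞 K) b = algebraMap (𝓞 F) (𝓞 K) b' := by
    apply mul_right_cancel₀ (hK.sqrt_ne_zero h)
    linear_combination hab - h1 -
      (algebraMap (𝓞 F) (𝓞 K) b - algebraMap (𝓞 F) (𝓞 K) b') * hK.two_mul
  rw [h2] at hab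
  exact ⟨algebraMap_injective (add_right_cancel hab), algebraMap_injective h2⟩

/-- The minimal equation of `θ` over `O_F`. -/
lemma exists_theta_sq (hK : IsCMData Δ sqrtΔ θ w) (h : IsQuadraticData D e sqrtD ω) :
    ∃ η : 𝓞 F, Δ = w ^ 2 + 4 * η ∧
      θ * θ = algebraMap (𝓞 F) (𝓞 K) η + algebraMap (𝓞 F) (𝓞 K) w * θ := by
  obtain ⟨a, b, hab⟩ := hK.exists_eq (θ * θ - algebraMap (𝓞 F) (𝓞 K) w * θ)
  -- Comparison of coordinates in 4(θ² - wθ) = Δ - w²: the integral element θ² - wθ has no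
  -- θ-component.
  have h1 : algebraMap (𝓞 F) (𝓞 K) (4 * a) + algebraMap (𝓞 F) (𝓞 K) (4 * b) * θ =
      algebraMap (𝓞 F) (𝓞 K) (Δ - w ^ 2) + algebraMap (𝓞 F) (𝓞 K) 0 * θ := by
    simp only [map_mul, map_sub, map_pow, map_ofNat, map_zero]
    linear_combination -4 * hab + hK.sq_sqrt +
      (2 * θ - algebraMap (𝓞 F) (𝓞 K) w + sqrtΔ) * hK.two_mul
  obtain ⟨h2, h3⟩ := hK.eq_of_add_mul_eq h h1
  have hb : b = 0 := (mul_eq_zero.mp h3).resolve_left (by norm_num)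
  refine ⟨a, by linear_combination -h2, ?_⟩
  rw [hb, map_zero, zero_mul, add_zero] at hab
  linear_combination hab

omit [IsCMField K] in
lemma adjoin_eq_top (hK : IsCMData Δ sqrtΔ θ w) (h : IsQuadraticData D e sqrtD ω) :
    Algebra.adjoin ℚ {((algebraMap (𝓞 F) (𝓞 K) sqrtD : 𝓞 K) : K), (sqrtΔ : K)} = ⊤ := by
  set A := Algebra.adjoin ℚ {((algebraMap (𝓞 F) (𝓞 K) sqrtD : 𝓞 K) : K), (sqrtΔ : K)} with hA
  have hsA : ((algebraMap (𝓞 F) (𝓞 K) sqrtD : 𝓞 K) : K) ∈ A := Algebra.subset_adjoin (by simp)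
  have huA : (sqrtΔ : K) ∈ A := Algebra.subset_adjoin (by simp)
  have hdiv : ∀ (n : ℤ) (z : K), n ≠ 0 → n * z ∈ A → z ∈ A := by
    intro n z hn hz
    have := Subalgebra.smul_mem _ hz ((n : ℚ)⁻¹)
    rw [Algebra.smul_def, map_inv₀, map_intCast,
      inv_mul_cancel_left₀ (by exact_mod_cast hn)] at this
    exact this
  have hjA : ∀ a : 𝓞 F, ((algebraMap (𝓞 F) (𝓞 K) a : 𝓞 K) : K) ∈ A := by
    have hoA : ((algebraMap (𝓞 F) (𝓞 K) ω : 𝓞 K) : K) ∈ A := by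
      apply hdiv 2 _ two_ne_zero
      have h1 := congrArg (fun z => ((algebraMap (𝓞 F) (𝓞 K) z : 𝓞 K) : K)) h.two_mul
      simp only [map_mul, map_add, map_ofNat, map_natCast] at h1
      rw [Int.cast_ofNat, h1]
      exact add_mem (natCast_mem _ D) hsA
    intro a
    obtain ⟨c, d, rfl⟩ := h.exists_eq_add_mul a
    simp only [map_mul, map_add, map_intCast]
    exact add_mem (intCast_mem _ c) (mul_mem (intCast_mem _ d) hoA)
  have hθA : (θ : K) ∈ A := by
    apply hdiv 2 _ two_ne_zero
    have h1 := congrArg (algebraMap (𝓞 K) K) hK.two_mul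
    simp only [map_mul, map_add, map_ofNat] at h1
    rw [Int.cast_ofNat, h1]
    exact add_mem (hjA w) huA
  rw [eq_top_iff]
  intro z _
  obtain ⟨n, hn0, hn⟩ := ((IsFractionRing.isAlgebraic_iff ℤ ℚ K).mpr
    (Algebra.IsAlgebraic.isAlgebraic z)).exists_integral_multiple
  obtain ⟨a, b, hab⟩ := hK.exists_eq ⟨_, hn⟩
  have h1 := congrArg (algebraMap (𝓞 K) K) hab
  simp only [map_mul, map_add] at h1
  apply hdiv n z hn0
  rw [← zsmul_eq_mul]
  refine (show n • z = _ from h1) ▸ ?_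
  exact add_mem (hjA a) (mul_mem (hjA b) hθA)

/-- If the norm of `Δ` is a square, then `K` is biquadratic. -/
lemma isKleinFour (hK : IsCMData Δ sqrtΔ θ w) (h : IsQuadraticData D e sqrtD ω)
    (hrank : Module.finrank ℚ K = 4) {m : ℤ} (hm : Algebra.norm ℤ Δ = m ^ 2) :
    IsKleinFour (K ≃ₐ[ℚ] K) := by
  obtain ⟨x, y, hxy⟩ := h.exists_eq_add_mul Δ
  rw [hxy, h.norm_eq] at hm
  have hD : (D : ℚ) = 4 * e + 1 := by exact_mod_cast h.eq_add
  -- x + yω = (x + Dy/2) + (y/2)√D.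
  refine isKleinFour_of_biquadratic (d := D) (r := x + D * y / 2) (t := y / 2) (m := m) hrank
    ?_ ?_ ?_ ?_ (hK.adjoin_eq_top h)
  · have h1 := congrArg (fun z => ((algebraMap (𝓞 F) (𝓞 K) z : 𝓞 K) : K)) h.sq_sqrt
    simpa only [map_pow, map_natCast, Rat.cast_natCast] using h1
  · have h1 := congrArg (algebraMap (𝓞 K) K) hK.sq_sqrt
    have h2 := congrArg (fun z => ((algebraMap (𝓞 F) (𝓞 K) z : 𝓞 K) : K)) h.two_mul
    rw [hxy] at h1
    simp only [map_pow, map_mul, map_add, map_ofNat, map_natCast, map_intCast] at h1 h2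
    rw [h1]
    push_cast
    linear_combination (y / 2 : K) * h2
  · exact fun h0 => hK.sqrt_ne_zero h (RingOfIntegers.ext h0)
  · have hm' : (x : ℚ) ^ 2 + D * x * y + D * e * y ^ 2 = m ^ 2 := by exact_mod_cast hm
    rw [← hm']
    linear_combination (D * y ^ 2 / 4 : ℚ) * hD

end IsCMData

end CMField

/-! ### Pairs of elements and the matrices T(μn) -/

section Pairs

lemma posDef_fin_two {a b c : ℝ} (ha : 0 < a) (hdet : 0 < a * c - b ^ 2) :
    (!![a, b; b, c] : Matrix (Fin 2) (Fin 2) ℝ).PosDef := by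
  refine Matrix.PosDef.of_dotProduct_mulVec_pos ?_ ?_
  · ext i j
    fin_cases i <;> fin_cases j <;> simp
  · intro x hx
    have hq : star x ⬝ᵥ (!![a, b; b, c] : Matrix (Fin 2) (Fin 2) ℝ).mulVec x =
        a * x 0 ^ 2 + 2 * b * x 0 * x 1 + c * x 1 ^ 2 := by
      simp [Matrix.mulVec, dotProduct, Fin.sum_univ_two]
      ring
    rw [hq]
    refine pos_of_mul_pos_right (a := a) ?_ ha.le
    rw [show a * (a * x 0 ^ 2 + 2 * b * x 0 * x 1 + c * x 1 ^ 2) =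
      (a * x 0 + b * x 1) ^ 2 + (a * c - b ^ 2) * x 1 ^ 2 by ring]
    by_cases h1 : x 1 = 0
    · have h0 : x 0 ≠ 0 := fun h0 => hx (by ext i; fin_cases i <;> simp [h0, h1])
      rw [h1, mul_zero, add_zero, zero_pow two_ne_zero, mul_zero, add_zero]
      exact sq_pos_of_ne_zero (mul_ne_zero ha.ne' h0)
    · positivity

variable {F : Type*} [Field F] [NumberField F] {R : Type*} [Ring R] {N : R → ℤ}
  {p D e : ℕ} {sqrtD ω Δ : 𝓞 F} {x y : ℤ}

/-- The condition `(δ + β ω)² = x + y ω` for elements `δ, β` of trace zero, in terms of norms. -/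
structure IsRootPair (N : R → ℤ) (D e : ℕ) (x y : ℤ) (δ β : R) : Prop where
  trace_left : polarForm N δ 1 = 0
  trace_right : polarForm N β 1 = 0
  fst_eq : x = -N δ + D * e * N β
  snd_eq : y = -polarForm N δ β - D * N β

/-- The condition P pins down T, and for fixed T the formula for Δ recovers μ|m|. As m ≠ 0, this
leaves one sign. -/
lemma existsUnique_sign {m : ℤ} {T : Matrix (Fin 2) (Fin 2) ℤ} {P : Matrix (Fin 2) (Fin 2) ℤ → Prop}
    (hP : ∀ T', T'.IsSymm → P T' → T' = T) (hPT : P T) (h : IsQuadraticData D e sqrtD ω)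
    (hT : IsTMatrix D sqrtD Δ m T) (hm : IsAdmissible p D Δ |m|) :
    ∃ n : ℤ, IsAdmissible p D Δ n ∧ ∃! μ : ℤˣ, ∃ T : Matrix (Fin 2) (Fin 2) ℤ,
      IsTMatrix D sqrtD Δ (μ * n) T ∧ P T := by
  obtain ⟨μ, hμ⟩ : ∃ μ : ℤˣ, (μ : ℤ) * |m| = m := by
    rcases abs_choice m with h1 | h1
    · exact ⟨1, by rw [h1]; simp⟩
    · exact ⟨-1, by rw [h1]; simp⟩
  refine ⟨|m|, hm, μ, ⟨T, by rwa [hμ], hPT⟩, ?_⟩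
  rintro μ' ⟨T', hT', hPT'⟩
  rw [hP T' hT'.isSymm hPT'] at hT'
  have h1 : ((2 * (μ' * |m|) - D * T 1 1 : ℤ) : 𝓞 F) + (0 : ℤ) * sqrtD =
      ((2 * m - D * T 1 1 : ℤ) : 𝓞 F) + (0 : ℤ) * sqrtD := by
    linear_combination hT.delta_eq - hT'.delta_eq
  have h2 := (h.eq_of_add_mul_sqrt_eq h1).1
  have h3 : (μ' : ℤ) * |m| = μ * |m| := by rw [hμ]; linarith
  exact Units.ext (mul_right_cancel₀ hm.1.ne' h3)

/-- The matrix of a root pair satisfies the conditions on `T(μn)`, and `n` is admissible. -/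
lemma IsRootPair.isTMatrix (h : IsQuadraticData D e sqrtD ω) (hN : IsNormForm N)
    (hp : ∀ α β, (p : ℤ) ∣ N (α * β - β * α)) (hΔ : Δ = x + y * ω)
    (hΔ4 : Algebra.norm ℤ Δ ≡ 1 [ZMOD 4]) (hsq : ∀ m : ℤ, Algebra.norm ℤ Δ ≠ m ^ 2)
    {w₀ w₁ : ℤ} {α₀ β₀ : R} (hroot : IsRootPair N D e x y (2 * α₀ - w₀) (2 * β₀ - w₁))
    {T : Matrix (Fin 2) (Fin 2) ℤ} (h00 : T 0 0 = N (2 * α₀ - w₀)) (h11 : T 1 1 = N (2 * β₀ - w₁))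
    (h01 : 2 * T 0 1 = polarForm N (2 * α₀ - w₀) (2 * β₀ - w₁)) (h10 : T 1 0 = T 0 1) :
    ∃ m : ℤ, IsTMatrix D sqrtD Δ m T ∧ IsAdmissible p D Δ |m| := by
  set δ : R := 2 * α₀ - w₀ with hδ
  set β : R := 2 * β₀ - w₁ with hβ
  have hDe : (D : ℤ) = 4 * e + 1 := by exact_mod_cast h.eq_add
  have hD0 : (0 : ℤ) < D := by exact_mod_cast h.prime.pos
  have hx := hroot.fst_eq
  have hy := hroot.snd_eq
  rw [← h00, ← h11] at hx
  rw [← h01, ← h11] at hy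
  -- Integers are central, so [δ, β] = 4[α₀, β₀].
  have hcomm : N (δ * β - β * δ) = 16 * N (α₀ * β₀ - β₀ * α₀) := by
    rw [show δ * β - β * δ = ((4 : ℤ) : R) * (α₀ * β₀ - β₀ * α₀) by
      have h2 := (Int.cast_commute w₀ β₀).eq
      have h3 := (Int.cast_commute w₁ α₀).eq
      have h4 := (Int.cast_commute w₁ (w₀ : R)).eq
      rw [hδ, hβ]
      simp only [sub_mul, mul_sub, two_mul, add_mul, mul_add, h2, h3, h4]
      push_cast
      noncomm_ring, hN.apply_intCast_mul]
    norm_num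
  rw [hN.apply_commutator hroot.trace_left hroot.trace_right, ← h00, ← h11, ← h01] at hcomm
  set M := N (α₀ * β₀ - β₀ * α₀) with hM
  have hdet : T 0 0 * T 1 1 - T 0 1 ^ 2 = 4 * M := by linarith
  have hnorm := h.norm_eq x y
  rw [← hΔ] at hnorm
  -- This is -½(z, z') for z = δ + βω and its conjugate, since ω + ω' = D and ωω' = De. The identity
  -- `hkey` is the Gram determinant of z, z'.
  obtain ⟨m, hm⟩ : ∃ m, m = -(T 0 0 + T 0 1 * D + T 1 1 * D * e) := ⟨_, rfl⟩
  have hkey : Algebra.norm ℤ Δ - m ^ 2 = 4 * D * M := by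
    rw [hnorm, hx, hy, hm]
    have h1 : (4 : ℤ) * D * M = D * (T 0 0 * T 1 1 - T 0 1 ^ 2) := by rw [hdet]; ring
    rw [h1, hDe]
    ring
  have hM0 : 0 ≤ M := hN.nonneg _
  have hMne : M ≠ 0 := by
    intro h0
    rw [h0, mul_zero] at hkey
    exact hsq m (by linarith)
  have hMpos : 0 < M := lt_of_le_of_ne hM0 hMne.symm
  have hm0 : m ≠ 0 := by
    intro h0
    rw [h0, zero_pow two_ne_zero, sub_zero] at hkey
    have h1 := hΔ4.dvd
    rw [hkey] at h1
    have h2 : (4 : ℤ) ∣ 4 * D * M := ⟨D * M, by ring⟩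
    omega
  have ha : 0 < T 0 0 := by
    have h1 : 0 ≤ T 0 0 := by rw [h00]; exact hN.nonneg _
    refine lt_of_le_of_ne h1 fun h2 => ?_
    rw [← h2, zero_mul] at hdet
    nlinarith [sq_nonneg (T 0 1)]
  have hTm : T.map (Int.cast : ℤ → ℝ) = !![(T 0 0 : ℝ), T 0 1; T 0 1, T 1 1] := by
    ext i j
    fin_cases i <;> fin_cases j <;> simp [h10]
  refine ⟨m, ⟨?_, ?_, ?_, ?_⟩, ?_, ?_, ?_⟩
  · ext i j
    fin_cases i <;> fin_cases j <;> simp [h10]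
  · rw [hTm]
    apply posDef_fin_two
    · exact_mod_cast ha
    · have : 0 < T 0 0 * T 1 1 - T 0 1 ^ 2 := by rw [hdet]; linarith
      exact_mod_cast this
  · rw [Matrix.det_fin_two, h10, hkey, ← sq, hdet]
    ring
  · have h2 := h.two_mul
    have hDe' : (D : 𝓞 F) = 4 * e + 1 := by exact_mod_cast congrArg (Nat.cast (R := 𝓞 F)) h.eq_add
    rw [hΔ, hx, hy, hm]
    push_cast
    linear_combination (-2 * T 0 1 - D * T 1 1 : 𝓞 F) * h2 - (D * T 1 1 : 𝓞 F) * hDe'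
  · exact abs_pos.mpr hm0
  · rw [sq_abs]
    have : 0 < 4 * (D : ℤ) * M := by positivity
    linarith
  · obtain ⟨j, hj⟩ := hp α₀ β₀
    rw [← hM] at hj
    refine ⟨j, ?_, by rw [sq_abs, hkey, hj]⟩
    rw [hj] at hMpos
    exact pos_of_mul_pos_right hMpos (Int.natCast_nonneg p)

/-- Conversely, the conditions on `T(μn)` determine the coordinates of `Δ`. -/
lemma IsTMatrix.isRootPair (h : IsQuadraticData D e sqrtD ω) (hΔ : Δ = x + y * ω) {m : ℤ}
    {T : Matrix (Fin 2) (Fin 2) ℤ} (hT : IsTMatrix D sqrtD Δ m T) {δ β : R}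
    (hδ : polarForm N δ 1 = 0) (hβ : polarForm N β 1 = 0)
    (h00 : T 0 0 = N δ) (h11 : T 1 1 = N β) (h01 : 2 * T 0 1 = polarForm N δ β) :
    IsRootPair N D e x y δ β := by
  have hDe : (D : ℤ) = 4 * e + 1 := by exact_mod_cast h.eq_add
  have h10 : T 1 0 = T 0 1 := hT.isSymm.apply 0 1
  have hc : 0 < T 1 1 := by
    have := hT.posDef.diag_pos (i := 1)
    rw [Matrix.map_apply] at this
    exact_mod_cast this
  have hnorm := h.norm_eq x y
  rw [← hΔ] at hnorm
  have hdelta := hT.delta_eq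
  rw [hΔ, show 2 * ((x : 𝓞 F) + y * ω) = ((2 * x + D * y : ℤ) : 𝓞 F) + (y : 𝓞 F) * sqrtD by
    push_cast; linear_combination (y : 𝓞 F) * h.two_mul, sub_eq_add_neg, ← neg_mul,
    ← Int.cast_neg] at hdelta
  obtain ⟨h1, hy⟩ := h.eq_of_add_mul_sqrt_eq hdelta
  have hdet := hT.det_eq
  rw [Matrix.det_fin_two, h10, hnorm] at hdet
  -- Substitute the coordinates of Δ into 4ΔΔ' = (2x + Dy)² - Dy² and compare with the determinant
  -- condition. The terms in m² cancel, leaving a linear equation for m multiplied by the positive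
  -- entry c.
  have hm : T 1 1 * (m + (T 0 0 + T 0 1 * D + T 1 1 * D * e)) = 0 := by
    have hD0 : (4 * D : ℤ) ≠ 0 := by
      have := h.prime.ne_zero
      positivity
    apply mul_left_cancel₀ hD0
    have h2 : 4 * (x ^ 2 + D * x * y + D * e * y ^ 2) = (2 * x + D * y) ^ 2 - D * y ^ 2 := by
      rw [hDe]; ring
    rw [h1, hy] at h2
    have h3 : 4 * (D * (T 0 0 * T 1 1 - T 0 1 * T 0 1)) =
        4 * (x ^ 2 + D * x * y + D * e * y ^ 2) - 4 * m ^ 2 := by rw [hdet, hy]; ring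
    rw [hy] at h3
    rw [h2] at h3
    linear_combination h3 - (D * (T 1 1) ^ 2 * D) * hDe
  have hm' := (mul_eq_zero.mp hm).resolve_left hc.ne'
  refine ⟨hδ, hβ, ?_, by rw [← h01, ← h11, hy]; ring⟩
  rw [← h00, ← h11]
  rw [hy] at h1
  have : 2 * x = 2 * (-T 0 0 + D * e * T 1 1) := by
    linear_combination h1 + 2 * hm' + (D * T 1 1) * hDe
  linarith

/-! ### Pairs in the order -/

lemma gramMatrix_apply (hN : IsNormForm N) {n : ℕ} (v : Fin n → R) (i j : Fin n) :
    gramMatrix v i j = (polarForm N (v i) (v j) : ℚ) / 2 := by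
  rw [gramMatrix, Matrix.of_apply, hN.normPairing_eq]

lemma IsNormForm.polarForm_two_mul_sub (hN : IsNormForm N) (α β : R) (a b : ℤ) :
    polarForm N (2 * α - a) (2 * β - b) = 4 * polarForm N α β - 2 * b * polarForm N α 1 -
      2 * a * polarForm N β 1 + 2 * a * b := by
  rw [show (2 : R) = ((2 : ℤ) : R) by norm_num, hN.polarForm_sub_left, hN.polarForm_sub_right,
    hN.polarForm_sub_right, hN.polarForm_intCast_mul_left, hN.polarForm_intCast_mul_right,
    hN.polarForm_intCast_mul_left, hN.polarForm_intCast_right, hN.polarForm_intCast_left,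
    hN.polarForm_intCast_mul_right, hN.polarForm_intCast_left, hN.polarForm_intCast_right,
    hN.polarForm_one_one, polarForm_comm N 1 β]
  ring

lemma IsNormForm.trace_two_mul_sub (hN : IsNormForm N) (α : R) (a : ℤ) :
    polarForm N (2 * α - a) 1 = 2 * (polarForm N α 1 - a) := by
  rw [show (2 : R) = ((2 : ℤ) : R) by norm_num, hN.polarForm_sub_left,
    hN.polarForm_intCast_mul_left, hN.polarForm_intCast_left, hN.polarForm_one_one]
  ring

lemma IsNormForm.apply_two_mul_sub (hN : IsNormForm N) (α : R) (a : ℤ) :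
    N (2 * α - a) = 4 * N α - 2 * a * polarForm N α 1 + a ^ 2 := by
  have h1 := hN.polarForm_two_mul_sub α α a a
  rw [hN.polarForm_self, hN.polarForm_self] at h1
  linarith

/-- The Gram matrix transforms under the change from 1, α₀, β₀ to 1, δ, β. The entries pairing with
1 express tr α₀ = w₀ and tr β₀ = w₁, that is, the trace-zero conditions on δ and β. -/
lemma gramMatrix_eq_tildeMatrix_iff (hN : IsNormForm N) {w₀ w₁ : ℤ} {α₀ β₀ : R}
    {T : Matrix (Fin 2) (Fin 2) ℤ} :
    gramMatrix ![1, α₀, β₀] = tildeMatrix w₀ w₁ T ↔ polarForm N (2 * α₀ - w₀) 1 = 0 ∧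
      polarForm N (2 * β₀ - w₁) 1 = 0 ∧ T 0 0 = N (2 * α₀ - w₀) ∧ T 1 1 = N (2 * β₀ - w₁) ∧
      2 * T 0 1 = polarForm N (2 * α₀ - w₀) (2 * β₀ - w₁) := by
  rw [hN.trace_two_mul_sub, hN.trace_two_mul_sub, hN.apply_two_mul_sub, hN.apply_two_mul_sub,
    hN.polarForm_two_mul_sub]
  have h10 := hN.polarForm_one_one
  constructor
  · intro hg
    have hg := fun i j => congrFun (congrFun hg i) j
    simp only [gramMatrix_apply hN] at hg
    have h01 : (polarForm N 1 α₀ : ℚ) / 2 = w₀ / 2 := hg 0 1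
    have h02 : (polarForm N 1 β₀ : ℚ) / 2 = w₁ / 2 := hg 0 2
    have h11 : (polarForm N α₀ α₀ : ℚ) / 2 = (T 0 0 + w₀ ^ 2) / 4 := hg 1 1
    have h12 : (polarForm N α₀ β₀ : ℚ) / 2 = (T 0 1 + w₀ * w₁) / 4 := hg 1 2
    have h22 : (polarForm N β₀ β₀ : ℚ) / 2 = (T 1 1 + w₁ ^ 2) / 4 := hg 2 2
    rw [hN.polarForm_self] at h11 h22
    rw [polarForm_comm] at h01 h02
    have e1 : polarForm N α₀ 1 = w₀ := by
      have : (polarForm N α₀ 1 : ℚ) = w₀ := by linarith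
      exact_mod_cast this
    have e2 : polarForm N β₀ 1 = w₁ := by
      have : (polarForm N β₀ 1 : ℚ) = w₁ := by linarith
      exact_mod_cast this
    rw [e1, e2]
    refine ⟨by ring, by ring, ?_, ?_, ?_⟩
    · have : (T 0 0 : ℚ) = 4 * N α₀ - 2 * w₀ * w₀ + w₀ ^ 2 := by push_cast at h11; linarith
      exact_mod_cast this
    · have : (T 1 1 : ℚ) = 4 * N β₀ - 2 * w₁ * w₁ + w₁ ^ 2 := by push_cast at h22; linarith
      exact_mod_cast this
    · have : 2 * (T 0 1 : ℚ) =
          4 * polarForm N α₀ β₀ - 2 * w₁ * w₀ - 2 * w₀ * w₁ + 2 * w₀ * w₁ := by linarith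
      exact_mod_cast this
  · rintro ⟨e1, e2, e3, e4, e5⟩
    have e1 : polarForm N α₀ 1 = w₀ := by linarith
    have e2 : polarForm N β₀ 1 = w₁ := by linarith
    rw [e1] at e3 e5
    rw [e2] at e4 e5
    have e5' : T 0 1 = 2 * polarForm N α₀ β₀ - w₀ * w₁ := by linarith
    ext i j
    rw [gramMatrix_apply hN]
    fin_cases i <;> fin_cases j <;>
      simp [tildeMatrix, h10, polarForm_comm N 1, polarForm_comm N β₀ α₀, e1, e2, e3, e4, e5',
        hN.polarForm_self] <;> ring

lemma gramMatrix_eq_map_iff (hN : IsNormForm N) {δ β : R} {T : Matrix (Fin 2) (Fin 2) ℤ}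
    (hT : T.IsSymm) : gramMatrix ![δ, β] = T.map (Int.cast : ℤ → ℚ) ↔
      T 0 0 = N δ ∧ T 1 1 = N β ∧ 2 * T 0 1 = polarForm N δ β := by
  have hT10 : T 1 0 = T 0 1 := hT.apply 0 1
  constructor
  · intro hg
    have hg := fun i j => congrFun (congrFun hg i) j
    simp only [gramMatrix_apply hN] at hg
    have h00 : (polarForm N δ δ : ℚ) / 2 = T 0 0 := hg 0 0
    have h01 : (polarForm N δ β : ℚ) / 2 = T 0 1 := hg 0 1
    have h11 : (polarForm N β β : ℚ) / 2 = T 1 1 := hg 1 1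
    rw [hN.polarForm_self] at h00 h11
    refine ⟨?_, ?_, ?_⟩
    · have : (T 0 0 : ℚ) = N δ := by push_cast at h00; linarith
      exact_mod_cast this
    · have : (T 1 1 : ℚ) = N β := by push_cast at h11; linarith
      exact_mod_cast this
    · have : 2 * (T 0 1 : ℚ) = polarForm N δ β := by linarith
      exact_mod_cast this
  · rintro ⟨e1, e2, e3⟩
    have e3' : (polarForm N δ β : ℚ) = 2 * T 0 1 := by exact_mod_cast e3.symm
    ext i j
    rw [gramMatrix_apply hN]
    fin_cases i <;> fin_cases j <;>
      simp [polarForm_comm N β δ, e1, e2, e3', hN.polarForm_self, hT10]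

lemma isSymm_ext {T T' : Matrix (Fin 2) (Fin 2) ℤ} (hT : T.IsSymm) (hT' : T'.IsSymm)
    (h00 : T 0 0 = T' 0 0) (h11 : T 1 1 = T' 1 1) (h01 : T 0 1 = T' 0 1) : T = T' := by
  have h1 : T 1 0 = T 0 1 := hT.apply 0 1
  have h2 : T' 1 0 = T' 0 1 := hT'.apply 0 1
  ext i j
  fin_cases i <;> fin_cases j <;> simp [h00, h11, h01, h1, h2]

lemma IsRootPair.exists_isTMatrix (h : IsQuadraticData D e sqrtD ω) (hN : IsNormForm N)
    (hp : ∀ α β, (p : ℤ) ∣ N (α * β - β * α)) (hΔ : Δ = x + y * ω)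
    (hΔ4 : Algebra.norm ℤ Δ ≡ 1 [ZMOD 4]) (hsq : ∀ m : ℤ, Algebra.norm ℤ Δ ≠ m ^ 2)
    {w₀ w₁ : ℤ} {α₀ β₀ : R} (hroot : IsRootPair N D e x y (2 * α₀ - w₀) (2 * β₀ - w₁)) :
    ∃ m T, IsTMatrix D sqrtD Δ m T ∧ IsAdmissible p D Δ |m| ∧ T 0 0 = N (2 * α₀ - w₀) ∧
      T 1 1 = N (2 * β₀ - w₁) ∧ 2 * T 0 1 = polarForm N (2 * α₀ - w₀) (2 * β₀ - w₁) := by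
  -- T must be integral: the pairing of 2α₀ - w₀ and 2β₀ - w₁ is even.
  obtain ⟨b, hb⟩ : ∃ b, 2 * b = polarForm N (2 * α₀ - w₀) (2 * β₀ - w₁) :=
    ⟨2 * polarForm N α₀ β₀ - w₁ * polarForm N α₀ 1 - w₀ * polarForm N β₀ 1 + w₀ * w₁, by
      rw [hN.polarForm_two_mul_sub]; ring⟩
  obtain ⟨m, hT, hm⟩ := hroot.isTMatrix h hN hp hΔ hΔ4 hsq
    (T := !![N (2 * α₀ - w₀), b; b, N (2 * β₀ - w₁)]) rfl rfl hb rfl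
  exact ⟨m, _, hT, hm, rfl, rfl, hb⟩

lemma isRootPair_iff_mem_orderPairs (h : IsQuadraticData D e sqrtD ω) (hN : IsNormForm N)
    (hp : ∀ α β, (p : ℤ) ∣ N (α * β - β * α)) (hΔ : Δ = x + y * ω)
    (hΔ4 : Algebra.norm ℤ Δ ≡ 1 [ZMOD 4]) (hsq : ∀ m : ℤ, Algebra.norm ℤ Δ ≠ m ^ 2)
    {w₀ w₁ : ℤ} {α₀ β₀ : R} :
    IsRootPair N D e x y (2 * α₀ - w₀) (2 * β₀ - w₁) ↔
      (α₀, β₀) ∈ orderPairs R p D sqrtD Δ w₀ w₁ := by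
  constructor
  · intro hroot
    obtain ⟨m, T, hT, hm, h00, h11, h01⟩ := hroot.exists_isTMatrix h hN hp hΔ hΔ4 hsq
    refine existsUnique_sign (fun T' hsymm hT' => ?_) ?_ h hT hm
    · obtain ⟨-, -, h00', h11', h01'⟩ := (gramMatrix_eq_tildeMatrix_iff hN).mp hT'
      exact isSymm_ext hsymm hT.isSymm (by rw [h00, h00']) (by rw [h11, h11']) (by linarith)
    · exact (gramMatrix_eq_tildeMatrix_iff hN).mpr
        ⟨hroot.trace_left, hroot.trace_right, h00, h11, h01⟩
  · rintro ⟨n, -, μ, ⟨T, hT, hg⟩, -⟩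
    obtain ⟨h1, h2, h00, h11, h01⟩ := (gramMatrix_eq_tildeMatrix_iff hN).mp hg
    exact hT.isRootPair h hΔ h1 h2 h00 h11 h01

/-! ### Pairs in the Gross lattice -/

lemma IsRootPair.mem_latticePairs (h : IsQuadraticData D e sqrtD ω) (hN : IsNormForm N)
    (hp : ∀ α β, (p : ℤ) ∣ N (α * β - β * α)) (hΔ : Δ = x + y * ω)
    (hΔ4 : Algebra.norm ℤ Δ ≡ 1 [ZMOD 4]) (hsq : ∀ m : ℤ, Algebra.norm ℤ Δ ≠ m ^ 2)
    {w₀ w₁ : ℤ} {α₀ β₀ : R} (hroot : IsRootPair N D e x y (2 * α₀ - w₀) (2 * β₀ - w₁)) :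
    (2 * α₀ - (w₀ : R), 2 * β₀ - (w₁ : R)) ∈ latticePairs R p D sqrtD Δ := by
  refine ⟨⟨⟨-w₀, α₀, by push_cast; abel⟩, ?_⟩, ⟨⟨-w₁, β₀, by push_cast; abel⟩, ?_⟩, ?_⟩
  · rw [hN.reducedTrace_eq]; exact hroot.trace_left
  · rw [hN.reducedTrace_eq]; exact hroot.trace_right
  obtain ⟨m, T, hT, hm, h00, h11, h01⟩ := hroot.exists_isTMatrix h hN hp hΔ hΔ4 hsq
  refine existsUnique_sign (fun T' hsymm hT' => ?_) ?_ h hT hm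
  · obtain ⟨h00', h11', h01'⟩ := (gramMatrix_eq_map_iff hN hsymm).mp hT'
    exact isSymm_ext hsymm hT.isSymm (by rw [h00, h00']) (by rw [h11, h11']) (by linarith)
  · exact (gramMatrix_eq_map_iff hN hT.isSymm).mpr ⟨h00, h11, h01⟩

/-- The hypotheses say (u + vω)² ≡ (w₀ + w₁ω)² mod 4. Only their reduction mod 2 matters: as D is
odd, the second gives v ≡ w₁ and then the first u ≡ w₀. -/
lemma even_sub_of_congr {e D u v w₀ w₁ s t : ℤ} (hD : D = 4 * e + 1)
    (h1 : u ^ 2 - D * e * v ^ 2 = w₀ ^ 2 - D * e * w₁ ^ 2 + 4 * s)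
    (h2 : 2 * u * v + D * v ^ 2 = 2 * w₀ * w₁ + D * w₁ ^ 2 + 4 * t) :
    Even (u - w₀) ∧ Even (v - w₁) := by
  have hDodd : ¬ Even D := by rw [hD]; simp [parity_simps, show Even (4 : ℤ) by decide]
  have e2 : Even (2 * u * v + D * v ^ 2) ↔ Even (2 * w₀ * w₁ + D * w₁ ^ 2 + 4 * t) := by rw [h2]
  have h4 : Even (4 : ℤ) := by decide
  simp [parity_simps, hDodd, h4] at e2
  have e1 : Even (u ^ 2 - D * e * v ^ 2) ↔ Even (w₀ ^ 2 - D * e * w₁ ^ 2 + 4 * s) := by rw [h1]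
  simp [parity_simps, hDodd, h4, e2] at e1
  simp only [parity_simps]
  tauto

lemma exists_eq_of_mem_latticePairs (h : IsQuadraticData D e sqrtD ω) (hN : IsNormForm N)
    (hΔ : Δ = x + y * ω) {w₀ w₁ : ℤ} {η : 𝓞 F} (hη : Δ = ((w₀ : 𝓞 F) + w₁ * ω) ^ 2 + 4 * η)
    {δ β : R} (hmem : (δ, β) ∈ latticePairs R p D sqrtD Δ) :
    ∃ α₀ β₀, δ = 2 * α₀ - w₀ ∧ β = 2 * β₀ - w₁ ∧ IsRootPair N D e x y δ β := by
  obtain ⟨⟨⟨u, y', hδ⟩, htδ⟩, ⟨⟨v, z', hβ⟩, htβ⟩, n, -, μ, ⟨T, hT, hg⟩, -⟩ := hmem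
  dsimp only at hδ hβ htδ htβ hg
  rw [hN.reducedTrace_eq] at htδ htβ
  obtain ⟨h00, h11, h01⟩ := (gramMatrix_eq_map_iff hN hT.isSymm).mp hg
  have hroot := hT.isRootPair h hΔ htδ htβ h00 h11 h01
  have hδ' : δ = 2 * y' - (-u : ℤ) := by rw [hδ]; push_cast; abel
  have hβ' : β = 2 * z' - (-v : ℤ) := by rw [hβ]; push_cast; abel
  obtain ⟨a₁, a₂, ha⟩ := h.exists_eq_add_mul η
  have hDe : (D : ℤ) = 4 * e + 1 := by exact_mod_cast h.eq_add
  have hxy : (x : 𝓞 F) + y * ω = ((w₀ ^ 2 - D * e * w₁ ^ 2 + 4 * a₁ : ℤ) : 𝓞 F) +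
      ((2 * w₀ * w₁ + D * w₁ ^ 2 + 4 * a₂ : ℤ) : 𝓞 F) * ω := by
    rw [← hΔ, hη, ha]
    have := h.omega_sq
    push_cast at this ⊢
    linear_combination (w₁ : 𝓞 F) ^ 2 * this
  obtain ⟨hx, hy⟩ := h.eq_of_add_mul_eq hxy
  have hNδ := hN.apply_two_mul_sub y' (-u)
  have hNβ := hN.apply_two_mul_sub z' (-v)
  have hB := hN.polarForm_two_mul_sub y' z' (-u) (-v)
  have hty : polarForm N y' 1 = -u := by
    have := hN.trace_two_mul_sub y' (-u); rw [← hδ', htδ] at this; linarith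
  have htz : polarForm N z' 1 = -v := by
    have := hN.trace_two_mul_sub z' (-v); rw [← hβ', htβ] at this; linarith
  rw [← hδ', hty] at hNδ
  rw [← hβ', htz] at hNβ
  rw [← hδ', ← hβ', hty, htz] at hB
  -- With δ = u + 2y' of trace zero, N(δ) = 4N(y') - u², and similarly for β and (δ, β). So the
  -- root-pair equations read Δ ≡ (u + vω)² mod 4, to be compared with Δ = w² + 4η.
  obtain ⟨⟨r, hr⟩, ⟨s, hs⟩⟩ := even_sub_of_congr (u := u) (v := v) (w₀ := w₀) (w₁ := w₁)
    (s := a₁ + N y' - D * e * N z') (t := a₂ + polarForm N y' z' + D * N z') hDe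
    (by have := hroot.fst_eq; rw [hx, hNδ, hNβ] at this; linarith)
    (by have := hroot.snd_eq; rw [hy, hB, hNβ] at this; linarith)
  refine ⟨y' + (w₀ + r : ℤ), z' + (w₁ + s : ℤ), ?_, ?_, hroot⟩
  · rw [hδ, show u = w₀ + (r + r) by linarith]; push_cast; noncomm_ring
  · rw [hβ, show v = w₁ + (s + s) by linarith]; push_cast; noncomm_ring

end Pairs

/-! ### The ring R ⊗ O_F = R ⊕ Rω -/

section Tensor

variable {F : Type*} [Field F] [NumberField F] {R : Type*} [Ring R] {N : R → ℤ}
  {D e : ℕ} {sqrtD ω Δ : 𝓞 F}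

/-- The element `x + y ω` of `R ⊗ O_F`. -/
def tensorElt (ω : 𝓞 F) (x y : R) : R ⊗[ℤ] 𝓞 F := x ⊗ₜ[ℤ] (1 : 𝓞 F) + y ⊗ₜ[ℤ] ω

lemma tmul_add_mul (x : R) (a b : ℤ) :
    x ⊗ₜ[ℤ] ((a : 𝓞 F) + b * ω) = tensorElt ω (a * x) (b * x) := by
  rw [tensorElt, TensorProduct.tmul_add, ← zsmul_one a, ← zsmul_eq_mul, ← zsmul_eq_mul,
    ← zsmul_eq_mul, TensorProduct.tmul_smul, TensorProduct.tmul_smul, TensorProduct.smul_tmul',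
    TensorProduct.smul_tmul']

lemma tensorElt_add (x y x' y' : R) :
    tensorElt ω x y + tensorElt ω x' y' = tensorElt ω (x + x') (y + y') := by
  simp only [tensorElt, TensorProduct.add_tmul]
  abel

lemma tensorElt_sub (x y x' y' : R) :
    tensorElt ω x y - tensorElt ω x' y' = tensorElt ω (x - x') (y - y') := by
  simp only [tensorElt, TensorProduct.sub_tmul]
  abel

lemma tensorElt_neg (x y : R) : -tensorElt ω x y = tensorElt ω (-x) (-y) := by
  simp only [tensorElt, TensorProduct.neg_tmul, neg_add]

lemma exists_eq_tensorElt (h : IsQuadraticData D e sqrtD ω) (s : R ⊗[ℤ] 𝓞 F) :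
    ∃ x y : R, s = tensorElt ω x y := by
  induction s with
  | zero => exact ⟨0, 0, by simp [tensorElt]⟩
  | tmul x a =>
    obtain ⟨m, n, rfl⟩ := h.exists_eq_add_mul a
    exact ⟨_, _, tmul_add_mul x m n⟩
  | add s t hs ht =>
    obtain ⟨x, y, rfl⟩ := hs
    obtain ⟨x', y', rfl⟩ := ht
    exact ⟨_, _, tensorElt_add x y x' y'⟩

lemma equivFinsupp_tensorElt (h : IsQuadraticData D e sqrtD ω) (x y : R) :
    ⇑(TensorProduct.equivFinsuppOfBasisRight (M := R) h.basis (tensorElt ω x y)) = ![x, y] := by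
  have h1 := h.basis_repr 1 0
  have h2 := h.basis_repr 0 1
  simp only [Int.cast_one, Int.cast_zero, zero_mul, add_zero, one_mul, zero_add] at h1 h2
  ext i
  rw [tensorElt, map_add, Finsupp.add_apply,
    TensorProduct.equivFinsuppOfBasisRight_apply_tmul_apply,
    TensorProduct.equivFinsuppOfBasisRight_apply_tmul_apply, h1, h2]
  fin_cases i <;> simp

lemma tensorElt_inj (h : IsQuadraticData D e sqrtD ω) {x y x' y' : R}
    (hxy : tensorElt ω x y = tensorElt ω x' y') : x = x' ∧ y = y' := by
  have h1 := equivFinsupp_tensorElt h x y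
  rw [hxy, equivFinsupp_tensorElt h] at h1
  exact ⟨(congrFun h1 0).symm, (congrFun h1 1).symm⟩

lemma tensorElt_mul (h : IsQuadraticData D e sqrtD ω) (x y x' y' : R) :
    tensorElt ω x y * tensorElt ω x' y' =
      tensorElt ω (x * x' - (D * e : ℕ) * (y * y')) (x * y' + y * x' + D * (y * y')) := by
  have h1 : (y * y') ⊗ₜ[ℤ] (ω * ω) =
      tensorElt ω (-((D * e : ℕ) : R) * (y * y')) (D * (y * y')) := by
    have := tmul_add_mul (ω := ω) (y * y') (-(D * e : ℕ)) D
    rw [show ω * ω = ((-(D * e : ℕ) : ℤ) : 𝓞 F) + ((D : ℤ) : 𝓞 F) * ω by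
      rw [h.omega_sq]; push_cast; ring, this]
    push_cast
    rfl
  have h2 : tensorElt ω x y * tensorElt ω x' y' =
      tensorElt ω (x * x') (x * y' + y * x') + (y * y') ⊗ₜ[ℤ] (ω * ω) := by
    simp only [tensorElt, mul_add, add_mul, Algebra.TensorProduct.tmul_mul_tmul, one_mul, mul_one,
      TensorProduct.add_tmul]
    abel
  rw [h2, h1, tensorElt_add, sub_eq_add_neg, neg_mul]

lemma one_tmul_commute (a : 𝓞 F) (s : R ⊗[ℤ] 𝓞 F) : Commute ((1 : R) ⊗ₜ[ℤ] a) s := by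
  induction s with
  | zero => exact Commute.zero_right _
  | tmul x b =>
    rw [Commute, SemiconjBy, Algebra.TensorProduct.tmul_mul_tmul,
      Algebra.TensorProduct.tmul_mul_tmul, one_mul, mul_one, mul_comm]
  | add s t hs ht => exact hs.add_right ht

/-- Torsion-freeness of R passes to coordinates; it allows the factor 4 relating the equations of √Δ
and θ to be cancelled. -/
lemma eq_zero_of_intCast_mul_tensor (h : IsQuadraticData D e sqrtD ω) (hN : IsNormForm N) {n : ℤ}
    (hn : n ≠ 0) {s : R ⊗[ℤ] 𝓞 F} (hs : (n : R ⊗[ℤ] 𝓞 F) * s = 0) : s = 0 := by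
  obtain ⟨x, y, rfl⟩ := exists_eq_tensorElt h s
  have h1 : (n : R ⊗[ℤ] 𝓞 F) * tensorElt ω x y = tensorElt ω (n * x) (n * y) := by
    simp only [← zsmul_eq_mul, tensorElt, smul_add, TensorProduct.smul_tmul']
  have h0 : (0 : R ⊗[ℤ] 𝓞 F) = tensorElt ω 0 0 := by simp [tensorElt]
  rw [h1, h0] at hs
  obtain ⟨hx, hy⟩ := tensorElt_inj h hs
  rw [hN.eq_zero_of_intCast_mul hn hx, hN.eq_zero_of_intCast_mul hn hy, ← h0]

lemma IsNormForm.mainInvolution_eq (hN : IsNormForm N) (x : R) :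
    mainInvolution x = (polarForm N x 1 : ℤ) - x := by
  rw [mainInvolution, hN.reducedTrace_eq]

/-- The main involution acting on the first factor of `R ⊗ O_F`. -/
lemma IsNormForm.exists_tensor_involution (hN : IsNormForm N) :
    ∃ J : (R ⊗[ℤ] 𝓞 F) →+ (R ⊗[ℤ] 𝓞 F),
      (∀ (x : R) (a : 𝓞 F), J (x ⊗ₜ[ℤ] a) = mainInvolution x ⊗ₜ[ℤ] a) ∧
      ∀ (a : 𝓞 F) (s : R ⊗[ℤ] 𝓞 F), J (1 ⊗ₜ[ℤ] a * s) = 1 ⊗ₜ[ℤ] a * J s := by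
  let c : R →+ R :=
    { toFun := mainInvolution
      map_zero' := by
        rw [hN.mainInvolution_eq, sub_zero]
        simp [polarForm, hN.apply_zero]
      map_add' := fun x y => by
        simp only [hN.mainInvolution_eq, hN.polarForm_add_left]
        push_cast
        abel }
  let J := (c.toIntLinearMap.rTensor (𝓞 F)).toAddMonoidHom
  have hJ : ∀ (x : R) (a : 𝓞 F), J (x ⊗ₜ[ℤ] a) = mainInvolution x ⊗ₜ[ℤ] a := fun x a =>
    LinearMap.rTensor_tmul _ _ _ _
  refine ⟨J, hJ, fun a s => ?_⟩
  induction s with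
  | zero => rw [mul_zero, map_zero, mul_zero]
  | tmul x b =>
    rw [hJ, Algebra.TensorProduct.tmul_mul_tmul, Algebra.TensorProduct.tmul_mul_tmul, hJ, one_mul,
      one_mul]
  | add s t hs ht => rw [mul_add, map_add, map_add, hs, ht, mul_add]

variable {x y : ℤ}

lemma IsNormForm.mul_self_of_trace_eq_zero (hN : IsNormForm N) {δ : R}
    (hδ : polarForm N δ 1 = 0) : δ * δ = ((-N δ : ℤ) : R) := by
  have := hN.sq_sub_mul_add δ
  rw [hδ, Int.cast_zero, zero_mul, sub_zero] at this
  rw [Int.cast_neg]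
  exact eq_neg_of_add_eq_zero_left this

lemma tensorElt_mul_self (h : IsQuadraticData D e sqrtD ω) (hN : IsNormForm N) {δ β : R}
    (hδ : polarForm N δ 1 = 0) (hβ : polarForm N β 1 = 0) :
    tensorElt ω δ β * tensorElt ω δ β = tensorElt ω ((-N δ + D * e * N β : ℤ) : R)
      ((-polarForm N δ β - D * N β : ℤ) : R) := by
  have h1 := hN.mul_add_mul δ β
  rw [hδ, hβ, Int.cast_zero, zero_mul, zero_mul, add_zero, zero_sub] at h1
  rw [tensorElt_mul h, h1, hN.mul_self_of_trace_eq_zero hδ, hN.mul_self_of_trace_eq_zero hβ]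
  push_cast
  congr 1 <;> noncomm_ring

/-- For trace zero, δ², β² and δβ + βδ are integers, so (δ + βω)² lies in O_F and equality with Δ is
a comparison of integral coordinates. -/
lemma isRootPair_iff (h : IsQuadraticData D e sqrtD ω) (hN : IsNormForm N) {δ β : R} :
    IsRootPair N D e x y δ β ↔ polarForm N δ 1 = 0 ∧ polarForm N β 1 = 0 ∧
      tensorElt ω δ β * tensorElt ω δ β = (1 : R) ⊗ₜ[ℤ] ((x : 𝓞 F) + y * ω) := by
  constructor
  · rintro ⟨hδ, hβ, hx, hy⟩
    rw [tensorElt_mul_self h hN hδ hβ, ← hx, ← hy, tmul_add_mul, mul_one, mul_one]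
    exact ⟨hδ, hβ, rfl⟩
  · rintro ⟨hδ, hβ, hs⟩
    rw [tensorElt_mul_self h hN hδ hβ, tmul_add_mul, mul_one, mul_one] at hs
    obtain ⟨hx, hy⟩ := tensorElt_inj h hs
    exact ⟨hδ, hβ, (hN.intCast_injective hx).symm, (hN.intCast_injective hy).symm⟩

end Tensor

/-! ### Embeddings of O_K and the correspondence -/

section Embedding

open NumberField NumberField.IsCMField

variable {F K : Type*} [Field F] [NumberField F] [Field K] [NumberField K] [IsCMField K]
  [Algebra F K] {D e : ℕ} {sqrtD ω Δ w : 𝓞 F} {sqrtΔ θ : 𝓞 K}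

namespace IsCMData

/-- A ring homomorphism on `O_K` may be prescribed by its central restriction to `O_F` and a root
of the minimal equation of `θ`. -/
lemma exists_ringHom {S : Type*} [Ring S] (hK : IsCMData Δ sqrtΔ θ w)
    (h : IsQuadraticData D e sqrtD ω) (r : 𝓞 F →+* S) (hr : ∀ a s, Commute (r a) s) {η : 𝓞 F}
    (hθ : θ * θ = algebraMap (𝓞 F) (𝓞 K) η + algebraMap (𝓞 F) (𝓞 K) w * θ) {α : S}
    (hα : α * α = r η + r w * α) :
    ∃ f : 𝓞 K →+* S, (∀ a, f (algebraMap (𝓞 F) (𝓞 K) a) = r a) ∧ f θ = α := by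
  choose a b hab using hK.exists_eq
  -- Coordinates are unique, so the map can be evaluated through any expression a' + b'θ of z.
  have key : ∀ z a' b', z = algebraMap (𝓞 F) (𝓞 K) a' + algebraMap (𝓞 F) (𝓞 K) b' * θ →
      r (a z) + r (b z) * α = r a' + r b' * α := by
    intro z a' b' hz
    obtain ⟨h1, h2⟩ := hK.eq_of_add_mul_eq h ((hab z).symm.trans hz)
    rw [h1, h2]
  refine ⟨{ toFun := fun z => r (a z) + r (b z) * α, map_one' := ?_, map_mul' := ?_,
            map_zero' := ?_, map_add' := ?_ }, fun c => ?_, ?_⟩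
  · rw [key 1 1 0 (by simp)]; simp
  · intro z z'
    rw [key (z * z') (a z * a z' + b z * b z' * η)
      (a z * b z' + b z * a z' + b z * b z' * w)]
    · have h1 := (hr (a z') α).eq
      have h2 := (hr (b z') α).eq
      have h3 : r (b z) * α * (r (b z') * α) = r (b z) * r (b z') * (α * α) := by
        rw [mul_assoc, ← mul_assoc α, ← h2]; simp only [mul_assoc]
      have h4 : r (b z) * α * r (a z') = r (b z) * r (a z') * α := by
        rw [mul_assoc, ← h1, mul_assoc]
      rw [mul_add, add_mul, add_mul, h3, h4, hα]
      simp only [map_add, map_mul, mul_add, add_mul, mul_assoc]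
      abel
    · conv_lhs => rw [hab z, hab z']
      simp only [map_add, map_mul]
      linear_combination algebraMap (𝓞 F) (𝓞 K) (b z) * algebraMap (𝓞 F) (𝓞 K) (b z') * hθ
  · rw [key 0 0 0 (by simp)]; simp
  · intro z z'
    rw [key (z + z') (a z + a z') (b z + b z')]
    · simp only [map_add, add_mul]; abel
    · conv_lhs => rw [hab z, hab z']
      simp only [map_add]; ring
  · exact (key _ c 0 (by simp)).trans (by simp)
  · exact (key _ 0 1 (by simp)).trans (by simp)

lemma injective_of_injective {S : Type*} [Ring S] (hK : IsCMData Δ sqrtΔ θ w)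
    (h : IsQuadraticData D e sqrtD ω) {f : 𝓞 K →+* S}
    (hf : Function.Injective fun a => f (algebraMap (𝓞 F) (𝓞 K) a)) : Function.Injective f := by
  obtain ⟨η, -, hη⟩ := hK.exists_theta_sq h
  refine (injective_iff_map_eq_zero f).mpr fun z hz => ?_
  obtain ⟨a, b, hab⟩ := hK.exists_eq z
  -- The relative norm of z lies in O_F, where f is injective; if f z = 0 it vanishes, and so does
  -- z.
  have h1 : z * ringOfIntegersComplexConj K z =
      algebraMap (𝓞 F) (𝓞 K) (a ^ 2 + a * b * w - b ^ 2 * η) := by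
    rw [hab]
    simp only [map_add, map_mul, map_sub, map_pow, h.conj_algebraMap, hK.conj_theta h]
    linear_combination -(algebraMap (𝓞 F) (𝓞 K) b) ^ 2 * hη
  have h2 : a ^ 2 + a * b * w - b ^ 2 * η = 0 := by
    apply hf
    simp only
    rw [← h1, map_mul, hz, zero_mul, map_zero, map_zero]
  rw [h2, map_zero] at h1
  exact (mul_eq_zero.mp h1).elim id fun h3 => by simpa using h3

end IsCMData

variable {R : Type*} [Ring R] {N : R → ℤ} {x y w₀ w₁ : ℤ}

/-- The image of `√Δ` under an embedding. -/
lemma map_sqrt_eq (hK : IsCMData Δ sqrtΔ θ ((w₀ : 𝓞 F) + w₁ * ω))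
    {f : 𝓞 K →+* R ⊗[ℤ] 𝓞 F} (hf : ∀ a : 𝓞 F, f (algebraMap (𝓞 F) (𝓞 K) a) = 1 ⊗ₜ[ℤ] a)
    {α₀ β₀ : R} (hθ : f θ = tensorElt ω α₀ β₀) :
    f sqrtΔ = tensorElt ω (2 * α₀ - w₀) (2 * β₀ - w₁) := by
  have h1 : sqrtΔ = θ + θ - algebraMap (𝓞 F) (𝓞 K) ((w₀ : 𝓞 F) + w₁ * ω) := by
    linear_combination -hK.two_mul
  rw [h1, map_sub, map_add, hf, tmul_add_mul, hθ, tensorElt_add, tensorElt_sub,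
    mul_one, mul_one, ← two_mul, ← two_mul]

lemma isRootPair_of_mem_conjEmbeddings (hK : IsCMData Δ sqrtΔ θ ((w₀ : 𝓞 F) + w₁ * ω))
    (h : IsQuadraticData D e sqrtD ω) (hN : IsNormForm N) (hΔ : Δ = x + y * ω)
    {f : 𝓞 K →+* R ⊗[ℤ] 𝓞 F} (hf : f ∈ conjEmbeddings R F K) {α₀ β₀ : R}
    (hθ : f θ = tensorElt ω α₀ β₀) : IsRootPair N D e x y (2 * α₀ - w₀) (2 * β₀ - w₁) := by
  obtain ⟨-, hfa, J, hJ, hJf⟩ := hf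
  have hs := map_sqrt_eq hK hfa hθ
  have hconj := hJf sqrtΔ
  rw [hK.conj_sqrt h, map_neg, hs, tensorElt_neg, tensorElt, map_add, hJ, hJ, ← tensorElt] at hconj
  obtain ⟨h1, h2⟩ := tensorElt_inj h hconj
  -- Conjugation negates √Δ, so the involution negates both coordinates, and δ̄ = tr(δ) - δ = -δ
  -- means trace zero.
  have htrace : ∀ {δ : R}, mainInvolution δ = -δ → polarForm N δ 1 = 0 := by
    intro δ hδ
    rw [hN.mainInvolution_eq, sub_eq_add_neg, add_eq_right] at hδ
    exact hN.intCast_injective (by rw [hδ, Int.cast_zero])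
  refine (isRootPair_iff h hN).mpr ⟨htrace h1, htrace h2, ?_⟩
  rw [← hs, ← map_mul, ← sq, hK.sq_sqrt, hfa, hΔ]

lemma exists_mem_conjEmbeddings (hK : IsCMData Δ sqrtΔ θ ((w₀ : 𝓞 F) + w₁ * ω))
    (h : IsQuadraticData D e sqrtD ω) (hN : IsNormForm N) (hΔ : Δ = x + y * ω) {α₀ β₀ : R}
    (hroot : IsRootPair N D e x y (2 * α₀ - w₀) (2 * β₀ - w₁)) :
    ∃ f ∈ conjEmbeddings R F K, f θ = tensorElt ω α₀ β₀ := by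
  obtain ⟨w, hw⟩ : ∃ w : 𝓞 F, w = (w₀ : 𝓞 F) + w₁ * ω := ⟨_, rfl⟩
  rw [← hw] at hK
  obtain ⟨η, hη, hθ⟩ := hK.exists_theta_sq h
  set α : R ⊗[ℤ] 𝓞 F := tensorElt ω α₀ β₀ with hα
  let r : 𝓞 F →+* R ⊗[ℤ] 𝓞 F := (Algebra.TensorProduct.includeRight : 𝓞 F →ₐ[ℤ] R ⊗[ℤ] 𝓞 F)
  have hr : ∀ a, r a = 1 ⊗ₜ[ℤ] a := fun a => rfl
  have hrw : r w = tensorElt ω (w₀ : R) (w₁ : R) := by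
    rw [hr, hw, tmul_add_mul, mul_one, mul_one]
  have hcomm : ∀ a s, Commute (r a) s := one_tmul_commute
  obtain ⟨htδ, htβ, hsq⟩ := (isRootPair_iff h hN).mp hroot
  have hδβ : tensorElt ω (2 * α₀ - w₀) (2 * β₀ - w₁) = 2 * α - r w := by
    rw [hrw, hα, two_mul (tensorElt _ _ _), tensorElt_add, tensorElt_sub, ← two_mul, ← two_mul]
  have hαα : α * α = r η + r w * α := by
    -- Four times the required equation is (2α - w)² = Δ = w² + 4η, expanded with w central.
    refine sub_eq_zero.mp (eq_zero_of_intCast_mul_tensor h hN (n := 4) (by norm_num) ?_)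
    rw [hδβ, ← hΔ, ← hr, hη, map_add, map_mul, map_pow, map_ofNat] at hsq
    have h1 := (hcomm w α).eq
    have h4 : ∀ s : R ⊗[ℤ] 𝓞 F, 4 * s = s + s + (s + s) := fun s => by
      rw [show (4 : R ⊗[ℤ] 𝓞 F) = 2 + 2 by norm_num, add_mul, two_mul]
    have h2 : (2 * α - r w) * (2 * α - r w) = 4 * (α * α) - 4 * (r w * α) + r w ^ 2 := by
      simp only [h4, two_mul, sq, mul_sub, sub_mul, mul_add, add_mul, ← h1]
      abel
    rw [h2] at hsq
    rw [Int.cast_ofNat, mul_sub, mul_add]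
    have h3 := sub_eq_zero.mpr hsq
    rw [← h3]
    abel
  obtain ⟨f, hfa, hfθ⟩ := hK.exists_ringHom h r hcomm hθ hαα
  have hr_inj : Function.Injective r := by
    intro a b hab
    obtain ⟨a₁, a₂, rfl⟩ := h.exists_eq_add_mul a
    obtain ⟨b₁, b₂, rfl⟩ := h.exists_eq_add_mul b
    rw [hr, hr, tmul_add_mul, tmul_add_mul, mul_one, mul_one, mul_one, mul_one] at hab
    obtain ⟨h1, h2⟩ := tensorElt_inj h hab
    rw [hN.intCast_injective h1, hN.intCast_injective h2]
  obtain ⟨J, hJ, hJmul⟩ := hN.exists_tensor_involution (F := F)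
  refine ⟨f, ⟨hK.injective_of_injective h (by simpa only [hfa] using hr_inj), hfa, J, hJ, ?_⟩, hfθ⟩
  have hJ1 : J 1 = 1 := by
    rw [Algebra.TensorProduct.one_def, hJ, hN.mainInvolution_eq, hN.polarForm_one_one]
    norm_num
  have hJα : J α = r w - α := by
    rw [hN.trace_two_mul_sub] at htδ htβ
    have e1 : polarForm N α₀ 1 = w₀ := by linarith
    have e2 : polarForm N β₀ 1 = w₁ := by linarith
    rw [hα, tensorElt, map_add, hJ, hJ, ← tensorElt, ← tensorElt, hN.mainInvolution_eq, hN.mainInvolution_eq,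
      e1, e2, hrw, tensorElt_sub]
  intro z
  obtain ⟨a, b, rfl⟩ := hK.exists_eq z
  have hJr : J (r a) = r a := by
    have := hJmul a 1
    rwa [mul_one, hJ1, mul_one] at this
  simp only [map_add, map_mul, h.conj_algebraMap, hK.conj_theta h, hfa, hfθ, map_sub]
  rw [hJr, hr b, hJmul, hJα]

lemma conjEmbeddings_ext (hK : IsCMData Δ sqrtΔ θ w) {f g : conjEmbeddings R F K}
    (hfg : f.1 θ = g.1 θ) : f = g := by
  refine Subtype.ext (RingHom.ext fun z => ?_)
  obtain ⟨a, b, rfl⟩ := hK.exists_eq z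
  rw [map_add, map_add, map_mul, map_mul, f.2.2.1, f.2.2.1, g.2.2.1, g.2.2.1, hfg]

/-- The correspondence among embeddings, pairs in the Gross lattice and pairs in the order, for a
ring with a norm form that is divisible by `p` on commutators. -/
theorem existsUnique_equiv {p : ℕ} (hK : IsCMData Δ sqrtΔ θ ((w₀ : 𝓞 F) + w₁ * ω))
    (h : IsQuadraticData D e sqrtD ω) (hN : IsNormForm N)
    (hp : ∀ α β, (p : ℤ) ∣ N (α * β - β * α)) (hΔ4 : Algebra.norm ℤ Δ ≡ 1 [ZMOD 4])
    (hsq : ∀ m : ℤ, Algebra.norm ℤ Δ ≠ m ^ 2) :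
    ∃! c : (conjEmbeddings R F K ≃ latticePairs R p D sqrtD Δ) ×
        (conjEmbeddings R F K ≃ orderPairs R p D sqrtD Δ w₀ w₁),
      ∀ ι : conjEmbeddings R F K,
        ι.1 θ = (c.2 ι).1.1 ⊗ₜ[ℤ] (1 : 𝓞 F) + (c.2 ι).1.2 ⊗ₜ[ℤ] ω ∧
        ι.1 sqrtΔ = (c.1 ι).1.1 ⊗ₜ[ℤ] (1 : 𝓞 F) + (c.1 ι).1.2 ⊗ₜ[ℤ] ω ∧
        (c.1 ι).1.1 = 2 * (c.2 ι).1.1 - (w₀ : R) ∧ (c.1 ι).1.2 = 2 * (c.2 ι).1.2 - (w₁ : R) := by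
  obtain ⟨x, y, hΔ⟩ := h.exists_eq_add_mul Δ
  choose α β hαβ using fun ι : conjEmbeddings R F K => exists_eq_tensorElt h (ι.1 θ)
  have hroot ι := isRootPair_of_mem_conjEmbeddings hK h hN hΔ ι.2 (hαβ ι)
  have hinj {ι κ} (h1 : α ι = α κ) (h2 : β ι = β κ) : ι = κ :=
    conjEmbeddings_ext hK (by rw [hαβ, hαβ, h1, h2])
  have hsurj {α₀ β₀ : R} (h1 : IsRootPair N D e x y (2 * α₀ - w₀) (2 * β₀ - w₁)) :
      ∃ ι, α ι = α₀ ∧ β ι = β₀ := by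
    obtain ⟨f, hf, hfθ⟩ := exists_mem_conjEmbeddings hK h hN hΔ h1
    exact ⟨⟨f, hf⟩, tensorElt_inj h ((hαβ ⟨f, hf⟩).symm.trans hfθ)⟩
  have hcancel {u v : R} {a : ℤ} (huv : 2 * u - (a : R) = 2 * v - a) : u = v := by
    refine sub_eq_zero.mp (hN.eq_zero_of_intCast_mul (n := 2) two_ne_zero ?_)
    rw [Int.cast_ofNat, mul_sub, sub_eq_zero]
    exact sub_left_injective huv
  let c₁ : conjEmbeddings R F K → latticePairs R p D sqrtD Δ := fun ι =>
    ⟨(2 * α ι - w₀, 2 * β ι - w₁), (hroot ι).mem_latticePairs h hN hp hΔ hΔ4 hsq⟩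
  let c₂ : conjEmbeddings R F K → orderPairs R p D sqrtD Δ w₀ w₁ := fun ι =>
    ⟨(α ι, β ι), (isRootPair_iff_mem_orderPairs h hN hp hΔ hΔ4 hsq).mp (hroot ι)⟩
  have hc₁ : Function.Bijective c₁ := by
    refine ⟨fun ι κ hικ => ?_, fun ⟨⟨δ, γ⟩, hmem⟩ => ?_⟩
    · have h1 := congrArg Subtype.val hικ
      exact hinj (hcancel (congrArg Prod.fst h1)) (hcancel (congrArg Prod.snd h1))
    · obtain ⟨η, hη, -⟩ := hK.exists_theta_sq h
      obtain ⟨α₀, β₀, rfl, rfl, h1⟩ := exists_eq_of_mem_latticePairs h hN hΔ hη hmem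
      obtain ⟨ι, rfl, rfl⟩ := hsurj h1
      exact ⟨ι, rfl⟩
  have hc₂ : Function.Bijective c₂ := by
    refine ⟨fun ι κ hικ => ?_, fun ⟨⟨α₀, β₀⟩, hmem⟩ => ?_⟩
    · have h1 := congrArg Subtype.val hικ
      exact hinj (congrArg Prod.fst h1) (congrArg Prod.snd h1)
    · obtain ⟨ι, rfl, rfl⟩ :=
        hsurj ((isRootPair_iff_mem_orderPairs h hN hp hΔ hΔ4 hsq).mpr hmem)
      exact ⟨ι, rfl⟩
  refine ⟨(Equiv.ofBijective c₁ hc₁, Equiv.ofBijective c₂ hc₂), fun ι =>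
    ⟨hαβ ι, map_sqrt_eq hK ι.2.2.1 (hαβ ι), rfl, rfl⟩, ?_⟩
  rintro ⟨d₁, d₂⟩ hd
  refine Prod.ext (Equiv.ext fun ι => ?_) (Equiv.ext fun ι => ?_)
  · obtain ⟨-, h2, -, -⟩ := hd ι
    obtain ⟨h3, h4⟩ := tensorElt_inj h (h2.symm.trans (map_sqrt_eq hK ι.2.2.1 (hαβ ι)))
    exact Subtype.ext (Prod.ext h3 h4)
  · obtain ⟨h1, -, -, -⟩ := hd ι
    obtain ⟨h3, h4⟩ := tensorElt_inj h (h1.symm.trans (hαβ ι))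
    exact Subtype.ext (Prod.ext h3 h4)

end Embedding
end GrossLattice

theorem mainTheorem10
    -- a supersingular elliptic curve over an algebraic closure of `𝔽_p`
    (p : ℕ) [Fact p.Prime] [DecidableEq (AlgebraicClosure (ZMod p))]
    (E : WeierstrassCurve (AlgebraicClosure (ZMod p))) [E.IsElliptic]
    (hE : GrossLattice.IsSupersingular E p)
    -- the real quadratic field `F = ℚ(√D)`, with `ω = (D + √D) / 2`
    (D : ℕ) (hD : D.Prime) (hD4 : D ≡ 1 [MOD 4])
    (F : Type*) [Field F] [NumberField F] (hF : Module.finrank ℚ F = 2)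
    (sqrtD ω : 𝓞 F) (hsqrtD : sqrtD ^ 2 = (D : 𝓞 F)) (hω : 2 * ω = (D : 𝓞 F) + sqrtD)
    -- the non-biquadratic quartic CM field `K = F(√Δ)`
    (K : Type*) [Field K] [NumberField K] [NumberField.IsCMField K] [Algebra F K]
    (hK : Module.finrank ℚ K = 4) (hbiquad : ¬ IsKleinFour (K ≃ₐ[ℚ] K))
    (Δ : 𝓞 F) (sqrtΔ : 𝓞 K) (hsqrtΔ : sqrtΔ ^ 2 = algebraMap (𝓞 F) (𝓞 K) Δ)
    -- `O_K = O_F + O_F θ` with `θ = (w + √Δ) / 2` and `w = w₀ + w₁ ω`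
    (w₀ w₁ : ℤ) (θ : 𝓞 K)
    (hθ : 2 * θ = algebraMap (𝓞 F) (𝓞 K) ((w₀ : 𝓞 F) + (w₁ : 𝓞 F) * ω) + sqrtΔ)
    (hOK : ∀ z : 𝓞 K, ∃ a b : 𝓞 F,
      z = algebraMap (𝓞 F) (𝓞 K) a + algebraMap (𝓞 F) (𝓞 K) b * θ)
    -- `D̃ = ΔΔ'` is square free and congruent to `1` modulo `4`
    (hDt4 : Algebra.norm ℤ Δ ≡ 1 [ZMOD 4]) (hDtsq : Squarefree (Algebra.norm ℤ Δ)) :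
    ∃! c : (GrossLattice.conjEmbeddings (GrossLattice.EndRing E) F K ≃
          GrossLattice.latticePairs (GrossLattice.EndRing E) p D sqrtD Δ) ×
        (GrossLattice.conjEmbeddings (GrossLattice.EndRing E) F K ≃
          GrossLattice.orderPairs (GrossLattice.EndRing E) p D sqrtD Δ w₀ w₁),
      ∀ ι : GrossLattice.conjEmbeddings (GrossLattice.EndRing E) F K,
        ι.1 θ = (c.2 ι).1.1 ⊗ₜ[ℤ] (1 : 𝓞 F) + (c.2 ι).1.2 ⊗ₜ[ℤ] ω ∧
        ι.1 sqrtΔ = (c.1 ι).1.1 ⊗ₜ[ℤ] (1 : 𝓞 F) + (c.1 ι).1.2 ⊗ₜ[ℤ] ω ∧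
        (c.1 ι).1.1 = 2 * (c.2 ι).1.1 - (w₀ : GrossLattice.EndRing E) ∧
        (c.1 ι).1.2 = 2 * (c.2 ι).1.2 - (w₁ : GrossLattice.EndRing E) := by
  obtain ⟨N, hN, hp⟩ := GrossLattice.exists_isNormForm_endRing hE
  have hD1 : D = 4 * (D / 4) + 1 := by
    have : D % 4 = 1 := hD4
    omega
  have h : GrossLattice.IsQuadraticData D (D / 4) sqrtD ω := ⟨hD, hD1, hF, hsqrtD, hω⟩
  have hK' : GrossLattice.IsCMData Δ sqrtΔ θ ((w₀ : 𝓞 F) + (w₁ : 𝓞 F) * ω) :=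
    ⟨hsqrtΔ, hθ, hOK⟩
  -- K is not biquadratic, so ΔΔ' is not a square.
  exact GrossLattice.existsUnique_equiv hK' h hN hp hDt4
    fun m hm => hbiquad (hK'.isKleinFour h hK hm)
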